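/- Let $E$ be a Radon space and let $(X,Y)=(\Omega,\mathcal F,\mathcal F_t,(X_t,Y_t),\theta_t,\mathbf P_{(x,y)})$ be a Markov additive process: an $\mathbb R\times E$-valued right process without killing such that $X$ has càdlàg paths and $\mathbf E_{(x,y)}[f(X_t,Y_t)]=\mathbf E_{(0,y)}[f(X_t+x,Y_t)]$ for all $(x,y)\in\mathbb R\times E$, $t\ge 0$ and measurable $f\ge 0$. Assume $\sup_{y\in E}\mathbf E_{(0,y)}\big[\sup_{s\in[0,1]}|X_s|\big]<\infty$. Let $\beta>1$, $q>0$, let $\mathbf q:E\to(q,\infty)$ be measurable, put $\mathfrak q(t)=\int_0^t\mathbf q(Y_s)\,ds$, and assume that, $\mathbf P_{(x,y)}$-a.s. for every $(x,y)$, $\mathfrak q(t)<\infty$ for all $t\ge0$. Let $N^{(1)},N^{(2)},\dots$ be Poisson processes of intensity $1$ that are $(\mathcal F_t)$-adapted and, under every $\mathbf P_{(x,y)}$, independent of each other and of $(X,Y)$; put $\hat N^{(n)}=\sum_{k=1}^nN^{(k)}$, a Poisson process of intensity $n$. A strategy is a pair $\pi=(L^\pi,R^\pi)$ of $(\mathcal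 F_t)$-adapted, non-negative, non-decreasing, càdlàg processes such that, $\mathbf P_{(x,y)}$-a.s. for every $(x,y)$, $X_t-L^\pi_t+R^\pi_t\ge0$ for all $t\ge 0$. It is admissible if $\mathbf E_{(x,y)}\big[\int_{[0,\infty)}e^{-\mathfrak q(t)}\,dR^\pi_t\big]<\infty$ for all $(x,y)$ (the integrals include the masses $L^\pi_0$, $R^\pi_0$ at time $0$). Its value is $$v_\pi(x,y)=\mathbf E_{(x,y)}\Big[\int_{[0,\infty)}e^{-\mathfrak q(t)}\,dL^\pi_t\Big]-\beta\,\mathbf E_{(x,y)}\Big[\int_{[0,\infty)}e^{-\mathfrak q(t)}\,dR^\pi_t\Big].$$ Let $V(x,y)$ be the supremum of $v_\pi(x,y)$ over all admissible strategies (the classical-classical value function), and, for $n\ge1$, let $V^{\mathrm P,n}(x,y)$ be the supremum of $v_\pi(x,y)$ over those admissible strategies for which there is a non-negative $(\mathcal F_t)$-adapted process $\ell$ with $L^\pi_t=\int_{[0,t]}\ell_s\,d\hat N^{(n)}_s$ for all $t\ge0$, $\mathbf P_{(x,y)}$-a.s. for every $(x,y)$ (the periodic-classical value function with Poissonian dividend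 opportunities of intensity $n$). Then $V$ and all $V^{\mathrm P,n}$, $n\ge1$, are finite, and for every $(x,y)\in\mathbb R\times E$, $$V^{\mathrm P,n}(x,y)\uparrow V(x,y)\qquad\text{as }n\uparrow\infty .$$ Moreover, $x\mapsto V(x,y)$ is concave on $\mathbb R$ for every $y\in E$. -/

import Mathlib

open MeasureTheory ProbabilityTheory Filter Set
open scoped NNReal ENNReal Topology

noncomputable section

namespace Dividend

/-- Universally measurable extended non-negative functions: measurable with respect to the
completion of every finite measure. -/
def UniversallyMeasurable {S : Type*} [MeasurableSpace S] (f : S → ℝ≥0∞) : Prop :=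
  ∀ μ : Measure S, IsFiniteMeasure μ → AEMeasurable f μ

/-- A Radon space: a space homeomorphic to a universally measurable subset of a compact metric
space. -/
class RadonSpace (E : Type*) [TopologicalSpace E] : Prop where
  exists_embedding : ∃ (K : Type) (_ : MetricSpace K) (_ : CompactSpace K)
    (_ : MeasurableSpace K) (_ : BorelSpace K) (f : E → K), Topology.IsEmbedding f ∧
      ∀ μ : Measure K, IsFiniteMeasure μ → NullMeasurableSet (range f) μ

/-- `f` is `α`-excessive for the semigroup `P_t f(z) = E_z[f(Z_t)]`:
`e^{-αt} P_t f ≤ f`, and `e^{-αt} P_t f → f` pointwise as `t ↓ 0`. -/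
structure IsExcessive {S Ω : Type*} [MeasurableSpace S] [MeasurableSpace Ω]
    (Z : ℝ≥0 → Ω → S) (P : S → Measure Ω) (α : ℝ) (f : S → ℝ≥0∞) : Prop where
  universallyMeasurable : UniversallyMeasurable f
  le : ∀ (t : ℝ≥0) (z : S),
    ENNReal.ofReal (Real.exp (-(α * t))) * ∫⁻ ω, f (Z t ω) ∂(P z) ≤ f z
  tendsto : ∀ z : S, Tendsto
    (fun t : ℝ≥0 => ENNReal.ofReal (Real.exp (-(α * t))) * ∫⁻ ω, f (Z t ω) ∂(P z))
    (𝓝[>] 0) (𝓝 (f z))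

/-- A right process `(Ω, 𝓕, 𝓕_t, Z_t, θ_t, P_z)` without killing on the state space `S`.
The transition kernels are only required to be universally measurable, and no usual conditions
are imposed on the filtration, which may be larger than the one generated by `Z`. -/
structure RightProcess (S Ω : Type*) [TopologicalSpace S] [MeasurableSpace S]
    [mΩ : MeasurableSpace Ω] where
  /-- the filtration `𝓕_t` -/
  filt : Filtration ℝ≥0 mΩ
  /-- the process `Z_t` -/
  Z : ℝ≥0 → Ω → S
  /-- the shift operators `θ_t` -/
  shift : ℝ≥0 → Ω → Ω
  /-- the law of the process started from a given state -/
  P : S → Measure Ω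
  isProb : ∀ z, IsProbabilityMeasure (P z)
  adapted : ∀ t, Measurable[filt t] (Z t)
  rightCont : ∀ (ω : Ω) (t : ℝ≥0), ContinuousWithinAt (fun s => Z s ω) (Ici t) t
  shift_eq : ∀ (s t : ℝ≥0) (ω : Ω), Z s (shift t ω) = Z (t + s) ω
  start : ∀ z, ∀ᵐ ω ∂(P z), Z 0 ω = z
  kernel : ∀ (t : ℝ≥0) (A : Set S), MeasurableSet A →
    UniversallyMeasurable (fun z => P z {ω | Z t ω ∈ A})
  /-- the Markov property relative to `𝓕_t` -/
  markov : ∀ (z : S) (s t : ℝ≥0) (f : S → ℝ≥0∞), Measurable f →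
    ∀ A : Set Ω, MeasurableSet[filt s] A →
      ∫⁻ ω in A, f (Z (s + t) ω) ∂(P z) =
        ∫⁻ ω in A, (∫⁻ ω', f (Z t ω') ∂(P (Z s ω))) ∂(P z)
  /-- excessive functions are almost surely right-continuous along the paths -/
  excessive_rightCont : ∀ (α : ℝ) (f : S → ℝ≥0∞), 0 < α → IsExcessive Z P α f →
    ∀ z, ∀ᵐ ω ∂(P z), ∀ t : ℝ≥0, ContinuousWithinAt (fun s => f (Z s ω)) (Ici t) t

/-- A Markov additive process `(X, Y)`: an `ℝ × E`-valued right process without killing whose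
first component has càdlàg paths and which satisfies
`E_{(x,y)}[f(X_t, Y_t)] = E_{(0,y)}[f(X_t + x, Y_t)]`. -/
structure MAP (E Ω : Type*) [TopologicalSpace E] [MeasurableSpace E] [MeasurableSpace Ω]
    extends RightProcess (ℝ × E) Ω where
  leftLim : ∀ (ω : Ω) (t : ℝ≥0), ∃ l : ℝ, Tendsto (fun s => (Z s ω).1) (𝓝[<] t) (𝓝 l)
  additive : ∀ (x : ℝ) (y : E) (t : ℝ≥0) (f : ℝ × E → ℝ≥0∞), Measurable f →
    ∫⁻ ω, f (Z t ω) ∂(P (x, y)) = ∫⁻ ω, f ((Z t ω).1 + x, (Z t ω).2) ∂(P (0, y))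

/-- The Lebesgue–Stieltjes measure `dg` on `[0, ∞)` of a non-negative, non-decreasing,
right-continuous path `g`, with the convention `g(0-) = 0`: it has mass `g 0` at `0`. -/
def pathMeasure (g : StieltjesFunction ℝ≥0) : Measure ℝ≥0 :=
  ENNReal.ofReal (g 0) • Measure.dirac 0 + g.measure

section

variable {E Ω : Type*} [TopologicalSpace E] [MeasurableSpace E] [MeasurableSpace Ω]

namespace MAP

/-- the additive component -/
def X (M : MAP E Ω) (t : ℝ≥0) (ω : Ω) : ℝ := (M.Z t ω).1

/-- the modulating component -/
def Y (M : MAP E Ω) (t : ℝ≥0) (ω : Ω) : E := (M.Z t ω).2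

end MAP

/-- The cumulative discount `∫_0^t q(Y_s) ds ∈ [0, ∞]`. -/
def cumDiscount (M : MAP E Ω) (q : E → ℝ) (t : ℝ≥0) (ω : Ω) : ℝ≥0∞ :=
  ∫⁻ s in Icc (0 : ℝ) t, ENNReal.ofReal (q (M.Y s.toNNReal ω))

/-- The discount factor `exp(-∫_0^t q(Y_s) ds)`. -/
def discount (M : MAP E Ω) (q : E → ℝ) (t : ℝ≥0) (ω : Ω) : ℝ≥0∞ :=
  EReal.exp (-(cumDiscount M q t ω : EReal))

/-- A strategy: a pair `(L, R)` of non-negative, non-decreasing, càdlàg adapted processes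
(cumulative dividends and cumulative capital injections) such that `X - L + R` stays
non-negative, almost surely under every `P_{(x,y)}`. Monotonicity and right-continuity of the
paths are carried by `StieltjesFunction`; left limits then exist by monotonicity. -/
structure Strategy (M : MAP E Ω) where
  /-- cumulative dividends -/
  L : Ω → StieltjesFunction ℝ≥0
  /-- cumulative capital injections -/
  R : Ω → StieltjesFunction ℝ≥0
  L_nonneg : ∀ ω t, 0 ≤ L ω t
  R_nonneg : ∀ ω t, 0 ≤ R ω t
  L_adapted : ∀ t, Measurable[M.filt t] (fun ω => L ω t)
  R_adapted : ∀ t, Measurable[M.filt t] (fun ω => R ω t)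
  solvent : ∀ z, ∀ᵐ ω ∂(M.P z), ∀ t, 0 ≤ M.X t ω - L ω t + R ω t

namespace Strategy

variable {M : MAP E Ω}

/-- `E_{(x,y)}[∫_{[0,∞)} e^{-∫_0^t q(Y_s)ds} dL_t]` -/
def vL (π : Strategy M) (q : E → ℝ) (z : ℝ × E) : ℝ≥0∞ :=
  ∫⁻ ω, (∫⁻ t, discount M q t ω ∂(pathMeasure (π.L ω))) ∂(M.P z)

/-- `E_{(x,y)}[∫_{[0,∞)} e^{-∫_0^t q(Y_s)ds} dR_t]` -/
def vR (π : Strategy M) (q : E → ℝ) (z : ℝ × E) : ℝ≥0∞ :=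
  ∫⁻ ω, (∫⁻ t, discount M q t ω ∂(pathMeasure (π.R ω))) ∂(M.P z)

/-- Admissibility: the expected discounted injections are finite from every initial state. -/
def Admissible (π : Strategy M) (q : E → ℝ) : Prop :=
  ∀ z, π.vR q z < ⊤

/-- The expected net present value `v^L - β v^R` (for an admissible strategy, `v^R < ∞`). -/
def value (π : Strategy M) (q : E → ℝ) (β : ℝ) (z : ℝ × E) : EReal :=
  (π.vL q z : EReal) - (β : EReal) * (π.vR q z : EReal)

/-- Dividends are paid only at the jump times of the counting process with paths `N`:
`L_t = ∫_{[0,t]} ℓ_s dN_s` for a non-negative adapted process `ℓ`. -/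
def PaysAtJumpsOf (π : Strategy M) (N : Ω → StieltjesFunction ℝ≥0) : Prop :=
  ∃ ℓ : ℝ≥0 → Ω → ℝ≥0, (∀ t, Measurable[M.filt t] (ℓ t)) ∧
    ∀ z, ∀ᵐ ω ∂(M.P z), ∀ t : ℝ≥0,
      ENNReal.ofReal (π.L ω t) = ∫⁻ s in Icc 0 t, (ℓ s ω : ℝ≥0∞) ∂(pathMeasure (N ω))

end Strategy

/-- A family of independent Poisson processes of intensity `1`, adapted to the filtration of
`(X, Y)` and independent of `(X, Y)`, under every `P_{(x,y)}`. -/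
structure PoissonClocks (M : MAP E Ω) where
  /-- the counting processes -/
  N : ℕ → ℝ≥0 → Ω → ℕ
  adapted : ∀ k t, Measurable[M.filt t] (N k t)
  mono : ∀ k ω, Monotone (fun t => N k t ω)
  rightCont : ∀ k ω t, ContinuousWithinAt (fun s => N k s ω) (Ici t) t
  zero : ∀ k z, ∀ᵐ ω ∂(M.P z), N k 0 ω = 0
  indepIncrements : ∀ k z, HasIndepIncrements (N k) (M.P z)
  law : ∀ k z (s t : ℝ≥0), s ≤ t →
    (M.P z).map (fun ω => N k t ω - N k s ω) = poissonMeasure (t - s)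
  indep : ∀ z, iIndepFun (fun (k : ℕ) (ω : Ω) (t : ℝ≥0) => N k t ω) (M.P z)
  indep_MAP : ∀ z, IndepFun (fun (ω : Ω) (p : ℕ × ℝ≥0) => N p.1 p.2 ω)
    (fun (ω : Ω) (t : ℝ≥0) => M.Z t ω) (M.P z)

/-- The path of the superposition of the first `n` clocks (a Poisson process of intensity `n`). -/
def PoissonClocks.superposition {M : MAP E Ω} (C : PoissonClocks M) (n : ℕ) (ω : Ω) :
    StieltjesFunction ℝ≥0 where
  toFun t := ∑ k ∈ Finset.range n, (C.N k t ω : ℝ)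
  mono' _ _ hst := Finset.sum_le_sum fun k _ => Nat.cast_le.mpr (C.mono k ω hst)
  right_continuous' t := by
    refine tendsto_finsetSum _ fun k _ => ?_
    exact (continuous_of_discreteTopology (f := fun j : ℕ => (j : ℝ))).continuousAt.tendsto.comp
      (C.rightCont k ω t)

/-- The value function of the problem in which dividends and injections may be made at any
time. -/
def valueCC (M : MAP E Ω) (q : E → ℝ) (β : ℝ) (z : ℝ × E) : EReal :=
  ⨆ (π : Strategy M) (_ : π.Admissible q), π.value q β z

/-- The value function of the problem in which dividends may be paid only at the jump times of
the Poisson process of intensity `n`. -/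
def valuePoisson (M : MAP E Ω) (C : PoissonClocks M) (q : E → ℝ) (β : ℝ) (n : ℕ)
    (z : ℝ × E) : EReal :=
  ⨆ (π : Strategy M) (_ : π.Admissible q ∧ π.PaysAtJumpsOf (C.superposition n)), π.value q β z

end

end Dividend

end

noncomputable section

namespace Dividend

/-! Since the discount rate exceeds `q₀ > 0`, the discount factor at `t` is the integral over `[t,
∞)` of the density `dens` = (rate × discount). Tonelli then turns the discounted integral of `dL`
into the integral of `L_s` against `dens` (`lintegral_discount_pathMeasure`, `Standing.vL_eq`). Thus
`L` and `R` enter the value linearly and only through their values at fixed times.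

Finiteness. Solvency gives `L ≤ |X| + R`, and `β > 1` absorbs `R`, so every value is at most the
discounted integral of a bound for the running maximum of `|X|`. That bound is a sum of suprema over
unit intervals, whose means are uniformly bounded by the Markov property and homogeneity, against
geometrically decaying discounts (`discInt_envelope_lt_top`). Paying nothing and injecting minimally
gives a finite lower bound.

Convergence. Keep the injections of a strategy and delay its dividends to the next jump of the
superposition (`Strategy.postpone`). Dividends only decrease, so solvency survives. Almost surely
the jumps become dense as `n` grows, hence the delayed dividends tend to the original ones at every
continuity point, and Fatou's lemma gives convergence of the value
(`Standing.tendsto_value_postpone`). Monotonicity holds because the jumps of a smaller superposition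
are jumps of a larger one.

Concavity. Strategies from two starting points cannot be mixed directly, since the filtration may
carry more than the path of `(X, Y)`. Dividends, delayed to a grid and truncated, are therefore
replaced by conditional expectations given the path; by the Markov property these depend only on the
path up to the grid time (`exists_stopped_weight`). This does not raise the cost of injections
(`Strategy.exists_gridDividend`). The result is a functional of paths, so it can be evaluated along
the translated paths `(X + a₁, Y)` and `(X + a₂, Y)`, which under one law have the laws started from
the two points (`lintegral_shiftPath`). A convex combination of the two dividend streams needs at
most the same combination of the injections; then the grid is refined. -/

/-! ### Discount factors and integration by parts along a single path. -/

/-- Lebesgue measure on `[0, ∞)`. -/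
def nnVol : Measure ℝ≥0 := (volume.restrict (Ici (0 : ℝ))).map Real.toNNReal

/-- `exp(-x)` for `x ∈ [0, ∞]`. -/
def expNeg (x : ℝ≥0∞) : ℝ≥0∞ := EReal.exp (-(x : EReal))

lemma nnVol_Iic (t : ℝ≥0) : nnVol (Iic t) = t := by
  rw [nnVol, Measure.map_apply measurable_real_toNNReal measurableSet_Iic,
    Measure.restrict_apply (measurable_real_toNNReal measurableSet_Iic)]
  have : Real.toNNReal ⁻¹' Iic t ∩ Ici 0 = Icc 0 (t : ℝ) := by
    ext s
    simp only [mem_inter_iff, mem_preimage, mem_Iic, mem_Ici, mem_Icc, Real.toNNReal_le_iff_le_coe]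
    exact and_comm
  simp [this]

lemma setLIntegral_Iic_nnVol (h : ℝ≥0 → ℝ≥0∞) (hm : Measurable h) (t : ℝ≥0) :
    ∫⁻ s in Iic t, h s ∂nnVol = ∫⁻ s in Icc (0 : ℝ) t, h s.toNNReal := by
  rw [nnVol, setLIntegral_map measurableSet_Iic hm measurable_real_toNNReal,
    Measure.restrict_restrict (measurable_real_toNNReal measurableSet_Iic)]
  congr 2
  ext s
  simp only [mem_inter_iff, mem_preimage, mem_Iic, mem_Ici, mem_Icc, Real.toNNReal_le_iff_le_coe]
  exact and_comm

lemma measure_ext_of_Iic {μ ν : Measure ℝ≥0} (h : ∀ t, μ (Iic t) = ν (Iic t))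
    (hfin : ∀ t, μ (Iic t) ≠ ⊤) : μ = ν := by
  refine Measure.ext_of_generateFrom_of_iUnion (range Iic) (fun n : ℕ => Iic (n : ℝ≥0))
    ?_ isPiSystem_Iic ?_ (fun n => mem_range_self _) (fun n => hfin _) ?_
  · rw [← borel_eq_generateFrom_Iic]
    exact BorelSpace.measurable_eq
  · exact iUnion_eq_univ_iff.2 fun x => exists_nat_ge x
  · rintro _ ⟨t, rfl⟩
    exact h t

instance : SFinite nnVol := by unfold nnVol; infer_instance

instance : NullSingletonClass nnVol where
  measure_singleton x := by
    rw [nnVol, Measure.map_apply measurable_real_toNNReal (measurableSet_singleton x),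
      Measure.restrict_apply (measurable_real_toNNReal (measurableSet_singleton x))]
    refine measure_mono_null (t := {(x : ℝ)}) ?_ (by simp)
    rintro s ⟨hs, hs0⟩
    simp only [mem_preimage, mem_singleton_iff] at hs
    simp [← hs, Real.coe_toNNReal s hs0]

lemma measurable_expNeg : Measurable expNeg :=
  EReal.exp_monotone.measurable.comp (measurable_coe_ennreal_ereal.neg)

lemma expNeg_antitone : Antitone expNeg := fun _ _ h =>
  EReal.exp_monotone (EReal.neg_le_neg_iff.2 (EReal.coe_ennreal_le_coe_ennreal_iff.2 h))

lemma expNeg_ofReal {x : ℝ} (hx : 0 ≤ x) : expNeg (ENNReal.ofReal x) =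
    ENNReal.ofReal (Real.exp (-x)) := by
  rw [expNeg, EReal.coe_ennreal_ofReal, max_eq_left hx, ← EReal.coe_neg, EReal.exp_coe]

lemma expNeg_coe (x : ℝ≥0) : expNeg x = ENNReal.ofReal (Real.exp (-x)) := by
  rw [← ENNReal.ofReal_coe_nnreal, expNeg_ofReal x.coe_nonneg]

lemma expNeg_le_one (x : ℝ≥0∞) : expNeg x ≤ 1 := by
  simpa [expNeg] using EReal.coe_ennreal_nonneg x

lemma setLIntegral_Ici_expNeg (u : ℝ≥0) : ∫⁻ v in Ici u, expNeg v ∂nnVol = expNeg u := by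
  have hm : Measurable fun v : ℝ≥0 => expNeg v := measurable_expNeg.comp measurable_coe_nnreal_ennreal
  have hset : Real.toNNReal ⁻¹' Ici u ∩ Ici 0 = Ici (u : ℝ) := by
    ext s
    simp only [mem_inter_iff, mem_preimage, mem_Ici]
    constructor
    · rintro ⟨h1, h2⟩
      exact (Real.le_toNNReal_iff_coe_le h2).1 h1
    · intro h
      have h2 : 0 ≤ s := u.2.trans h
      exact ⟨(Real.le_toNNReal_iff_coe_le h2).2 h, h2⟩
  rw [nnVol, setLIntegral_map measurableSet_Ici hm measurable_real_toNNReal,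
    Measure.restrict_restrict (measurable_real_toNNReal measurableSet_Ici), hset, expNeg_coe,
    ← integral_exp_neg_Ioi, ← integral_Ici_eq_integral_Ioi, ofReal_integral_eq_lintegral_ofReal]
  · refine setLIntegral_congr_fun measurableSet_Ici fun s hs => ?_
    simp only [expNeg_coe, Real.coe_toNNReal s (u.2.trans hs)]
  · exact (integrableOn_Ici_iff_integrableOn_Ioi).2 (integrableOn_exp_neg_Ioi _)
  · exact ae_of_all _ fun s => (Real.exp_pos _).le

section accumulated

variable {h : ℝ≥0 → ℝ≥0∞}

lemma continuous_setLIntegral_Iic (hm : Measurable h)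
    (hfin : ∀ t, ∫⁻ s in Iic t, h s ∂nnVol < ⊤) :
    Continuous fun t => ∫⁻ s in Iic t, h s ∂nnVol := by
  refine continuous_iff_continuousAt.2 fun t => ?_
  simp_rw [ContinuousAt, ← lintegral_indicator measurableSet_Iic]
  refine tendsto_lintegral_filter_of_dominated_convergence ((Iic (t + 1)).indicator h)
    (.of_forall fun _ => hm.indicator measurableSet_Iic) ?_ ?_ ?_
  · filter_upwards [Iic_mem_nhds (lt_add_one t)] with r hr
    exact ae_of_all _ fun a => indicator_le_indicator_of_subset (Iic_subset_Iic.2 hr)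
      (fun _ => zero_le) a
  · rw [lintegral_indicator measurableSet_Iic]
    exact (hfin _).ne
  · have : ∀ᵐ a ∂nnVol, a ≠ t := by
      rw [ae_iff]
      simp
    filter_upwards [this] with a ha
    refine tendsto_const_nhds.congr' ?_
    rcases lt_or_gt_of_ne ha with h1 | h1
    · filter_upwards [Ioi_mem_nhds h1] with r hr
      rw [indicator_of_mem (show a ∈ Iic t from h1.le), indicator_of_mem (show a ∈ Iic r from (mem_Ioi.1 hr).le)]
    · filter_upwards [Iio_mem_nhds h1] with r hr
      rw [indicator_of_notMem (by simpa using h1), indicator_of_notMem (by simpa using hr)]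

/-- The change of variables `v = ∫_0^s h` in `∫_t^∞ h(s) exp(-∫_0^s h) ds`. -/
lemma setLIntegral_Ici_mul_expNeg (hm : Measurable h) {c : ℝ≥0} (hc : 0 < c)
    (hlb : ∀ s, c ≤ h s) (hfin : ∀ t, ∫⁻ s in Iic t, h s ∂nnVol < ⊤) (t : ℝ≥0) :
    ∫⁻ s in Ici t, h s * expNeg (∫⁻ r in Iic s, h r ∂nnVol) ∂nnVol =
      expNeg (∫⁻ r in Iic t, h r ∂nnVol) := by
  set H : ℝ≥0 → ℝ≥0∞ := fun t => ∫⁻ s in Iic t, h s ∂nnVol with hH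
  have hcont : Continuous H := continuous_setLIntegral_Iic hm hfin
  have hstrict : StrictMono H := by
    intro a b hab
    have h1 : H b = H a + ∫⁻ s in Ioc a b, h s ∂nnVol := by
      rw [hH, ← lintegral_union measurableSet_Ioc]
      · simp [Iic_union_Ioc_eq_Iic hab.le]
      · exact (Iic_disjoint_Ioc le_rfl)
    have h2 : 0 < ∫⁻ s in Ioc a b, h s ∂nnVol := by
      have h3 : nnVol (Ioc a b) ≠ 0 := by
        intro h0
        have : nnVol (Iic b) ≤ nnVol (Iic a) + nnVol (Ioc a b) := by
          rw [← Iic_union_Ioc_eq_Iic hab.le]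
          exact measure_union_le _ _
        rw [h0, nnVol_Iic, nnVol_Iic, add_zero, ENNReal.coe_le_coe] at this
        exact absurd this (not_le.2 hab)
      calc 0 < ∫⁻ s in Ioc a b, (c : ℝ≥0∞) ∂nnVol := by
            rw [setLIntegral_const]
            exact ENNReal.mul_pos (by exact_mod_cast hc.ne') h3
        _ ≤ _ := lintegral_mono fun s => hlb s
    rw [h1]
    exact ENNReal.lt_add_right (hfin a).ne h2.ne'
  -- The lower bound on the rate makes `H` unbounded; with continuity and `H 0 = 0` it attains every
  -- finite value.
  have hlow : ∀ t, c * t ≤ H t := fun t => by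
    calc (c * t : ℝ≥0∞) = ∫⁻ s in Iic t, (c : ℝ≥0∞) ∂nnVol := by
          rw [setLIntegral_const, nnVol_Iic]
      _ ≤ H t := lintegral_mono fun s => hlb s
  have h0 : H 0 = 0 := by
    have h00 : Iic (0 : ℝ≥0) = {0} := by ext; simp
    rw [hH]
    simp only [h00]
    exact setLIntegral_measure_zero _ _ (measure_singleton _)
  have hsurj : ∀ b : ℝ≥0, ∃ s, H s = b := fun b => by
    have : (b : ℝ≥0∞) ∈ range H := mem_range_of_exists_le_of_exists_ge hcont
      ⟨0, by simp [h0]⟩ ⟨b / c, by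
        refine le_trans ?_ (hlow _)
        rw [← ENNReal.coe_mul, mul_div_cancel₀ _ hc.ne']⟩
    exact this
  set G : ℝ≥0 → ℝ≥0 := fun t => (H t).toNNReal with hG
  have hGH : ∀ t, (G t : ℝ≥0∞) = H t := fun t => ENNReal.coe_toNNReal (hfin t).ne
  have hGmono : StrictMono G := fun a b hab => by
    have := hstrict hab
    rwa [← hGH, ← hGH, ENNReal.coe_lt_coe] at this
  have hGmeas : Measurable G := hGmono.monotone.measurable
  -- `G` carries `h ds` to Lebesgue measure: the set where `G ≤ b` is the interval up to the time at
  -- which `H` reaches `b`.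
  have hmap : (nnVol.withDensity h).map G = nnVol := by
    refine measure_ext_of_Iic (fun b => ?_) (fun b => ?_) |>.symm
    · obtain ⟨s, hs⟩ := hsurj b
      have hGs : G s = b := by
        rw [← ENNReal.coe_inj, hGH, hs]
      have hpre : G ⁻¹' Iic b = Iic s := by
        ext r
        rw [mem_preimage, mem_Iic, ← hGs, hGmono.le_iff_le, mem_Iic]
      rw [Measure.map_apply hGmeas measurableSet_Iic, hpre, withDensity_apply _ measurableSet_Iic,
        nnVol_Iic, ← hs]
    · rw [nnVol_Iic]
      exact ENNReal.coe_ne_top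
  have hpreI : G ⁻¹' Ici (G t) = Ici t := by
    ext r
    rw [mem_preimage, mem_Ici, hGmono.le_iff_le, mem_Ici]
  have hmE : Measurable fun v : ℝ≥0 => expNeg v := measurable_expNeg.comp measurable_coe_nnreal_ennreal
  calc ∫⁻ s in Ici t, h s * expNeg (H s) ∂nnVol
      = ∫⁻ s in Ici t, expNeg (G s) ∂(nnVol.withDensity h) := by
        rw [restrict_withDensity measurableSet_Ici,
          lintegral_withDensity_eq_lintegral_mul _ hm
            (show Measurable fun s => expNeg (G s) from hmE.comp hGmeas)]
        exact lintegral_congr fun s => by simp [hGH]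
    _ = ∫⁻ v in Ici (G t), expNeg v ∂((nnVol.withDensity h).map G) := by
        rw [setLIntegral_map measurableSet_Ici hmE hGmeas, hpreI]
    _ = expNeg (H t) := by rw [hmap, setLIntegral_Ici_expNeg, hGH]

lemma measurable_mul_expNeg_setLIntegral_Iic (hm : Measurable h) :
    Measurable fun s => h s * expNeg (∫⁻ r in Iic s, h r ∂nnVol) := by
  refine hm.mul (measurable_expNeg.comp (Monotone.measurable fun a b hab => ?_))
  exact lintegral_mono_set (Iic_subset_Iic.2 hab)

/-- The Stieltjes measure has no mass at the bottom point `0`; the added atom supplies exactly `g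
0`. -/
lemma pathMeasure_Iic (g : StieltjesFunction ℝ≥0) (h0 : 0 ≤ g 0) (t : ℝ≥0) :
    pathMeasure g (Iic t) = ENNReal.ofReal (g t) := by
  have h1 : Iic t = insert 0 (Ioc 0 t) := by
    ext s
    simp only [mem_Iic, mem_insert_iff, mem_Ioc]
    rcases eq_or_ne s 0 with rfl | hs
    · simp
    · simp [hs, pos_iff_ne_zero]
  have h2 : g.measure {0} = 0 := by
    have := g.measure_botSet
    rwa [botSet_eq_singleton_of_isBot (x := (0 : ℝ≥0)) (fun _ => zero_le)] at this
  have h3 : g.measure (Iic t) = ENNReal.ofReal (g t - g 0) := by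
    rw [h1, insert_eq, measure_union (by simp) measurableSet_Ioc, h2, zero_add,
      StieltjesFunction.measure_Ioc]
  rw [pathMeasure, Measure.add_apply, h3, Measure.smul_apply,
    Measure.dirac_apply' _ measurableSet_Iic, indicator_of_mem (by simp), Pi.one_apply,
    smul_eq_mul, mul_one, ← ENNReal.ofReal_add h0 (sub_nonneg.2 (g.mono zero_le)),
    add_sub_cancel]

instance (g : StieltjesFunction ℝ≥0) : SFinite (pathMeasure g) := by
  unfold pathMeasure; infer_instance

/-- Integration by parts for the discounted integral of a non-decreasing path. -/
lemma lintegral_expNeg_pathMeasure (hm : Measurable h) {c : ℝ≥0} (hc : 0 < c)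
    (hlb : ∀ s, c ≤ h s) (hfin : ∀ t, ∫⁻ s in Iic t, h s ∂nnVol < ⊤)
    (g : StieltjesFunction ℝ≥0) (h0 : 0 ≤ g 0) :
    ∫⁻ t, expNeg (∫⁻ r in Iic t, h r ∂nnVol) ∂(pathMeasure g) =
      ∫⁻ s, ENNReal.ofReal (g s) * (h s * expNeg (∫⁻ r in Iic s, h r ∂nnVol)) ∂nnVol := by
  set d : ℝ≥0 → ℝ≥0∞ := fun s => h s * expNeg (∫⁻ r in Iic s, h r ∂nnVol) with hd
  have hdm : Measurable d := measurable_mul_expNeg_setLIntegral_Iic hm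
  calc ∫⁻ t, expNeg (∫⁻ r in Iic t, h r ∂nnVol) ∂(pathMeasure g)
      = ∫⁻ t, ∫⁻ s, (Ici t).indicator d s ∂nnVol ∂(pathMeasure g) := by
        refine lintegral_congr fun t => ?_
        rw [lintegral_indicator measurableSet_Ici, ← setLIntegral_Ici_mul_expNeg hm hc hlb hfin]
    _ = ∫⁻ s, ∫⁻ t, (Ici t).indicator d s ∂(pathMeasure g) ∂nnVol := lintegral_lintegral_swap ?_
    _ = ∫⁻ s, ENNReal.ofReal (g s) * d s ∂nnVol := by
        refine lintegral_congr fun s => ?_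
        have : (fun t => (Ici t).indicator d s) = (Iic s).indicator fun _ => d s := by
          ext t
          simp [indicator_apply]
        rw [this, lintegral_indicator_const measurableSet_Iic, pathMeasure_Iic g h0, mul_comm]
  · refine Measurable.aemeasurable ?_
    have : (Function.uncurry fun t s : ℝ≥0 => (Ici t).indicator d s) =
        {p : ℝ≥0 × ℝ≥0 | p.1 ≤ p.2}.indicator fun p => d p.2 := by
      ext p
      simp [Function.uncurry, indicator_apply]
    rw [this]
    exact (hdm.comp measurable_snd).indicator (measurableSet_le measurable_fst measurable_snd)

end accumulated

/-! ### Joint measurability of right-continuous processes. -/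

/-- Rounding up to the next grid point approaches `t` from the right, the only side on which
right-continuity gives information. -/
lemma tendsto_floor_add_one_div (t : ℝ≥0) :
    Tendsto (fun n : ℕ => ((⌊(n + 1 : ℝ≥0) * t⌋₊ : ℝ≥0) + 1) / (n + 1)) atTop (𝓝[≥] t) := by
  have hpos : ∀ n : ℕ, (0 : ℝ≥0) < n + 1 := fun n => by positivity
  refine tendsto_nhdsWithin_iff.2 ⟨?_, .of_forall fun n => ?_⟩
  · refine tendsto_of_tendsto_of_tendsto_of_le_of_le (g := fun _ => t)
      (h := fun n : ℕ => t + 1 / ((n : ℝ≥0) + 1)) tendsto_const_nhds ?_ (fun n => ?_) (fun n => ?_)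
    · have h1 : Tendsto (fun n : ℕ => 1 / ((n : ℝ≥0) + 1)) atTop (𝓝 0) := by
        rw [← NNReal.tendsto_coe]
        simpa using tendsto_one_div_add_atTop_nhds_zero_nat (𝕜 := ℝ)
      simpa using h1.const_add t
    · rw [le_div_iff₀ (hpos n), mul_comm]
      exact (Nat.lt_floor_add_one _).le
    · simp only []
      rw [div_le_iff₀ (hpos n), add_mul t, one_div, inv_mul_cancel₀ (hpos n).ne', mul_comm t]
      gcongr
      exact Nat.floor_le zero_le
  · rw [mem_Ici, le_div_iff₀ (hpos n), mul_comm]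
    exact (Nat.lt_floor_add_one _).le

/-- A right-continuous process is jointly measurable. -/
lemma measurable_uncurry_of_rightCont {Ω B : Type*} {mΩ : MeasurableSpace Ω} [TopologicalSpace B]
    [MeasurableSpace B] [BorelSpace B] [TopologicalSpace.PseudoMetrizableSpace B]
    {u : ℝ≥0 → Ω → B} (hu : ∀ t, Measurable (u t))
    (hr : ∀ ω t, ContinuousWithinAt (fun s => u s ω) (Ici t) t) :
    Measurable fun p : ℝ≥0 × Ω => u p.1 p.2 := by
  refine measurable_of_tendsto_metrizable
    (f := fun (n : ℕ) (p : ℝ≥0 × Ω) => u (((⌊(n + 1 : ℝ≥0) * p.1⌋₊ : ℝ≥0) + 1) / (n + 1)) p.2)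
    (fun n => ?_) (tendsto_pi_nhds.2 fun p => ?_)
  · have key : ∀ (v : ℕ → Ω → B), (∀ k, Measurable (v k)) → ∀ k : ℝ≥0 → ℕ, Measurable k →
        Measurable fun p : ℝ≥0 × Ω => v (k p.1) p.2 := fun v hv k hk =>
      (measurable_from_prod_countable_right hv : Measurable fun p : ℕ × Ω => v p.1 p.2).comp
        ((hk.comp measurable_fst).prodMk measurable_snd)
    exact key (fun k => u (((k : ℝ≥0) + 1) / (n + 1))) (fun k => hu _)
      (fun t => ⌊(n + 1 : ℝ≥0) * t⌋₊) (Nat.measurable_floor.comp (measurable_id.const_mul _))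
  · exact (hr p.2 p.1).tendsto.comp (tendsto_floor_add_one_div p.1)

section radon

variable (E : Type*) [TopologicalSpace E] [RadonSpace E]

/-- Metrizability is what makes pointwise limits of measurable `E`-valued maps measurable. -/
lemma RadonSpace.metrizableSpace : TopologicalSpace.MetrizableSpace E := by
  obtain ⟨K, _, _, _, _, f, hf, -⟩ := RadonSpace.exists_embedding (E := E)
  exact hf.metrizableSpace

end radon

/-! ### The discounting density and Fatou's lemma for dividends. -/

section density

variable {E Ω : Type*} [TopologicalSpace E] [MeasurableSpace E] [MeasurableSpace Ω]
  (M : MAP E Ω) (q : E → ℝ)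

/-- the density of the discounting measure `-d e^{-∫_0^t q(Y_s) ds}` -/
def dens (s : ℝ≥0) (ω : Ω) : ℝ≥0∞ := ENNReal.ofReal (q (M.Y s ω)) * discount M q s ω

/-- the discounted integral `E_z ∫_0^∞ g_s e^{-𝔮(s)} q(Y_s) ds` -/
def discInt (g : ℝ≥0 → Ω → ℝ≥0∞) (z : ℝ × E) : ℝ≥0∞ :=
  ∫⁻ ω, ∫⁻ s, g s ω * dens M q s ω ∂nnVol ∂(M.P z)

variable {M q}

lemma measurable_X (t : ℝ≥0) : Measurable[M.filt t] (M.X t) :=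
  measurable_fst.comp (M.adapted t)

lemma measurable_Y (t : ℝ≥0) : Measurable[M.filt t] (M.Y t) :=
  measurable_snd.comp (M.adapted t)

lemma rightCont_X (ω : Ω) (t : ℝ≥0) : ContinuousWithinAt (fun s => M.X s ω) (Ici t) t :=
  continuous_fst.continuousAt.comp_continuousWithinAt (M.rightCont ω t)

lemma rightCont_Y (ω : Ω) (t : ℝ≥0) : ContinuousWithinAt (fun s => M.Y s ω) (Ici t) t :=
  continuous_snd.continuousAt.comp_continuousWithinAt (M.rightCont ω t)

lemma dens_lt_top (s : ℝ≥0) (ω : Ω) : dens M q s ω < ⊤ :=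
  ENNReal.mul_lt_top ENNReal.ofReal_lt_top
    ((expNeg_le_one (cumDiscount M q s ω)).trans_lt ENNReal.one_lt_top)

lemma discInt_mono {g g' : ℝ≥0 → Ω → ℝ≥0∞} {z : ℝ × E}
    (h : ∀ᵐ ω ∂(M.P z), ∀ s, g s ω ≤ g' s ω) : discInt M q g z ≤ discInt M q g' z :=
  lintegral_mono_ae (h.mono fun ω hω => lintegral_mono fun s => by gcongr; exact hω s)

namespace Strategy

variable (π : Strategy M)

lemma measurable_L : Measurable fun p : ℝ≥0 × Ω => π.L p.2 p.1 :=
  measurable_uncurry_of_rightCont (fun t => (π.L_adapted t).mono (M.filt.le t) le_rfl)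
    fun ω t => (π.L ω).right_continuous t

lemma measurable_R : Measurable fun p : ℝ≥0 × Ω => π.R p.2 p.1 :=
  measurable_uncurry_of_rightCont (fun t => (π.R_adapted t).mono (M.filt.le t) le_rfl)
    fun ω t => (π.R ω).right_continuous t

end Strategy

variable [BorelSpace E] [RadonSpace E]

lemma measurable_rate {Ω' : Type*} {m : MeasurableSpace Ω'} {y : ℝ≥0 → Ω' → E}
    (hy : ∀ t, Measurable (y t))
    (hr : ∀ ω t, ContinuousWithinAt (fun s => y s ω) (Ici t) t) (hq : Measurable q) :
    Measurable fun p : ℝ≥0 × Ω' => ENNReal.ofReal (q (y p.1 p.2)) := by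
  have := RadonSpace.metrizableSpace E
  exact (hq.comp (measurable_uncurry_of_rightCont hy hr)).ennreal_ofReal

lemma measurable_rate_path (hq : Measurable q) (ω : Ω) :
    Measurable fun s => ENNReal.ofReal (q (M.Y s ω)) :=
  (measurable_rate (y := M.Y) (fun t => (measurable_Y t).mono (M.filt.le t) le_rfl)
    rightCont_Y hq).comp (measurable_id.prodMk measurable_const)

lemma cumDiscount_eq (hq : Measurable q) (t : ℝ≥0) (ω : Ω) :
    cumDiscount M q t ω = ∫⁻ s in Iic t, ENNReal.ofReal (q (M.Y s ω)) ∂nnVol :=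
  (setLIntegral_Iic_nnVol _ (measurable_rate_path hq ω) t).symm

lemma discount_eq (hq : Measurable q) (t : ℝ≥0) (ω : Ω) :
    discount M q t ω = expNeg (∫⁻ s in Iic t, ENNReal.ofReal (q (M.Y s ω)) ∂nnVol) := by
  rw [← cumDiscount_eq hq]; rfl

/-- The σ-algebra is left free so that the lemma also applies to the one generated by the path of
`Y` alone. -/
lemma measurable_pathDens {Ω' : Type*} {m : MeasurableSpace Ω'} {y : ℝ≥0 → Ω' → E}
    (hy : ∀ t, Measurable (y t))
    (hr : ∀ ω t, ContinuousWithinAt (fun s => y s ω) (Ici t) t) (hq : Measurable q) :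
    Measurable fun p : ℝ≥0 × Ω' => ENNReal.ofReal (q (y p.1 p.2)) *
      expNeg (∫⁻ s in Iic p.1, ENNReal.ofReal (q (y s p.2)) ∂nnVol) := by
  have hr := measurable_rate hy hr hq
  refine hr.mul (measurable_expNeg.comp ?_)
  simp_rw [← lintegral_indicator measurableSet_Iic]
  have : Measurable fun p : (ℝ≥0 × Ω') × ℝ≥0 =>
      (Iic p.1.1).indicator (fun s => ENNReal.ofReal (q (y s p.1.2))) p.2 := by
    have h1 : (fun p : (ℝ≥0 × Ω') × ℝ≥0 =>
        (Iic p.1.1).indicator (fun s => ENNReal.ofReal (q (y s p.1.2))) p.2) =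
        {p : (ℝ≥0 × Ω') × ℝ≥0 | p.2 ≤ p.1.1}.indicator
          fun p => ENNReal.ofReal (q (y p.2 p.1.2)) := by
      ext p
      simp [indicator_apply]
    rw [h1]
    exact (hr.comp (measurable_snd.prodMk (measurable_snd.comp measurable_fst))).indicator
      (measurableSet_le measurable_snd (measurable_fst.comp measurable_fst))
  exact this.lintegral_prod_right'

lemma measurable_dens (hq : Measurable q) : Measurable fun p : ℝ≥0 × Ω => dens M q p.1 p.2 := by
  simp only [dens, discount_eq hq]
  exact measurable_pathDens (fun t => (measurable_Y t).mono (M.filt.le t) le_rfl) rightCont_Y hq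

/-- The density of the discounting measure is a measurable functional of the path of `Y`. -/
lemma exists_dens_eq_comp (hq : Measurable q) (s : ℝ≥0) :
    ∃ Ψ : (ℝ≥0 → E) → ℝ≥0∞, Measurable Ψ ∧ ∀ ω, dens M q s ω = Ψ fun t => M.Y t ω := by
  let f : Ω → ℝ≥0 → E := fun ω t => M.Y t ω
  have h1 : Measurable[MeasurableSpace.pi.comap f] f := comap_measurable f
  have h2 : Measurable[MeasurableSpace.pi.comap f] (dens M q s) := by
    unfold dens
    simp only [discount_eq hq]
    -- Measurability relative to the σ-algebra of the path yields the factorization through the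
    -- path.
    exact (measurable_pathDens (m := MeasurableSpace.pi.comap f) (y := M.Y)
      (fun t => (measurable_pi_apply t).comp h1) rightCont_Y hq).comp
      (measurable_const.prodMk measurable_id)
  obtain ⟨Ψ, hΨ, h⟩ := h2.exists_eq_measurable_comp
  exact ⟨Ψ, hΨ, fun ω => congrFun h ω⟩

lemma setLIntegral_Ici_dens (hq : Measurable q) {q₀ : ℝ} (hq₀ : 0 < q₀) (hqq₀ : ∀ y, q₀ < q y)
    {ω : Ω} (hω : ∀ t, cumDiscount M q t ω < ⊤) (t : ℝ≥0) :
    ∫⁻ s in Ici t, dens M q s ω ∂nnVol = discount M q t ω := by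
  simp only [dens, discount_eq hq]
  refine setLIntegral_Ici_mul_expNeg (measurable_rate_path hq ω) (c := q₀.toNNReal) (by simpa)
    (fun s => ?_) (fun t => ?_) t
  · exact ENNReal.ofReal_le_ofReal (hqq₀ _).le
  · rw [← cumDiscount_eq hq]
    exact hω t

lemma lintegral_discount_pathMeasure (hq : Measurable q) {q₀ : ℝ} (hq₀ : 0 < q₀)
    (hqq₀ : ∀ y, q₀ < q y) {ω : Ω} (hω : ∀ t, cumDiscount M q t ω < ⊤)
    (g : StieltjesFunction ℝ≥0) (h0 : 0 ≤ g 0) :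
    ∫⁻ t, discount M q t ω ∂(pathMeasure g) = ∫⁻ s, ENNReal.ofReal (g s) * dens M q s ω ∂nnVol := by
  simp only [dens, discount_eq hq]
  refine lintegral_expNeg_pathMeasure (measurable_rate_path hq ω) (c := q₀.toNNReal) (by simpa)
    (fun s => ?_) (fun t => ?_) g h0
  · exact ENNReal.ofReal_le_ofReal (hqq₀ _).le
  · rw [← cumDiscount_eq hq]
    exact hω t

lemma discount_le (hq : Measurable q) {q₀ : ℝ} (hq₀ : 0 < q₀) (hqq₀ : ∀ y, q₀ < q y)
    (t : ℝ≥0) (ω : Ω) : discount M q t ω ≤ ENNReal.ofReal (Real.exp (-(q₀ * t))) := by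
  rw [discount_eq hq, ← expNeg_ofReal (by positivity)]
  refine expNeg_antitone ?_
  calc ENNReal.ofReal (q₀ * t) = ∫⁻ s in Iic t, ENNReal.ofReal q₀ ∂nnVol := by
        rw [setLIntegral_const, nnVol_Iic, ENNReal.ofReal_mul hq₀.le, ENNReal.ofReal_coe_nnreal]
    _ ≤ _ := lintegral_mono fun s => ENNReal.ofReal_le_ofReal (hqq₀ _).le

lemma discInt_eq_swap (hq : Measurable q) {g : ℝ≥0 → Ω → ℝ≥0∞}
    (hg : Measurable fun p : ℝ≥0 × Ω => g p.1 p.2) (z : ℝ × E) :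
    discInt M q g z = ∫⁻ s, ∫⁻ ω, g s ω * dens M q s ω ∂(M.P z) ∂nnVol := by
  have := M.isProb z
  exact lintegral_lintegral_swap (Measurable.aemeasurable
    (((hg.mul (measurable_dens hq)).comp measurable_swap)))

lemma measurable_lintegral_dens (hq : Measurable q) {g : ℝ≥0 → Ω → ℝ≥0∞}
    (hg : Measurable fun p : ℝ≥0 × Ω => g p.1 p.2) :
    Measurable fun ω => ∫⁻ s, g s ω * dens M q s ω ∂nnVol :=
  Measurable.lintegral_prod_right' (f := fun p : Ω × ℝ≥0 => g p.2 p.1 * dens M q p.2 p.1)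
    ((hg.mul (measurable_dens hq)).comp measurable_swap)

lemma discInt_add (hq : Measurable q) {g g' : ℝ≥0 → Ω → ℝ≥0∞}
    (hg : Measurable fun p : ℝ≥0 × Ω => g p.1 p.2) (z : ℝ × E) :
    discInt M q (fun s ω => g s ω + g' s ω) z = discInt M q g z + discInt M q g' z := by
  rw [discInt, discInt, discInt, ← lintegral_add_left (measurable_lintegral_dens hq hg)]
  refine lintegral_congr fun ω => ?_
  rw [← lintegral_add_left]
  · exact lintegral_congr fun s => add_mul _ _ _
  · exact (hg.mul (measurable_dens hq)).comp (measurable_id.prodMk measurable_const)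

/-- Fatou's lemma for dividends which are delayed and truncated. -/
lemma tendsto_discInt (hq : Measurable q) (L : Ω → StieltjesFunction ℝ≥0) (z : ℝ × E)
    (g : ℕ → ℝ≥0 → Ω → ℝ≥0∞) (hg : ∀ n, Measurable fun p : ℝ≥0 × Ω => g n p.1 p.2)
    (hle : ∀ n s ω, g n s ω ≤ ENNReal.ofReal (L ω s))
    (hlim : ∀ᵐ ω ∂(M.P z), ∀ u s, u < s → ∀ᶠ n : ℕ in atTop,
      min (ENNReal.ofReal (L ω u)) n ≤ g n s ω) :
    Tendsto (fun n => discInt M q (g n) z) atTop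
      (𝓝 (discInt M q (fun s ω => ENNReal.ofReal (L ω s)) z)) := by
  refine tendsto_of_le_liminf_of_limsup_le ?_ (limsup_le_of_le (h := .of_forall fun n =>
    discInt_mono (ae_of_all _ fun ω s => hle n s ω)))
  have hmeas : ∀ n ω, Measurable fun s => g n s ω * dens M q s ω := fun n ω =>
    ((hg n).mul (measurable_dens hq)).comp (measurable_id.prodMk measurable_const)
  calc discInt M q (fun s ω => ENNReal.ofReal (L ω s)) z
      ≤ ∫⁻ ω, liminf (fun n => ∫⁻ s, g n s ω * dens M q s ω ∂nnVol) atTop ∂(M.P z) := by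
        refine lintegral_mono_ae (hlim.mono fun ω hω => ?_)
        refine le_trans (lintegral_mono_ae ?_) (lintegral_liminf_le (fun n => hmeas n ω))
        -- A monotone path has countably many discontinuities. At any other `s > 0`, `L_u` with `u <
        -- s` is close to `L_s`, and the truncation level eventually exceeds it.
        have h1 : ∀ᵐ s ∂nnVol, ContinuousAt (L ω) s :=
          (L ω).mono.countable_not_continuousAt.ae_notMem nnVol |>.mono fun s hs => by
            simpa using hs
        have h2 : ∀ᵐ s ∂nnVol, s ≠ 0 := by
          rw [ae_iff]
          simp
        filter_upwards [h1, h2] with s hs hs0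
        have ht : Tendsto (fun n => g n s ω) atTop (𝓝 (ENNReal.ofReal (L ω s))) := by
          refine tendsto_of_le_liminf_of_limsup_le ?_
            (limsup_le_of_le (h := .of_forall fun n => hle n s ω))
          refine le_of_forall_lt fun c hc => ?_
          obtain ⟨c', hcc', hc'⟩ := exists_between hc
          have hcont : Tendsto (fun u => ENNReal.ofReal (L ω u)) (𝓝[<] s)
              (𝓝 (ENNReal.ofReal (L ω s))) :=
            (ENNReal.continuous_ofReal.tendsto _).comp (hs.tendsto.mono_left nhdsWithin_le_nhds)
          have : (𝓝[<] s).NeBot := nhdsLT_neBot_of_exists_lt ⟨0, pos_iff_ne_zero.2 hs0⟩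
          obtain ⟨u, hu, hus⟩ := ((hcont.eventually (lt_mem_nhds hc')).and
            self_mem_nhdsWithin).exists
          have hc't : c' ≠ ⊤ := (hc'.trans_le le_top).ne
          obtain ⟨N, hN⟩ := ENNReal.exists_nat_gt hc't
          refine hcc'.trans_le (le_liminf_of_le (h := ?_))
          filter_upwards [hω u s hus, eventually_ge_atTop N] with n hn hNn
          refine le_trans (le_min hu.le (hN.le.trans ?_)) hn
          exact_mod_cast hNn
        exact ((ENNReal.Tendsto.mul_const ht (Or.inr (dens_lt_top s ω).ne)).liminf_eq).ge
    _ ≤ liminf (fun n => discInt M q (g n) z) atTop :=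
        lintegral_liminf_le fun n => measurable_lintegral_dens hq (hg n)

end density

/-! ### The Markov property for functionals of the whole path. -/

/-- Equality of the integrals over the sets of a sub-σ-algebra extends to integrals with weights
which are measurable with respect to it. -/
lemma lintegral_mul_eq_of_setLIntegral_eq {Ω : Type*} {m mΩ : MeasurableSpace Ω} (hm : m ≤ mΩ)
    {μ : Measure Ω} {G G' : Ω → ℝ≥0∞} (hG : AEMeasurable G μ) (hG' : AEMeasurable G' μ)
    (h : ∀ A, MeasurableSet[m] A → ∫⁻ ω in A, G ω ∂μ = ∫⁻ ω in A, G' ω ∂μ)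
    {φ : Ω → ℝ≥0∞} (hφ : Measurable[m] φ) :
    ∫⁻ ω, φ ω * G ω ∂μ = ∫⁻ ω, φ ω * G' ω ∂μ := by
  have key : ∀ G : Ω → ℝ≥0∞, ∀ (c : ℝ≥0∞) (A : Set Ω), MeasurableSet[m] A → AEMeasurable G μ →
      ∫⁻ ω, A.indicator (fun _ => c) ω * G ω ∂μ = c * ∫⁻ ω in A, G ω ∂μ := by
    intro G c A hA hG
    rw [← lintegral_const_mul'' _ hG.restrict, ← lintegral_indicator (hm _ hA)]
    refine lintegral_congr fun ω => ?_
    by_cases hω : ω ∈ A <;> simp [hω]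
  refine Measurable.ennreal_induction
    (motive := fun φ => ∫⁻ ω, φ ω * G ω ∂μ = ∫⁻ ω, φ ω * G' ω ∂μ) ?_ ?_ ?_ hφ
  · intro c A hA
    rw [key G c A hA hG, key G' c A hA hG', h A hA]
  · intro f g _ hf _ ihf ihg
    have hf' : Measurable[mΩ] f := hf.mono hm le_rfl
    have hadd : ∀ G : Ω → ℝ≥0∞, AEMeasurable G μ → ∫⁻ ω, (f + g) ω * G ω ∂μ =
        ∫⁻ ω, f ω * G ω ∂μ + ∫⁻ ω, g ω * G ω ∂μ := fun G hG => by
      rw [← lintegral_add_left' (f := fun ω => f ω * G ω) (hf'.aemeasurable.mul hG)]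
      exact lintegral_congr fun ω => add_mul _ _ _
    rw [hadd G hG, hadd G' hG', ihf, ihg]
  · intro f hf hmono ih
    have hf' : ∀ n, Measurable[mΩ] (f n) := fun n => (hf n).mono hm le_rfl
    have hsup : ∀ G : Ω → ℝ≥0∞, AEMeasurable G μ → ∫⁻ ω, (⨆ n, f n ω) * G ω ∂μ =
        ⨆ n, ∫⁻ ω, f n ω * G ω ∂μ := fun G hG => by
      simp only [ENNReal.iSup_mul]
      exact lintegral_iSup' (f := fun n ω => f n ω * G ω) (fun n => (hf' n).aemeasurable.mul hG)
        (ae_of_all _ fun ω i j hij => mul_le_mul_left (hmono hij ω) _)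
    rw [hsup G hG, hsup G' hG', iSup_congr ih]

lemma lintegral_indicator_const_comp {α β : Type*} [MeasurableSpace α] [MeasurableSpace β]
    (μ : Measure α) {f : α → β} (hf : Measurable f) {A : Set β} (hA : MeasurableSet A) (c : ℝ≥0∞) :
    ∫⁻ a, A.indicator (fun _ => c) (f a) ∂μ = c * μ (f ⁻¹' A) := by
  rw [← lintegral_map (measurable_const.indicator hA) hf, lintegral_indicator_const hA,
    Measure.map_apply hf hA]

section markov

variable {S Ω : Type*} [MeasurableSpace S] {mΩ : MeasurableSpace Ω}

/-- The process `W` is Markov under `μ` with respect to the filtration `F`, with the transition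
function `z ↦ P_z[Z_t ∈ ·]`. -/
structure OneStep (Z : ℝ≥0 → Ω → S) (P : S → Measure Ω) (F : Filtration ℝ≥0 mΩ)
    (W : ℝ≥0 → Ω → S) (μ : Measure Ω) : Prop where
  adapted : ∀ t, Measurable[F t] (W t)
  eq : ∀ (s t : ℝ≥0) (f : S → ℝ≥0∞), Measurable f → ∀ A, MeasurableSet[F s] A →
    ∫⁻ ω in A, f (W (s + t) ω) ∂μ = ∫⁻ ω in A, (∫⁻ ω', f (Z t ω') ∂(P (W s ω))) ∂μ

/-- Product functional of a path observed at times with the given increments. -/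
def pathProd : List (ℝ≥0 × (S → ℝ≥0∞)) → ℝ≥0 → (ℝ≥0 → S) → ℝ≥0∞
  | [], _, _ => 1
  | (d, f) :: l, s, w => f (w (s + d)) * pathProd l (s + d) w

lemma measurable_pathProd (l : List (ℝ≥0 × (S → ℝ≥0∞))) (hl : ∀ p ∈ l, Measurable p.2) (s : ℝ≥0) :
    Measurable (pathProd l s) := by
  induction l generalizing s with
  | nil => exact measurable_const
  | cons p l ih =>
    exact ((hl p (by simp)).comp (measurable_pi_apply _)).mul
      (ih (fun p hp => hl p (by simp [hp])) _)

/-- Induction on the minimum lists the observation times in increasing order, so truncated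
subtraction gives true increments; `r` is the time already reached. -/
lemma exists_pathProd (B : ℝ≥0 → Set S) (hB : ∀ t, MeasurableSet (B t)) (I : Finset ℝ≥0) :
    ∀ r, (∀ t ∈ I, r ≤ t) → ∃ l : List (ℝ≥0 × (S → ℝ≥0∞)), (∀ p ∈ l, Measurable p.2) ∧
      ∀ w s, pathProd l (s + r) w =
        ((I : Set ℝ≥0).pi B).indicator (fun _ => 1) fun t => w (s + t) := by
  induction I using Finset.induction_on_min with
  | empty => exact fun r _ => ⟨[], by simp, fun w s => by simp [pathProd]⟩
  | insert t J htJ ih =>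
    intro r hr
    obtain ⟨l, hl, hlw⟩ := ih t fun u hu => (htJ u hu).le
    refine ⟨(t - r, (B t).indicator fun _ => 1) :: l, ?_, fun w s => ?_⟩
    · intro p hp
      rcases List.mem_cons.1 hp with rfl | hp
      · exact measurable_const.indicator (hB t)
      · exact hl p hp
    · have hrt : s + r + (t - r) = s + t := by
        rw [add_assoc, add_tsub_cancel_of_le (hr t (by simp))]
      simp only [pathProd, hrt, hlw]
      by_cases h1 : w (s + t) ∈ B t
      · by_cases h2 : (fun t => w (s + t)) ∈ (J : Set ℝ≥0).pi B
        · rw [indicator_of_mem h1, indicator_of_mem h2, indicator_of_mem, one_mul]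
          rw [Finset.coe_insert, insert_pi]
          exact ⟨h1, h2⟩
        · rw [indicator_of_mem h1, indicator_of_notMem h2, indicator_of_notMem, one_mul]
          rw [Finset.coe_insert, insert_pi]
          exact fun h => h2 (mem_inter_iff _ _ _ |>.1 h).2
      · rw [indicator_of_notMem h1, zero_mul, Finset.coe_insert, insert_pi, indicator_of_notMem]
        exact fun h => h1 (mem_inter_iff _ _ _ |>.1 h).1

variable {Z : ℝ≥0 → Ω → S} {P : S → Measure Ω} (hZ : ∀ t, Measurable (Z t))
  (hP : ∀ z, IsProbabilityMeasure (P z))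
  (hker : ∀ (t : ℝ≥0) (A : Set S), MeasurableSet A →
    UniversallyMeasurable (fun z => P z {ω | Z t ω ∈ A}))

include hZ hker in
lemma UniversallyMeasurable.lintegral_of_measurable {f : S → ℝ≥0∞} (hf : Measurable f) (t : ℝ≥0) :
    UniversallyMeasurable fun z => ∫⁻ ω, f (Z t ω) ∂(P z) := by
  intro μ hμ
  refine Measurable.ennreal_induction
    (motive := fun f => AEMeasurable (fun z => ∫⁻ ω, f (Z t ω) ∂(P z)) μ) ?_ ?_ ?_ hf
  · intro c A hA
    exact ((hker t A hA μ hμ).const_mul c).congr (ae_of_all _ fun z =>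
      (lintegral_indicator_const_comp (P z) (hZ t) hA c).symm)
  · intro f g _ hf _ ihf ihg
    exact (ihf.add ihg).congr (ae_of_all _ fun z =>
      (lintegral_add_left (μ := P z) (hf.comp (hZ t)) fun ω => g (Z t ω)).symm)
  · intro f hf hmono ih
    exact (AEMeasurable.iSup ih).congr (ae_of_all _ fun z =>
      (lintegral_iSup (μ := P z) (fun n => (hf n).comp (hZ t))
        (fun i j hij ω => hmono hij (Z t ω))).symm)

include hZ hP hker in
/-- The law at time `t` of the process started from the initial law `μ`. -/
lemma exists_measure_evolve (μ : Measure S) [IsFiniteMeasure μ] (t : ℝ≥0) :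
    ∃ ν : Measure S, IsFiniteMeasure ν ∧ ∀ A, MeasurableSet A →
      ν A = ∫⁻ z, P z {ω | Z t ω ∈ A} ∂μ := by
  let ν : Measure S := Measure.ofMeasurable (fun A _ => ∫⁻ z, P z {ω | Z t ω ∈ A} ∂μ)
    (by simp) (by
      intro A hA hd
      rw [← lintegral_tsum fun i => hker t _ (hA i) μ inferInstance]
      refine lintegral_congr fun z => ?_
      have : {ω | Z t ω ∈ ⋃ i, A i} = ⋃ i, Z t ⁻¹' A i := by ext; simp
      rw [this, measure_iUnion (fun i j hij => (hd hij).preimage _) fun i => hZ t (hA i)]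
      rfl)
  have hν : ∀ A, MeasurableSet A → ν A = ∫⁻ z, P z {ω | Z t ω ∈ A} ∂μ :=
    fun A hA => Measure.ofMeasurable_apply A hA
  refine ⟨ν, ⟨?_⟩, hν⟩
  rw [hν _ MeasurableSet.univ]
  simp

include hZ hP hker in
-- Modify `g` on a null set of the law at time `t` started from `μ`. For `μ`-almost every starting
-- point that set is also null for the law at time `t`, so the integral is unaffected.
lemma UniversallyMeasurable.lintegral {g : S → ℝ≥0∞} (hg : UniversallyMeasurable g) (t : ℝ≥0) :
    UniversallyMeasurable fun z => ∫⁻ ω, g (Z t ω) ∂(P z) := by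
  intro μ hμ
  obtain ⟨ν, hν, hνA⟩ := exists_measure_evolve hZ hP hker μ t
  have hg' := hg ν hν
  refine ((lintegral_of_measurable hZ hker hg'.measurable_mk t) μ hμ).congr ?_
  obtain ⟨N, hgN, hN, hN0⟩ := exists_measurable_superset_of_null (ae_iff.1 hg'.ae_eq_mk)
  rw [hνA N hN, lintegral_eq_zero_iff' (hker t N hN μ hμ)] at hN0
  filter_upwards [hN0] with z hz
  refine lintegral_congr_ae ?_
  refine measure_mono_null (fun ω hω => ?_) hz
  exact hgN (fun h => hω h.symm)

include hZ hker in
-- Applied to the null set where `g` differs from a measurable version, the one-step property itself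
-- shows that this set is almost surely null for the transition from `W s`.
lemma OneStep.eq_of_universallyMeasurable {F : Filtration ℝ≥0 mΩ} {W : ℝ≥0 → Ω → S}
    {μ : Measure Ω} [IsFiniteMeasure μ] (hW : OneStep Z P F W μ) {g : S → ℝ≥0∞}
    (hg : UniversallyMeasurable g) (s t : ℝ≥0) {A : Set Ω} (hA : MeasurableSet[F s] A) :
    ∫⁻ ω in A, g (W (s + t) ω) ∂μ = ∫⁻ ω in A, (∫⁻ ω', g (Z t ω') ∂(P (W s ω))) ∂μ := by
  have hWm : ∀ t, Measurable (W t) := fun t => (hW.adapted t).mono (F.le t) le_rfl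
  have hg' := hg (μ.map (W (s + t))) inferInstance
  obtain ⟨N, hgN, hN, hN0⟩ := exists_measurable_superset_of_null (ae_iff.1 hg'.ae_eq_mk)
  have h0 : ∀ᵐ ω ∂μ, P (W s ω) (Z t ⁻¹' N) = 0 := by
    have h1 := hW.eq s t (N.indicator fun _ => 1) (measurable_const.indicator hN) univ
      MeasurableSet.univ
    rw [Measure.restrict_univ] at h1
    have h2 : μ (W (s + t) ⁻¹' N) = 0 := by
      rw [← Measure.map_apply (hWm _) hN, hN0]
    simp only [lintegral_indicator_const_comp _ (hWm (s + t)) hN, one_mul, h2,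
      lintegral_indicator_const_comp _ (hZ t) hN] at h1
    have h3 : AEMeasurable (fun ω => P (W s ω) (Z t ⁻¹' N)) μ :=
      (hker t N hN (μ.map (W s)) inferInstance).comp_measurable (hWm s)
    exact (lintegral_eq_zero_iff' h3).1 h1.symm
  calc ∫⁻ ω in A, g (W (s + t) ω) ∂μ = ∫⁻ ω in A, hg'.mk g (W (s + t) ω) ∂μ :=
        lintegral_congr_ae (ae_restrict_of_ae (ae_of_ae_map (hWm _).aemeasurable hg'.ae_eq_mk))
    _ = ∫⁻ ω in A, (∫⁻ ω', hg'.mk g (Z t ω') ∂(P (W s ω))) ∂μ :=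
        hW.eq s t _ hg'.measurable_mk A hA
    _ = _ := by
        refine lintegral_congr_ae (ae_restrict_of_ae (h0.mono fun ω hω => lintegral_congr_ae ?_))
        refine measure_mono_null (fun ω' hω' => ?_) hω
        exact hgN (fun h => hω' h.symm)

include hZ hP hker in
-- Condition at the first observation time: the first factor is known there and the remaining
-- product is replaced by a function of the state. That function is only universally measurable, so
-- measurability is carried through the same induction.
lemma markov_pathProd (F₀ : Filtration ℝ≥0 mΩ) (hZP : ∀ z, OneStep Z P F₀ Z (P z))
    (l : List (ℝ≥0 × (S → ℝ≥0∞))) (hl : ∀ p ∈ l, Measurable p.2) :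
    UniversallyMeasurable (fun z => ∫⁻ ω, pathProd l 0 (fun t => Z t ω) ∂(P z)) ∧
    ∀ (F : Filtration ℝ≥0 mΩ) (W : ℝ≥0 → Ω → S) (μ : Measure Ω) [IsFiniteMeasure μ],
      OneStep Z P F W μ → ∀ (s : ℝ≥0) (A : Set Ω), MeasurableSet[F s] A →
      ∫⁻ ω in A, pathProd l s (fun t => W t ω) ∂μ =
        ∫⁻ ω in A, (∫⁻ ω', pathProd l 0 (fun t => Z t ω') ∂(P (W s ω))) ∂μ := by
  induction l with
  | nil =>
    refine ⟨fun μ _ => ?_, fun F W μ _ hW s A hA => ?_⟩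
    · simp [pathProd]
    · simp [pathProd]
  | cons p l ih =>
    obtain ⟨d, f⟩ := p
    have hf : Measurable f := hl (d, f) (by simp)
    have hl' : ∀ p ∈ l, Measurable p.2 := fun p hp => hl p (by simp [hp])
    obtain ⟨hg, ihW⟩ := ih hl'
    set g : S → ℝ≥0∞ := fun z => ∫⁻ ω, pathProd l 0 (fun t => Z t ω) ∂(P z) with hgdef
    have hfg : UniversallyMeasurable fun z => f z * g z :=
      fun μ hμ => hf.aemeasurable.mul (hg μ hμ)
    have step : ∀ (F : Filtration ℝ≥0 mΩ) (W : ℝ≥0 → Ω → S) (μ : Measure Ω) [IsFiniteMeasure μ],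
        OneStep Z P F W μ → ∀ (s : ℝ≥0) (A : Set Ω), MeasurableSet[F s] A →
        ∫⁻ ω in A, pathProd ((d, f) :: l) s (fun t => W t ω) ∂μ =
          ∫⁻ ω in A, f (W (s + d) ω) * g (W (s + d) ω) ∂μ := by
      intro F W μ _ hW s A hA
      have hWm : ∀ t, Measurable (W t) := fun t => (hW.adapted t).mono (F.le t) le_rfl
      have hWp : Measurable fun ω t => W t ω := measurable_pi_lambda _ hWm
      have h1 := lintegral_mul_eq_of_setLIntegral_eq (F.le (s + d))
        (G := fun ω => pathProd l (s + d) fun t => W t ω) (G' := fun ω => g (W (s + d) ω))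
        (φ := A.indicator fun ω => f (W (s + d) ω)) (μ := μ)
        ((measurable_pathProd l hl' _).comp hWp).aemeasurable
        ((hg (μ.map (W (s + d))) inferInstance).comp_measurable (hWm _))
        (fun A' hA' => ihW F W μ hW (s + d) A' hA')
        ((hf.comp (hW.adapted _)).indicator (F.mono (le_add_of_nonneg_right zero_le) _ hA))
      rw [← lintegral_indicator (F.le s _ hA), ← lintegral_indicator (F.le s _ hA)]
      refine (lintegral_congr fun ω => ?_).trans (h1.trans (lintegral_congr fun ω => ?_)) <;>
      by_cases hω : ω ∈ A <;> simp [hω, pathProd]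
    have hZstep : ∀ z, ∫⁻ ω, pathProd ((d, f) :: l) 0 (fun t => Z t ω) ∂(P z) =
        ∫⁻ ω, f (Z d ω) * g (Z d ω) ∂(P z) := by
      intro z
      have := hP z
      simpa using step F₀ Z (P z) (hZP z) 0 univ MeasurableSet.univ
    refine ⟨?_, fun F W μ _ hW s A hA => ?_⟩
    · simp_rw [hZstep]
      exact hfg.lintegral hZ hP hker d
    · simp_rw [hZstep]
      rw [step F W μ hW s A hA]
      exact hW.eq_of_universallyMeasurable hZ hker hfg s d hA

include hZ hP hker in
-- The cylinder sets form a π-system generating the product σ-algebra, and the claim passes to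
-- complements and disjoint unions.
lemma markov_pathSet (F₀ : Filtration ℝ≥0 mΩ) (hZP : ∀ z, OneStep Z P F₀ Z (P z))
    (B : Set (ℝ≥0 → S)) (hB : MeasurableSet B) :
    UniversallyMeasurable (fun z => P z ((fun ω t => Z t ω) ⁻¹' B)) ∧
    ∀ (F : Filtration ℝ≥0 mΩ) (W : ℝ≥0 → Ω → S) (μ : Measure Ω) [IsFiniteMeasure μ],
      OneStep Z P F W μ → ∀ (s : ℝ≥0) (A : Set Ω), MeasurableSet[F s] A →
      μ.restrict A ((fun ω t => W (s + t) ω) ⁻¹' B) =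
        ∫⁻ ω in A, P (W s ω) ((fun ω t => Z t ω) ⁻¹' B) ∂μ := by
  have hZp : Measurable fun ω t => Z t ω := measurable_pi_lambda _ hZ
  induction B, hB using MeasurableSpace.induction_on_inter
    (generateFrom_squareCylinders (α := fun _ : ℝ≥0 => S)).symm
    (isPiSystem_squareCylinders (fun _ => @MeasurableSpace.isPiSystem_measurableSet S _) (by simp)) with
  | empty => exact ⟨fun μ _ => by simp, by simp⟩
  | basic C hC =>
    obtain ⟨I, B, hB, rfl⟩ := hC
    obtain ⟨l, hl, hlw⟩ := exists_pathProd B (fun t => hB t (mem_univ t)) I 0 (by simp)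
    have hmeas : MeasurableSet ((I : Set ℝ≥0).pi B) :=
      MeasurableSet.pi I.countable_toSet fun t _ => hB t (mem_univ t)
    have hPz : ∀ z, ∫⁻ ω, pathProd l 0 (fun t => Z t ω) ∂(P z) =
        P z ((fun ω t => Z t ω) ⁻¹' ((I : Set ℝ≥0).pi B)) := by
      intro z
      rw [← lintegral_indicator_one (hZp hmeas)]
      refine lintegral_congr fun ω => ?_
      have := hlw (fun t => Z t ω) 0
      simp only [add_zero, zero_add] at this
      rw [this]
      rfl
    obtain ⟨h1, h2⟩ := markov_pathProd hZ hP hker F₀ hZP l hl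
    simp_rw [hPz] at h1 h2
    refine ⟨h1, fun F W μ _ hW s A hA => ?_⟩
    rw [← h2 F W μ hW s A hA]
    have hWm : ∀ t, Measurable (W t) := fun t => (hW.adapted t).mono (F.le t) le_rfl
    have hWp : Measurable fun ω t => W (s + t) ω := measurable_pi_lambda _ fun t => hWm _
    rw [← lintegral_indicator_one (hWp hmeas)]
    refine lintegral_congr fun ω => ?_
    have := hlw (fun t => W t ω) s
    simp only [add_zero] at this
    rw [this]
    rfl
  | compl B hB ih =>
    obtain ⟨h1, h2⟩ := ih
    have hc : ∀ z, P z ((fun ω t => Z t ω) ⁻¹' Bᶜ) = 1 - P z ((fun ω t => Z t ω) ⁻¹' B) := by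
      intro z
      have := hP z
      exact prob_compl_eq_one_sub (hZp hB)
    simp_rw [hc]
    refine ⟨fun μ hμ => aemeasurable_const.sub (h1 μ hμ), fun F W μ _ hW s A hA => ?_⟩
    have hWm : ∀ t, Measurable (W t) := fun t => (hW.adapted t).mono (F.le t) le_rfl
    have hWp : Measurable fun ω t => W (s + t) ω := measurable_pi_lambda _ fun t => hWm _
    have hae : AEMeasurable (fun ω => P (W s ω) ((fun ω t => Z t ω) ⁻¹' B)) (μ.restrict A) :=
      ((h1 (μ.map (W s)) inferInstance).comp_measurable (hWm s)).restrict
    rw [lintegral_sub' hae, ← h2 F W μ hW s A hA]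
    · rw [preimage_compl, measure_compl (hWp hB) (measure_ne_top _ _)]
      simp
    · rw [← h2 F W μ hW s A hA]
      exact measure_ne_top _ _
    · refine ae_of_all _ fun ω => ?_
      have := hP (W s ω)
      exact prob_le_one
  | iUnion B hd hB ih =>
    have hu : ∀ z, P z ((fun ω t => Z t ω) ⁻¹' (⋃ i, B i)) =
        ∑' i, P z ((fun ω t => Z t ω) ⁻¹' (B i)) := by
      intro z
      rw [preimage_iUnion, measure_iUnion (fun i j hij => (hd hij).preimage _)
        fun i => hZp (hB i)]
    simp_rw [hu]
    refine ⟨fun μ hμ => AEMeasurable.tsum fun i => (ih i).1 μ hμ,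
      fun F W μ _ hW s A hA => ?_⟩
    have hWm : ∀ t, Measurable (W t) := fun t => (hW.adapted t).mono (F.le t) le_rfl
    have hWp : Measurable fun ω t => W (s + t) ω := measurable_pi_lambda _ fun t => hWm _
    rw [preimage_iUnion, measure_iUnion (fun i j hij => (hd hij).preimage _)
      fun i => hWp (hB i), lintegral_tsum]
    · exact tsum_congr fun i => (ih i).2 F W μ hW s A hA
    · exact fun i => (((ih i).1 (μ.map (W s)) inferInstance).comp_measurable (hWm s)).restrict

include hZ hP hker in
/-- The Markov property for measurable functionals of the whole path after a given time. -/
theorem markov_path (F₀ : Filtration ℝ≥0 mΩ) (hZP : ∀ z, OneStep Z P F₀ Z (P z))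
    {G : (ℝ≥0 → S) → ℝ≥0∞} (hG : Measurable G) :
    UniversallyMeasurable (fun z => ∫⁻ ω, G (fun t => Z t ω) ∂(P z)) ∧
    ∀ (F : Filtration ℝ≥0 mΩ) (W : ℝ≥0 → Ω → S) (μ : Measure Ω) [IsFiniteMeasure μ],
      OneStep Z P F W μ → ∀ (s : ℝ≥0) (A : Set Ω), MeasurableSet[F s] A →
      ∫⁻ ω in A, G (fun t => W (s + t) ω) ∂μ =
        ∫⁻ ω in A, (∫⁻ ω', G (fun t => Z t ω') ∂(P (W s ω))) ∂μ := by
  have hZp : Measurable fun ω t => Z t ω := measurable_pi_lambda _ hZ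
  refine Measurable.ennreal_induction (motive := fun G =>
    UniversallyMeasurable (fun z => ∫⁻ ω, G (fun t => Z t ω) ∂(P z)) ∧
    ∀ (F : Filtration ℝ≥0 mΩ) (W : ℝ≥0 → Ω → S) (μ : Measure Ω) [IsFiniteMeasure μ],
      OneStep Z P F W μ → ∀ (s : ℝ≥0) (A : Set Ω), MeasurableSet[F s] A →
      ∫⁻ ω in A, G (fun t => W (s + t) ω) ∂μ =
        ∫⁻ ω in A, (∫⁻ ω', G (fun t => Z t ω') ∂(P (W s ω))) ∂μ) ?_ ?_ ?_ hG
  · intro c B hB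
    obtain ⟨h1, h2⟩ := markov_pathSet hZ hP hker F₀ hZP B hB
    simp only [lintegral_indicator_const_comp _ hZp hB]
    refine ⟨fun μ hμ => (h1 μ hμ).const_mul c, fun F W μ _ hW s A hA => ?_⟩
    have hWm : ∀ t, Measurable (W t) := fun t => (hW.adapted t).mono (F.le t) le_rfl
    have hWp : Measurable fun ω t => W (s + t) ω := measurable_pi_lambda _ fun t => hWm _
    rw [lintegral_indicator_const_comp _ hWp hB, h2 F W μ hW s A hA, lintegral_const_mul'']
    exact ((h1 (μ.map (W s)) inferInstance).comp_measurable (hWm s)).restrict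
  · intro f g _ hf hg ihf ihg
    have hadd : ∀ z, ∫⁻ ω, (f + g) (fun t => Z t ω) ∂(P z) =
        ∫⁻ ω, f (fun t => Z t ω) ∂(P z) + ∫⁻ ω, g (fun t => Z t ω) ∂(P z) := fun z =>
      lintegral_add_left (hf.comp hZp) _
    simp_rw [hadd]
    refine ⟨fun μ hμ => (ihf.1 μ hμ).add (ihg.1 μ hμ), fun F W μ _ hW s A hA => ?_⟩
    have hWm : ∀ t, Measurable (W t) := fun t => (hW.adapted t).mono (F.le t) le_rfl
    rw [lintegral_add_left', ← ihf.2 F W μ hW s A hA, ← ihg.2 F W μ hW s A hA]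
    · exact lintegral_add_left (hf.comp (measurable_pi_lambda _ fun t => hWm _)) _
    exact ((ihf.1 (μ.map (W s)) inferInstance).comp_measurable (hWm s)).restrict
  · intro f hf hmono ih
    have hsup : ∀ z, ∫⁻ ω, (⨆ n, f n fun t => Z t ω) ∂(P z) =
        ⨆ n, ∫⁻ ω, f n (fun t => Z t ω) ∂(P z) := fun z =>
      lintegral_iSup (fun n => (hf n).comp hZp) fun i j hij ω => hmono hij _
    simp_rw [hsup]
    refine ⟨fun μ hμ => AEMeasurable.iSup fun n => (ih n).1 μ hμ, fun F W μ _ hW s A hA => ?_⟩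
    have hWm : ∀ t, Measurable (W t) := fun t => (hW.adapted t).mono (F.le t) le_rfl
    refine Eq.trans ?_ (lintegral_iSup' ?_ ?_).symm
    · simp_rw [← fun n => (ih n).2 F W μ hW s A hA]
      exact lintegral_iSup (fun n => (hf n).comp (measurable_pi_lambda _ fun t => hWm _))
        fun i j hij ω => hmono hij _
    · exact fun n => (((ih n).1 (μ.map (W s)) inferInstance).comp_measurable (hWm s)).restrict
    · exact ae_of_all _ fun ω i j hij => lintegral_mono fun ω' => hmono hij _

end markov

/-! ### Spatial homogeneity and the moment of the running maximum. -/

/-- The running supremum of a right-continuous function is a countable supremum. -/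
lemma iSup_Iic_eq_of_rightCont {f : ℝ≥0 → ℝ≥0∞} (hf : ∀ t, ContinuousWithinAt f (Ici t) t)
    (t : ℝ≥0) :
    ⨆ u ∈ Iic t, f u = f t ⊔ ⨆ n, f (min (TopologicalSpace.denseSeq ℝ≥0 n) t) := by
  refine le_antisymm (iSup₂_le fun u hu => ?_)
    (sup_le (le_iSup₂ (f := fun u (_ : u ∈ Iic t) => f u) t (mem_Iic.2 le_rfl))
      (iSup_le fun n => le_iSup₂ (f := fun u (_ : u ∈ Iic t) => f u) _
        (mem_Iic.2 (min_le_right _ _))))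
  -- The endpoint needs its own term: dense times slightly to the right of `u` stay in `[0, t]` only
  -- when `u < t`.
  rcases eq_or_lt_of_le (mem_Iic.1 hu) with rfl | hut
  · exact le_sup_left
  refine le_sup_of_le_right (le_of_forall_lt fun c hc => ?_)
  have h1 : ∀ᶠ r in 𝓝[>] u, c < f r ∧ r < t :=
    (((hf u).eventually (lt_mem_nhds hc)).filter_mono (nhdsWithin_mono _ Ioi_subset_Ici_self)).and
      (mem_of_superset (Ioo_mem_nhdsGT hut) fun r hr => hr.2)
  obtain ⟨v, huv, hv⟩ := (mem_nhdsGT_iff_exists_Ioo_subset).1 h1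
  obtain ⟨n, hn⟩ := (TopologicalSpace.denseRange_denseSeq ℝ≥0).exists_mem_open isOpen_Ioo
    (nonempty_Ioo.2 huv)
  have h2 := hv hn
  refine lt_of_lt_of_le h2.1 ?_
  have := le_iSup (fun n => f (min (TopologicalSpace.denseSeq ℝ≥0 n) t)) n
  rwa [min_eq_left h2.2.le] at this

/-- `sup_{u ∈ [0,1]} |w_u - w_0|`, as a measurable functional of a path. -/
def incPath {E : Type*} (w : ℝ≥0 → ℝ × E) : ℝ≥0∞ :=
  ‖(w 1).1 - (w 0).1‖ₑ ⊔ ⨆ n, ‖(w (min (TopologicalSpace.denseSeq ℝ≥0 n) 1)).1 - (w 0).1‖ₑ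

lemma measurable_incPath {E : Type*} [MeasurableSpace E] : Measurable (incPath (E := E)) := by
  have h : ∀ u : ℝ≥0, Measurable fun w : ℝ≥0 → ℝ × E => ‖(w u).1 - (w 0).1‖ₑ := fun u =>
    (((measurable_pi_apply u).fst).sub ((measurable_pi_apply 0).fst)).enorm
  exact (h 1).sup (Measurable.iSup fun n => h _)

section map

variable {E Ω : Type*} [TopologicalSpace E] [MeasurableSpace E] [MeasurableSpace Ω] (M : MAP E Ω)

/-- the path of `(X + a, Y)` -/
def shiftPath (a : ℝ) (ω : Ω) (t : ℝ≥0) : ℝ × E := (M.X t ω + a, M.Y t ω)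

variable {M}

lemma measurable_Z (t : ℝ≥0) : Measurable (M.Z t) := (M.adapted t).mono (M.filt.le t) le_rfl

lemma oneStep_Z (z : ℝ × E) : OneStep M.Z M.P M.filt M.Z (M.P z) :=
  ⟨M.adapted, fun s t f hf A hA => M.markov z s t f hf A hA⟩

/-- Additivity reduces both starting points to `(0, y)`, where the displacements add up; so the
translated process has the same transition function. -/
lemma oneStep_shiftPath (a : ℝ) (z : ℝ × E) :
    OneStep M.Z M.P M.filt (fun t ω => shiftPath M a ω t) (M.P z) := by
  refine ⟨fun t => ((measurable_X t).add_const a).prodMk (measurable_Y t),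
    fun s t f hf A hA => ?_⟩
  have hfa : ∀ a : ℝ, Measurable fun p : ℝ × E => f (p.1 + a, p.2) := fun a =>
    hf.comp ((measurable_fst.add_const a).prodMk measurable_snd)
  rw [show ∫⁻ ω in A, f (shiftPath M a ω (s + t)) ∂(M.P z) = _ from
    M.markov z s t (fun p => f (p.1 + a, p.2)) (hfa a) A hA]
  refine lintegral_congr fun ω => ?_
  rw [show M.Z s ω = (M.X s ω, M.Y s ω) from rfl, shiftPath, M.additive _ _ t _ (hfa a),
    M.additive _ _ t _ hf]
  simp only [add_assoc]

lemma measurable_shiftPath (a : ℝ) : Measurable (shiftPath M a) :=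
  measurable_pi_lambda _ fun t =>
    (((measurable_X t).add_const a).prodMk (measurable_Y t)).mono (M.filt.le t) le_rfl

theorem markov_pathMAP {G : (ℝ≥0 → ℝ × E) → ℝ≥0∞} (hG : Measurable G) :
    UniversallyMeasurable (fun z => ∫⁻ ω, G (fun t => M.Z t ω) ∂(M.P z)) ∧
    ∀ (W : ℝ≥0 → Ω → ℝ × E) (z : ℝ × E), OneStep M.Z M.P M.filt W (M.P z) →
      ∀ (s : ℝ≥0) (A : Set Ω), MeasurableSet[M.filt s] A →
      ∫⁻ ω in A, G (fun t => W (s + t) ω) ∂(M.P z) =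
        ∫⁻ ω in A, (∫⁻ ω', G (fun t => M.Z t ω') ∂(M.P (W s ω))) ∂(M.P z) := by
  have h := markov_path measurable_Z M.isProb M.kernel M.filt oneStep_Z hG
  refine ⟨h.1, fun W z hW s A hA => ?_⟩
  have := M.isProb z
  exact h.2 M.filt W (M.P z) hW s A hA

/-- Spatial homogeneity of the law of the whole path. -/
theorem lintegral_shiftPath {G : (ℝ≥0 → ℝ × E) → ℝ≥0∞} (hG : Measurable G) (a x : ℝ) (y : E) :
    ∫⁻ ω, G (shiftPath M a ω) ∂(M.P (x, y)) = ∫⁻ ω, G (fun t => M.Z t ω) ∂(M.P (x + a, y)) := by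
  have := M.isProb (x, y)
  have h := (markov_pathMAP (M := M) hG).2 _ (x, y) (oneStep_shiftPath a _) 0 univ MeasurableSet.univ
  simp only [Measure.restrict_univ, zero_add] at h
  refine h.trans ?_
  have h2 : ∀ᵐ ω ∂(M.P (x, y)), ∫⁻ ω', G (fun t => M.Z t ω') ∂(M.P (shiftPath M a ω 0)) =
      ∫⁻ ω', G (fun t => M.Z t ω') ∂(M.P (x + a, y)) := by
    filter_upwards [M.start (x, y)] with ω hω
    simp [shiftPath, MAP.X, MAP.Y, hω]
  rw [lintegral_congr_ae h2]
  simp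

lemma incPath_eq (j : ℝ≥0) (ω : Ω) :
    incPath (fun t => M.Z (j + t) ω) = ⨆ u ∈ Iic (1 : ℝ≥0), ‖M.X (j + u) ω - M.X j ω‖ₑ := by
  rw [iSup_Iic_eq_of_rightCont]
  · simp [incPath, MAP.X]
  · intro t
    have h1 : ContinuousWithinAt (fun u => M.X (j + u) ω) (Ici t) t :=
      (rightCont_X ω (j + t)).comp (continuous_const.add continuous_id).continuousWithinAt
        fun u hu => add_le_add_right (mem_Ici.1 hu) _
    exact continuous_enorm.continuousAt.comp_continuousWithinAt (h1.sub continuousWithinAt_const)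

/-- The Markov property at `j` reduces to an increment from time zero; increments ignore
translation, so homogeneity moves the start to `(0, y)`. -/
lemma lintegral_incPath_le (z : ℝ × E) (j : ℝ≥0) :
    ∫⁻ ω, incPath (fun t => M.Z (j + t) ω) ∂(M.P z) ≤
      ⨆ y : E, ∫⁻ ω, (⨆ s ∈ Icc (0 : ℝ≥0) 1, ‖M.X s ω‖ₑ) ∂(M.P (0, y)) := by
  have := M.isProb z
  have h := (markov_pathMAP (M := M) measurable_incPath).2 _ z (oneStep_Z z) j univ
    MeasurableSet.univ
  rw [Measure.restrict_univ] at h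
  rw [h]
  set C := ⨆ y : E, ∫⁻ ω, (⨆ s ∈ Icc (0 : ℝ≥0) 1, ‖M.X s ω‖ₑ) ∂(M.P (0, y))
  have hle : ∀ z : ℝ × E, ∫⁻ ω, incPath (fun t => M.Z t ω) ∂(M.P z) ≤ C := by
    rintro ⟨x, y⟩
    have h1 := lintegral_shiftPath (M := M) measurable_incPath x 0 y
    rw [zero_add] at h1
    rw [← h1]
    refine le_trans (lintegral_mono_ae ?_) (le_iSup
      (fun y : E => ∫⁻ ω, (⨆ s ∈ Icc (0 : ℝ≥0) 1, ‖M.X s ω‖ₑ) ∂(M.P (0, y))) y)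
    filter_upwards [M.start (0, y)] with ω hω
    have h2 : incPath (shiftPath M x ω) = incPath (fun t => M.Z (0 + t) ω) := by
      simp [incPath, shiftPath, MAP.X]
    rw [h2, incPath_eq]
    refine iSup₂_le fun u hu => ?_
    have h3 : M.X 0 ω = 0 := by simp [MAP.X, hω]
    rw [h3, sub_zero, zero_add]
    exact le_iSup₂ (f := fun s (_ : s ∈ Icc (0 : ℝ≥0) 1) => ‖M.X s ω‖ₑ) u ⟨zero_le, hu⟩
  calc _ ≤ ∫⁻ ω, C ∂(M.P z) := lintegral_mono fun ω => hle _
    _ = C := by simp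

variable (M) in
/-- An upper bound of the running maximum of `|X|`. -/
def envelope (s : ℝ≥0) (ω : Ω) : ℝ≥0∞ :=
  ‖M.X 0 ω‖ₑ + ∑' j : ℕ, (Ici (j : ℝ≥0)).indicator (fun _ => incPath fun t => M.Z (j + t) ω) s

lemma measurable_incPath_Z (j : ℝ≥0) : Measurable fun ω => incPath fun t => M.Z (j + t) ω :=
  measurable_incPath.comp (measurable_pi_lambda _ fun _ => measurable_Z _)

lemma measurable_envelope : Measurable fun p : ℝ≥0 × Ω => envelope M p.1 p.2 := by
  have h0 : Measurable (M.X 0) := (measurable_X 0).mono (M.filt.le 0) le_rfl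
  refine (h0.enorm.comp measurable_snd).add (Measurable.tsum fun j => ?_)
  have : (fun p : ℝ≥0 × Ω => (Ici (j : ℝ≥0)).indicator
      (fun _ => incPath fun t => M.Z (j + t) p.2) p.1) =
      (Prod.fst ⁻¹' Ici (j : ℝ≥0)).indicator fun p => incPath fun t => M.Z (j + t) p.2 := by
    rfl
  rw [this]
  exact ((measurable_incPath_Z (M := M) j).comp measurable_snd).indicator
    (measurable_fst measurableSet_Ici)

/-- Telescope over the integers up to the integer part of `u`, then add one partial increment; every
unit interval used begins no later than `s`. -/
lemma enorm_X_le_envelope {u s : ℝ≥0} (hus : u ≤ s) (ω : Ω) : ‖M.X u ω‖ₑ ≤ envelope M s ω := by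
  set I : ℕ → ℝ≥0∞ := fun j => incPath fun t => M.Z (j + t) ω with hI
  have hinc : ∀ (j : ℕ) (v : ℝ≥0), v ≤ 1 → ‖M.X (j + v) ω - M.X j ω‖ₑ ≤ I j := fun j v hv => by
    rw [hI]
    simp only [incPath_eq]
    exact le_iSup₂ (f := fun u (_ : u ∈ Iic (1 : ℝ≥0)) => ‖M.X (j + u) ω - M.X j ω‖ₑ) v hv
  have htri : ∀ a b : ℝ, ‖a‖ₑ ≤ ‖b‖ₑ + ‖a - b‖ₑ := fun a b => by
    simpa using enorm_add_le b (a - b)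
  have hk : ∀ k : ℕ, ‖M.X k ω‖ₑ ≤ ‖M.X 0 ω‖ₑ + ∑ j ∈ Finset.range k, I j := by
    intro k
    induction k with
    | zero => simp
    | succ k ih =>
      rw [Finset.sum_range_succ, ← add_assoc, Nat.cast_succ]
      exact (htri _ _).trans (add_le_add ih (hinc k 1 le_rfl))
  have hfl : (⌊u⌋₊ : ℝ≥0) ≤ u := Nat.floor_le zero_le
  have hu : ‖M.X u ω‖ₑ ≤ ‖M.X 0 ω‖ₑ + ∑ j ∈ Finset.range (⌊u⌋₊ + 1), I j := by
    rw [Finset.sum_range_succ, ← add_assoc]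
    have h1 := hinc ⌊u⌋₊ (u - ⌊u⌋₊) (by
      rw [tsub_le_iff_left]
      exact (Nat.lt_floor_add_one u).le)
    rw [add_tsub_cancel_of_le hfl] at h1
    exact (htri _ _).trans (add_le_add (hk _) h1)
  refine hu.trans (add_le_add le_rfl ?_)
  refine le_trans (Finset.sum_le_sum fun j hj => ?_) (ENNReal.sum_le_tsum (Finset.range (⌊u⌋₊ + 1)))
  rw [indicator_of_mem]
  refine mem_Ici.2 (le_trans ?_ (hfl.trans hus))
  exact_mod_cast Nat.lt_succ_iff.1 (Finset.mem_range.1 hj)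

variable [BorelSpace E] [RadonSpace E] {q : E → ℝ}

/-- The running maximum of `|X|` has a finite expected discounted integral. -/
theorem discInt_envelope_lt_top
    (hM : (⨆ y : E, ∫⁻ ω, (⨆ s ∈ Icc (0 : ℝ≥0) 1, ‖M.X s ω‖ₑ) ∂(M.P (0, y))) < ⊤)
    (hq : Measurable q) {q₀ : ℝ} (hq₀ : 0 < q₀) (hqq₀ : ∀ y, q₀ < q y)
    (hfin : ∀ z, ∀ᵐ ω ∂(M.P z), ∀ t : ℝ≥0, cumDiscount M q t ω < ⊤) (z : ℝ × E) :
    discInt M q (envelope M) z < ⊤ := by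
  have := M.isProb z
  set C := ⨆ y : E, ∫⁻ ω, (⨆ s ∈ Icc (0 : ℝ≥0) 1, ‖M.X s ω‖ₑ) ∂(M.P (0, y))
  set I : ℕ → Ω → ℝ≥0∞ := fun j ω => incPath fun t => M.Z (j + t) ω with hI
  have hIm : ∀ j, Measurable (I j) := fun j => measurable_incPath_Z _
  set r := ENNReal.ofReal (Real.exp (-q₀)) with hr
  have hr1 : r < 1 := by
    rw [hr, ← ENNReal.ofReal_one]
    exact (ENNReal.ofReal_lt_ofReal_iff one_pos).2 (by simpa using hq₀)
  have hdisc : ∀ (j : ℕ) ω, discount M q j ω ≤ r ^ j := fun j ω => by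
    refine (discount_le hq hq₀ hqq₀ j ω).trans_eq ?_
    rw [hr, ← ENNReal.ofReal_pow (Real.exp_pos _).le, ← Real.exp_nat_mul]
    congr 2
    simp [mul_comm]
  have hdm : ∀ ω, Measurable fun s => dens M q s ω := fun ω =>
    (measurable_dens hq).comp (measurable_id.prodMk measurable_const)
  have hpath : ∀ᵐ ω ∂(M.P z), ∫⁻ s, envelope M s ω * dens M q s ω ∂nnVol ≤
      ‖z.1‖ₑ + ∑' j, I j ω * r ^ j := by
    filter_upwards [hfin z, M.start z] with ω hω hz
    -- An increment entering at time `t` is weighted by the discount at `t`, which for `t = j` is at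
    -- most `r ^ j`.
    have h1 : ∀ (t : ℝ≥0) (c : ℝ≥0∞), ∫⁻ s, (Ici t).indicator (fun _ => c) s * dens M q s ω ∂nnVol
        = c * discount M q t ω := fun t c => by
      rw [← setLIntegral_Ici_dens hq hq₀ hqq₀ hω, ← lintegral_const_mul _ (hdm ω),
        ← lintegral_indicator measurableSet_Ici]
      refine lintegral_congr fun s => ?_
      by_cases hs : s ∈ Ici t <;> simp [hs]
    have h2 : ∫⁻ s, ‖M.X 0 ω‖ₑ * dens M q s ω ∂nnVol ≤ ‖z.1‖ₑ := by
      have h3 := h1 0 ‖M.X 0 ω‖ₑ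
      have h4 : Ici (0 : ℝ≥0) = univ := by ext; simp
      simp only [h4, indicator_univ] at h3
      rw [h3, show M.X 0 ω = z.1 by simp [MAP.X, hz]]
      exact mul_le_of_le_one_right zero_le (expNeg_le_one _)
    simp only [envelope, add_mul, ← ENNReal.tsum_mul_right]
    rw [lintegral_add_left ((hdm ω).const_mul _), lintegral_tsum]
    · refine add_le_add h2 (ENNReal.tsum_le_tsum fun j => ?_)
      rw [h1]
      gcongr
      exact hdisc j ω
    · exact fun j => ((measurable_const.indicator measurableSet_Ici).mul (hdm ω)).aemeasurable
  calc discInt M q (envelope M) z ≤ ∫⁻ ω, (‖z.1‖ₑ + ∑' j, I j ω * r ^ j) ∂(M.P z) :=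
        lintegral_mono_ae hpath
    _ = ‖z.1‖ₑ + ∑' j, (∫⁻ ω, I j ω ∂(M.P z)) * r ^ j := by
        rw [lintegral_add_left measurable_const, lintegral_tsum fun j =>
          ((hIm j).mul_const _).aemeasurable]
        simp_rw [fun j => lintegral_mul_const (μ := M.P z) (r ^ j) (hIm j)]
        simp
    _ ≤ ‖z.1‖ₑ + ∑' j : ℕ, C * r ^ j := by
        gcongr with j
        exact lintegral_incPath_le z j
    _ < ⊤ := by
        rw [ENNReal.tsum_mul_left, ENNReal.tsum_geometric]
        refine ENNReal.add_lt_top.2 ⟨enorm_lt_top, ENNReal.mul_lt_top hM ?_⟩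
        exact ENNReal.inv_lt_top.2 (tsub_pos_of_lt hr1)

end map

/-! ### Minimal injections and finiteness of the values. -/

/-- The running supremum of the positive part of a right-continuous, locally bounded path. -/
def runSup (f : ℝ≥0 → ℝ) (hf : ∀ t, ContinuousWithinAt f (Ici t) t)
    (hb : ∀ t, ⨆ u ∈ Iic t, ENNReal.ofReal (f u) < ⊤) : StieltjesFunction ℝ≥0 where
  toFun t := (⨆ u ∈ Iic t, ENNReal.ofReal (f u)).toReal
  mono' _ t hst := ENNReal.toReal_mono (hb t).ne (biSup_mono fun _ hu => (mem_Iic.1 hu).trans hst)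
  right_continuous' t := by
    refine (ENNReal.tendsto_toReal (hb t).ne).comp (tendsto_order.2 ⟨fun a ha => ?_, fun a ha => ?_⟩)
    · filter_upwards [self_mem_nhdsWithin] with s hs
      exact ha.trans_le (biSup_mono fun u hu => (mem_Iic.1 hu).trans hs)
    · obtain ⟨c, hc, hca⟩ := exists_between ha
      have h1 : ∀ᶠ s in 𝓝[≥] t, ENNReal.ofReal (f s) < c :=
        ((ENNReal.continuous_ofReal.tendsto _).comp (hf t)).eventually (gt_mem_nhds
          (lt_of_le_of_lt (le_iSup₂ (f := fun u (_ : u ∈ Iic t) => ENNReal.ofReal (f u)) t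
            (mem_Iic.2 le_rfl)) hc))
      obtain ⟨v, htv, hv⟩ := (mem_nhdsGE_iff_exists_Ico_subset).1 h1
      filter_upwards [Ico_mem_nhdsGE htv] with s hs
      refine lt_of_le_of_lt (iSup₂_le fun u hu => ?_) hca
      rcases le_or_gt u t with hut | hut
      · exact (le_iSup₂ (f := fun u (_ : u ∈ Iic t) => ENNReal.ofReal (f u)) u hut).trans hc.le
      · exact (hv ⟨hut.le, (mem_Iic.1 hu).trans_lt hs.2⟩ : _ < c).le

lemma ofReal_runSup {f : ℝ≥0 → ℝ} (hf : ∀ t, ContinuousWithinAt f (Ici t) t)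
    (hb : ∀ t, ⨆ u ∈ Iic t, ENNReal.ofReal (f u) < ⊤) (t : ℝ≥0) :
    ENNReal.ofReal (runSup f hf hb t) = ⨆ u ∈ Iic t, ENNReal.ofReal (f u) :=
  ENNReal.ofReal_toReal (hb t).ne

section map

variable {E Ω : Type*} [TopologicalSpace E] [MeasurableSpace E] [MeasurableSpace Ω] {M : MAP E Ω}

/-- Left limits bound the path just before each point and right-continuity from that point on;
compactness of `[0, t]` makes the bound uniform. -/
lemma exists_bound_X (ω : Ω) (t : ℝ≥0) : ∃ B : ℝ, ∀ u ≤ t, |M.X u ω| ≤ B := by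
  suffices h : ∃ B : ℝ, ∀ u ∈ Icc 0 t, |M.X u ω| ≤ B from
    h.imp fun B hB u hu => hB u ⟨zero_le, hu⟩
  refine isCompact_Icc.induction_on (p := fun s => ∃ B : ℝ, ∀ u ∈ s, |M.X u ω| ≤ B)
    ⟨0, by simp⟩ (fun s s' hss' ⟨B, hB⟩ => ⟨B, fun u hu => hB u (hss' hu)⟩)
    (fun s s' ⟨B, hB⟩ ⟨B', hB'⟩ => ⟨max B B', fun u hu => ?_⟩) (fun x _ => ?_)
  · rcases hu with hu | hu
    · exact le_max_of_le_left (hB u hu)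
    · exact le_max_of_le_right (hB' u hu)
  · obtain ⟨l, hl⟩ := M.leftLim ω x
    have key : ∀ (F : Filter ℝ≥0) (l : ℝ), Tendsto (fun s => M.X s ω) F (𝓝 l) →
        ∀ᶠ s in F, |M.X s ω| < |l| + 1 := fun F l h =>
      h.abs.eventually (gt_mem_nhds (lt_add_one _))
    have h1 := key _ _ hl
    have h2 := key _ _ (rightCont_X ω x)
    refine ⟨{s | |M.X s ω| ≤ max (|l| + 1) (|M.X x ω| + 1)}, mem_nhdsWithin_of_mem_nhds ?_,
      max (|l| + 1) (|M.X x ω| + 1), fun u hu => hu⟩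
    rw [← nhdsLT_sup_nhdsGE, mem_sup]
    exact ⟨h1.mono fun s hs => le_max_of_le_left hs.le,
      h2.mono fun s hs => le_max_of_le_right hs.le⟩

lemma iSup_ofReal_sub_X_lt_top {g : ℝ≥0 → ℝ} {c : ℝ} (hg : ∀ t, g t ≤ c) (ω : Ω) (t : ℝ≥0) :
    ⨆ u ∈ Iic t, ENNReal.ofReal (g u - M.X u ω) < ⊤ := by
  obtain ⟨B, hB⟩ := exists_bound_X (M := M) ω t
  refine lt_of_le_of_lt (iSup₂_le fun u hu => ENNReal.ofReal_le_ofReal (?_ : _ ≤ c + B))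
    ENNReal.ofReal_lt_top
  have := abs_le.1 (hB u hu)
  linarith [hg u]

lemma rightCont_sub_X (g : StieltjesFunction ℝ≥0) (ω : Ω) (t : ℝ≥0) :
    ContinuousWithinAt (fun u => g u - M.X u ω) (Ici t) t :=
  (g.right_continuous t).sub (rightCont_X ω t)

/-- The strategy which pays given bounded dividends and injects as little as possible. -/
def minStrategy (M : MAP E Ω) (L : Ω → StieltjesFunction ℝ≥0) (c : ℝ) (h0 : ∀ ω t, 0 ≤ L ω t)
    (hc : ∀ ω t, L ω t ≤ c) (hL : ∀ t, Measurable[M.filt t] (fun ω => L ω t)) : Strategy M where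
  L := L
  R ω := runSup (fun u => L ω u - M.X u ω) (rightCont_sub_X (L ω) ω)
    (iSup_ofReal_sub_X_lt_top (hc ω) ω)
  L_nonneg := h0
  R_nonneg _ _ := ENNReal.toReal_nonneg
  L_adapted := hL
  R_adapted t := by
    refine Measurable.ennreal_toReal ?_
    have h1 : ∀ u ≤ t, Measurable[M.filt t] fun ω => ENNReal.ofReal (L ω u - M.X u ω) :=
      fun u hu => ((hL u).sub (measurable_X u)).ennreal_ofReal.mono (M.filt.mono hu) le_rfl
    have h2 : (fun ω => ⨆ u ∈ Iic t, ENNReal.ofReal (L ω u - M.X u ω)) =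
        fun ω => ENNReal.ofReal (L ω t - M.X t ω) ⊔ ⨆ n, ENNReal.ofReal
          (L ω (min (TopologicalSpace.denseSeq ℝ≥0 n) t) -
            M.X (min (TopologicalSpace.denseSeq ℝ≥0 n) t) ω) := by
      ext ω
      exact iSup_Iic_eq_of_rightCont (f := fun u => ENNReal.ofReal (L ω u - M.X u ω))
        (fun t => ENNReal.continuous_ofReal.continuousAt.comp_continuousWithinAt
          (rightCont_sub_X (L ω) ω t)) t
    rw [h2]
    exact (h1 t le_rfl).sup (Measurable.iSup fun n => h1 _ (min_le_right _ _))
  solvent z := ae_of_all _ fun ω t => by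
    have h1 := le_iSup₂ (f := fun u (_ : u ∈ Iic t) => ENNReal.ofReal (L ω u - M.X u ω)) t
      (mem_Iic.2 le_rfl)
    rw [← ofReal_runSup (rightCont_sub_X (L ω) ω) (iSup_ofReal_sub_X_lt_top (hc ω) ω),
      ENNReal.ofReal_le_ofReal_iff (show 0 ≤ runSup _ _ _ t from ENNReal.toReal_nonneg)] at h1
    linarith

lemma ofReal_minStrategy_R {L : Ω → StieltjesFunction ℝ≥0} {c : ℝ} (h0 : ∀ ω t, 0 ≤ L ω t)
    (hc : ∀ ω t, L ω t ≤ c) (hL : ∀ t, Measurable[M.filt t] (fun ω => L ω t)) (ω : Ω) (t : ℝ≥0) :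
    ENNReal.ofReal ((minStrategy M L c h0 hc hL).R ω t) =
      ⨆ u ∈ Iic t, ENNReal.ofReal (L ω u - M.X u ω) :=
  ofReal_runSup (rightCont_sub_X (L ω) ω) (iSup_ofReal_sub_X_lt_top (hc ω) ω) t

lemma valuePoisson_le_valueCC (M : MAP E Ω) (C : PoissonClocks M) (q : E → ℝ) (β : ℝ) (n : ℕ)
    (z : ℝ × E) : valuePoisson M C q β n z ≤ valueCC M q β z :=
  iSup₂_le fun π hπ => le_iSup₂ (f := fun (π : Strategy M) (_ : π.Admissible q) => π.value q β z)
    π hπ.1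

/-- The standing assumptions on the process and the discount rate. -/
structure Standing (M : MAP E Ω) (q : E → ℝ) (q₀ : ℝ) : Prop where
  moment : (⨆ y : E, ∫⁻ ω, (⨆ s ∈ Icc (0 : ℝ≥0) 1, ‖M.X s ω‖ₑ) ∂(M.P (0, y))) < ⊤
  measurable : Measurable q
  pos : 0 < q₀
  lt : ∀ y, q₀ < q y
  finite : ∀ z, ∀ᵐ ω ∂(M.P z), ∀ t : ℝ≥0, cumDiscount M q t ω < ⊤

variable [BorelSpace E] [RadonSpace E] {q : E → ℝ} {q₀ : ℝ} (H : Standing M q q₀)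

namespace Standing

include H

lemma discInt_envelope_lt_top (z : ℝ × E) : discInt M q (envelope M) z < ⊤ :=
  Dividend.discInt_envelope_lt_top H.moment H.measurable H.pos H.lt H.finite z

lemma discInt_const_le (c : ℝ≥0∞) (z : ℝ × E) : discInt M q (fun _ _ => c) z ≤ c := by
  have := M.isProb z
  calc discInt M q (fun _ _ => c) z ≤ ∫⁻ ω, c ∂(M.P z) := by
        refine lintegral_mono_ae ((H.finite z).mono fun ω hω => ?_)
        have h1 := setLIntegral_Ici_dens H.measurable H.pos H.lt hω 0
        have h4 : Ici (0 : ℝ≥0) = univ := by ext; simp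
        rw [h4, Measure.restrict_univ] at h1
        have hdm : Measurable fun s => dens M q s ω :=
          (measurable_dens H.measurable).comp (measurable_id.prodMk measurable_const)
        simp only []
        rw [lintegral_const_mul _ hdm, h1]
        exact mul_le_of_le_one_right zero_le (expNeg_le_one _)
    _ = c := by simp

/-- After this integration by parts, dividends can be compared, approximated and projected
separately at each time. -/
lemma vL_eq (π : Strategy M) (z : ℝ × E) :
    π.vL q z = discInt M q (fun s ω => ENNReal.ofReal (π.L ω s)) z :=
  lintegral_congr_ae ((H.finite z).mono fun ω hω =>
    lintegral_discount_pathMeasure H.measurable H.pos H.lt hω _ (π.L_nonneg ω 0))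

lemma vR_eq (π : Strategy M) (z : ℝ × E) :
    π.vR q z = discInt M q (fun s ω => ENNReal.ofReal (π.R ω s)) z :=
  lintegral_congr_ae ((H.finite z).mono fun ω hω =>
    lintegral_discount_pathMeasure H.measurable H.pos H.lt hω _ (π.R_nonneg ω 0))

lemma vL_le (π : Strategy M) (z : ℝ × E) :
    π.vL q z ≤ discInt M q (envelope M) z + π.vR q z := by
  rw [H.vL_eq, H.vR_eq, ← discInt_add H.measurable measurable_envelope]
  refine discInt_mono ((π.solvent z).mono fun ω hω s => ?_)
  calc ENNReal.ofReal (π.L ω s) ≤ ENNReal.ofReal (|M.X s ω| + π.R ω s) := by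
        refine ENNReal.ofReal_le_ofReal ?_
        linarith [hω s, le_abs_self (M.X s ω)]
    _ ≤ ENNReal.ofReal |M.X s ω| + ENNReal.ofReal (π.R ω s) := ENNReal.ofReal_add_le
    _ ≤ envelope M s ω + ENNReal.ofReal (π.R ω s) := by
        gcongr
        rw [← Real.enorm_eq_ofReal_abs]
        exact enorm_X_le_envelope le_rfl ω

lemma vL_lt_top {π : Strategy M} (hπ : π.Admissible q) (z : ℝ × E) : π.vL q z < ⊤ :=
  (H.vL_le π z).trans_lt (ENNReal.add_lt_top.2 ⟨H.discInt_envelope_lt_top z, hπ z⟩)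

lemma value_eq {π : Strategy M} (hπ : π.Admissible q) (β : ℝ) (z : ℝ × E) :
    π.value q β z = (((π.vL q z).toReal - β * (π.vR q z).toReal : ℝ) : EReal) := by
  rw [Strategy.value, EReal.coe_sub, EReal.coe_mul, EReal.coe_ennreal_toReal (hπ z).ne,
    EReal.coe_ennreal_toReal (H.vL_lt_top hπ z).ne]

/-- With dividends bounded by `c`, the minimal injections are at most `c` plus the running maximum
of `|X|`. -/
lemma admissible_minStrategy {L : Ω → StieltjesFunction ℝ≥0} {c : ℝ} (h0 : ∀ ω t, 0 ≤ L ω t)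
    (hc : ∀ ω t, L ω t ≤ c) (hL : ∀ t, Measurable[M.filt t] (fun ω => L ω t)) :
    (minStrategy M L c h0 hc hL).Admissible q := by
  intro z
  rw [H.vR_eq]
  calc _ ≤ discInt M q (fun s ω => envelope M s ω + ENNReal.ofReal c) z := by
        refine discInt_mono (ae_of_all _ fun ω s => ?_)
        rw [ofReal_minStrategy_R]
        refine iSup₂_le fun u hu => ?_
        calc ENNReal.ofReal (L ω u - M.X u ω) ≤ ENNReal.ofReal (|M.X u ω| + c) := by
              refine ENNReal.ofReal_le_ofReal ?_
              linarith [hc ω u, neg_abs_le (M.X u ω)]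
          _ ≤ ENNReal.ofReal |M.X u ω| + ENNReal.ofReal c := ENNReal.ofReal_add_le
          _ ≤ _ := by
              gcongr
              rw [← Real.enorm_eq_ofReal_abs]
              exact enorm_X_le_envelope hu ω
    _ = discInt M q (envelope M) z + discInt M q (fun _ _ => ENNReal.ofReal c) z :=
        discInt_add H.measurable measurable_envelope z
    _ < ⊤ := ENNReal.add_lt_top.2 ⟨H.discInt_envelope_lt_top z,
        (H.discInt_const_le _ z).trans_lt ENNReal.ofReal_lt_top⟩

lemma value_le {π : Strategy M} (hπ : π.Admissible q) {β : ℝ} (hβ : 1 < β) (z : ℝ × E) :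
    π.value q β z ≤ ((discInt M q (envelope M) z).toReal : EReal) := by
  rw [H.value_eq hπ, EReal.coe_le_coe_iff]
  have h1 := ENNReal.toReal_mono (ENNReal.add_lt_top.2
    ⟨H.discInt_envelope_lt_top z, hπ z⟩).ne (H.vL_le π z)
  rw [ENNReal.toReal_add (H.discInt_envelope_lt_top z).ne (hπ z).ne] at h1
  -- The bound on `vL` costs one copy of `vR`, which is covered by the `β > 1` copies subtracted.
  nlinarith [ENNReal.toReal_nonneg (a := π.vR q z)]

lemma valueCC_ne_top {β : ℝ} (hβ : 1 < β) (z : ℝ × E) : valueCC M q β z ≠ ⊤ :=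
  ne_top_of_le_ne_top (EReal.coe_ne_top _) (iSup₂_le fun _ hπ => H.value_le hπ hβ z)

lemma valuePoisson_ne_bot (C : PoissonClocks M) (β : ℝ) (n : ℕ) (z : ℝ × E) :
    valuePoisson M C q β n z ≠ ⊥ := by
  let π := minStrategy M (fun _ => 0) 0 (fun _ _ => le_rfl) (fun _ _ => le_rfl)
    (fun _ => measurable_const)
  have hπ : π.Admissible q := H.admissible_minStrategy _ _ _
  have hp : π.PaysAtJumpsOf (C.superposition n) :=
    ⟨fun _ _ => 0, fun _ => measurable_const, fun z => ae_of_all _ fun ω t => by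
      have h1 : π.L ω t = 0 := rfl
      simp [h1]⟩
  refine ne_bot_of_le_ne_bot ?_ (le_iSup₂ (f := fun (π : Strategy M)
    (_ : π.Admissible q ∧ π.PaysAtJumpsOf (C.superposition n)) => π.value q β z) π ⟨hπ, hp⟩)
  rw [H.value_eq hπ]
  exact EReal.coe_ne_bot _

lemma valueCC_ne_bot (β : ℝ) (C : PoissonClocks M) (z : ℝ × E) : valueCC M q β z ≠ ⊥ :=
  ne_bot_of_le_ne_bot (H.valuePoisson_ne_bot C β 1 z) (valuePoisson_le_valueCC M C q β 1 z)

end Standing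

end map

/-! ### Counting paths, their jumps, and delayed dividends. -/

section paths

lemma pathMeasure_Ioc (g : StieltjesFunction ℝ≥0) (h0 : 0 ≤ g 0) {a b : ℝ≥0} (hab : a ≤ b) :
    pathMeasure g (Ioc a b) = ENNReal.ofReal (g b) - ENNReal.ofReal (g a) := by
  rw [show Ioc a b = Iic b \ Iic a by ext; simp [and_comm], measure_sdiff (Iic_subset_Iic.2 hab) measurableSet_Iic.nullMeasurableSet,
    pathMeasure_Iic g h0, pathMeasure_Iic g h0]
  rw [pathMeasure_Iic g h0]
  exact ENNReal.ofReal_ne_top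

lemma pathMeasure_singleton_ne_top (g : StieltjesFunction ℝ≥0) (h0 : 0 ≤ g 0) (t : ℝ≥0) :
    pathMeasure g {t} ≠ ⊤ := by
  refine ne_top_of_le_ne_top ?_ (measure_mono (singleton_subset_iff.2 (mem_Iic.2 le_rfl)))
  rw [pathMeasure_Iic g h0]
  exact ENNReal.ofReal_ne_top

lemma pathMeasure_singleton_zero (g : StieltjesFunction ℝ≥0) (h0 : 0 ≤ g 0) :
    pathMeasure g {0} = ENNReal.ofReal (g 0) := by
  rw [← pathMeasure_Iic g h0]
  congr 1
  ext; simp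

/-- The jump is a countable infimum of differences using only values up to time `t`; this form makes
it adapted. -/
lemma pathMeasure_singleton (g : StieltjesFunction ℝ≥0) (h0 : 0 ≤ g 0) {t : ℝ≥0} (ht : 0 < t) :
    pathMeasure g {t} =
      ⨅ n : ℕ, (ENNReal.ofReal (g t) - ENNReal.ofReal (g (t - t / (n + 1)))) := by
  have hle : ∀ n : ℕ, t - t / (n + 1) ≤ t := fun n => tsub_le_self
  have hanti : Antitone fun n : ℕ => Ioc (t - t / ((n : ℝ≥0) + 1)) t := fun m n hmn =>
    Ioc_subset_Ioc_left (by gcongr)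
  have hset : {t} = ⋂ n : ℕ, Ioc (t - t / ((n : ℝ≥0) + 1)) t := by
    ext s
    simp only [mem_singleton_iff, mem_iInter, mem_Ioc]
    refine ⟨?_, fun h => le_antisymm (h 0).2 ?_⟩
    · rintro rfl n
      exact ⟨tsub_lt_self ht (by positivity), le_rfl⟩
    · have h1 : Tendsto (fun n : ℕ => t - t / ((n : ℝ≥0) + 1)) atTop (𝓝 (t - t * 0)) := by
        have h2 : Tendsto (fun n : ℕ => 1 / ((n : ℝ≥0) + 1)) atTop (𝓝 0) := by
          rw [← NNReal.tendsto_coe]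
          simpa using tendsto_one_div_add_atTop_nhds_zero_nat (𝕜 := ℝ)
        simpa [div_eq_mul_inv] using (tendsto_const_nhds (x := t)).sub (h2.const_mul t)
      rw [mul_zero, tsub_zero] at h1
      exact le_of_tendsto h1 (.of_forall fun n => (h n).1.le)
  rw [hset, hanti.measure_iInter (fun n => measurableSet_Ioc.nullMeasurableSet)]
  · exact iInf_congr fun n => pathMeasure_Ioc g h0 (hle n)
  · refine ⟨0, ?_⟩
    rw [pathMeasure_Ioc g h0 (hle 0)]
    exact ne_top_of_le_ne_top ENNReal.ofReal_ne_top tsub_le_self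

lemma measurable_pathMeasure_singleton {Ω : Type*} {mΩ : MeasurableSpace Ω}
    {F : Filtration ℝ≥0 mΩ} {g : Ω → StieltjesFunction ℝ≥0} (h0 : ∀ ω, 0 ≤ g ω 0)
    (hg : ∀ t, Measurable[F t] fun ω => g ω t) (t : ℝ≥0) :
    Measurable[F t] fun ω => pathMeasure (g ω) {t} := by
  rcases eq_or_ne t 0 with rfl | ht
  · simp only [fun ω => pathMeasure_singleton_zero (g ω) (h0 ω)]
    exact (hg 0).ennreal_ofReal
  · simp only [fun ω => pathMeasure_singleton (g ω) (h0 ω) (pos_iff_ne_zero.2 ht)]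
    exact Measurable.iInf fun n => (hg t).ennreal_ofReal.sub
      ((hg _).ennreal_ofReal.mono (F.mono tsub_le_self) le_rfl)

variable {f g : StieltjesFunction ℝ≥0}

lemma eventually_eq_of_nat_valued (hf : ∀ t, ∃ k : ℕ, f t = k) (t : ℝ≥0) :
    ∀ᶠ s in 𝓝[≥] t, f s = f t := by
  have h1 : ∀ᶠ s in 𝓝[≥] t, f s < f t + 1 :=
    (f.right_continuous t).eventually (gt_mem_nhds (lt_add_one _))
  filter_upwards [h1, self_mem_nhdsWithin] with s hs hts
  obtain ⟨j, hj⟩ := hf s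
  obtain ⟨k, hk⟩ := hf t
  have h2 := f.mono (mem_Ici.1 hts)
  rw [hj, hk] at hs h2 ⊢
  norm_cast at hs h2 ⊢
  omega

lemma nonneg_of_nat_valued (hf : ∀ t, ∃ k : ℕ, f t = k) (t : ℝ≥0) : 0 ≤ f t := by
  obtain ⟨k, hk⟩ := hf t
  rw [hk]
  positivity

/-- A path which moves only when the counting path `f` jumps has no mass outside the jumps. -/
lemma pathMeasure_null_of_nat_valued (hf : ∀ t, ∃ k : ℕ, f t = k) (hg0 : 0 ≤ g 0)
    (hfg0 : f 0 = 0 → g 0 = 0) (hfg : ∀ s t, f s = f t → g s = g t) :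
    pathMeasure g {s | pathMeasure f {s} = 0} = 0 := by
  have hf0 := nonneg_of_nat_valued hf
  refine measure_null_of_locally_null _ fun s hs => ?_
  obtain ⟨b, hsb, hb⟩ := (mem_nhdsGE_iff_exists_Icc_subset).1 (eventually_eq_of_nat_valued hf s)
  have hsb' : g b = g s := hfg _ _ (hb (right_mem_Icc.2 (le_of_lt hsb)))
  rcases eq_or_ne s 0 with rfl | hs0
  · refine ⟨Iic b, mem_nhdsWithin_of_mem_nhds (Iic_mem_nhds hsb), ?_⟩
    rw [mem_ofPred_eq, pathMeasure_singleton_zero f (hf0 0), ENNReal.ofReal_eq_zero] at hs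
    rw [pathMeasure_Iic g hg0, hsb', hfg0 (le_antisymm hs (hf0 0)), ENNReal.ofReal_zero]
  · have hspos := pos_iff_ne_zero.2 hs0
    -- If the counting path differed from `f s` at all earlier times, each difference would be at
    -- least `1`, and so would the jump at `s`.
    obtain ⟨a, has, ha⟩ : ∃ a < s, f a = f s := by
      by_contra! hcon
      rw [mem_ofPred_eq, pathMeasure_singleton f (hf0 0) hspos] at hs
      have h1 : (1 : ℝ≥0∞) ≤ ⨅ n : ℕ,
          (ENNReal.ofReal (f s) - ENNReal.ofReal (f (s - s / (n + 1)))) := by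
        refine le_iInf fun n => ?_
        have hlt : s - s / ((n : ℝ≥0) + 1) < s := tsub_lt_self hspos (by positivity)
        have hle := f.mono hlt.le
        have hne := hcon _ hlt
        obtain ⟨j, hj⟩ := hf s
        obtain ⟨k, hk⟩ := hf (s - s / (n + 1))
        rw [hj, hk] at hle hne
        rw [hj, hk, ENNReal.ofReal_natCast, ENNReal.ofReal_natCast]
        norm_cast at hle hne ⊢
        omega
      rw [hs] at h1
      exact absurd h1 (by simp)
    refine ⟨Ioc a b, mem_nhdsWithin_of_mem_nhds (Ioc_mem_nhds has hsb), ?_⟩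
    rw [pathMeasure_Ioc g hg0 (has.le.trans (le_of_lt hsb)), hsb', hfg _ _ ha, tsub_self]

lemma countable_pathMeasure_singleton_ne_zero (f : StieltjesFunction ℝ≥0) :
    {s | pathMeasure f {s} ≠ 0}.Countable := by
  refine (f.countable_leftLim_ne.insert 0).mono fun s hs => ?_
  by_contra hcon
  simp only [mem_insert_iff, mem_ofPred_eq, not_or, not_not] at hcon
  refine hs ?_
  rw [pathMeasure, Measure.add_apply, StieltjesFunction.measure_singleton, hcon.2]
  simp [Ne.symm hcon.1]

/-- the ratio of the jumps of two paths -/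
def jumpRatio (g f : StieltjesFunction ℝ≥0) (s : ℝ≥0) : ℝ≥0 :=
  (pathMeasure g {s} / pathMeasure f {s}).toNNReal

/-- A path which moves only when the counting path `f` jumps is an integral with respect to it. -/
lemma setLIntegral_jumpRatio (hf : ∀ t, ∃ k : ℕ, f t = k) (hg0 : 0 ≤ g 0)
    (hfg0 : f 0 = 0 → g 0 = 0) (hfg : ∀ s t, f s = f t → g s = g t) (h : ℝ≥0 → ℝ≥0∞)
    (A : Set ℝ≥0) :
    ∫⁻ s in A, h s ∂(pathMeasure g) = ∫⁻ s in A, h s * jumpRatio g f s ∂(pathMeasure f) := by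
  have hf0 := nonneg_of_nat_valued hf
  set D := {s | pathMeasure f {s} ≠ 0} with hD
  have hDc : D.Countable := countable_pathMeasure_singleton_ne_zero f
  -- Both integrals are sums over the countably many jump times of `f`: the key is used once for `g`
  -- and once for `f` itself.
  have key : ∀ (g : StieltjesFunction ℝ≥0) (h : ℝ≥0 → ℝ≥0∞), 0 ≤ g 0 →
      (f 0 = 0 → g 0 = 0) → (∀ s t, f s = f t → g s = g t) →
      ∫⁻ s in A, h s ∂(pathMeasure g) = ∑' s : (A ∩ D : Set ℝ≥0), h s * pathMeasure g {(s : ℝ≥0)} := by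
    intro g h hg0 hfg0 hfg
    have hnull := pathMeasure_null_of_nat_valued hf hg0 hfg0 hfg
    rw [← lintegral_countable h (hDc.mono inter_subset_right)]
    refine setLIntegral_congr (inter_ae_eq_left_of_ae_eq_univ (ae_eq_univ.2 ?_)).symm
    convert hnull using 2
    ext s
    simp [hD]
  rw [key g h hg0 hfg0 hfg, key f _ (hf0 0) id fun _ _ h => h]
  refine tsum_congr fun s => ?_
  have hs : pathMeasure f {(s : ℝ≥0)} ≠ 0 := s.2.2
  have hs' := pathMeasure_singleton_ne_top f (hf0 0) s
  rw [jumpRatio, ENNReal.coe_toNNReal (ENNReal.div_ne_top (pathMeasure_singleton_ne_top g hg0 s) hs),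
    mul_assoc, ENNReal.div_mul_cancel hs hs']

variable (L N : StieltjesFunction ℝ≥0)

lemma iSup_lt_le_ofReal (t : ℝ≥0) :
    ⨆ u, ⨆ (_ : N u < N t), ENNReal.ofReal (L u) ≤ ENNReal.ofReal (L t) :=
  iSup₂_le fun _ hu => ENNReal.ofReal_le_ofReal (L.mono (N.mono.reflect_lt hu).le)

/-- The dividends `L` up to just before the last jump of the counting path `N`. -/
def delayed (hN : ∀ t, ∃ k : ℕ, N t = k) : StieltjesFunction ℝ≥0 where
  toFun t := (⨆ u, ⨆ (_ : N u < N t), ENNReal.ofReal (L u)).toReal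
  mono' s t hst := ENNReal.toReal_mono
    (ne_top_of_le_ne_top ENNReal.ofReal_ne_top (iSup_lt_le_ofReal L N t))
    (iSup₂_le fun u hu => le_iSup₂ (f := fun u (_ : N u < N t) => ENNReal.ofReal (L u)) u
      (hu.trans_le (N.mono hst)))
  right_continuous' t := by
    refine tendsto_const_nhds.congr' ?_
    filter_upwards [eventually_eq_of_nat_valued hN t] with s hs
    rw [hs]

variable {L N} (hN : ∀ t, ∃ k : ℕ, N t = k)

lemma ofReal_delayed (t : ℝ≥0) :
    ENNReal.ofReal (delayed L N hN t) = ⨆ u, ⨆ (_ : N u < N t), ENNReal.ofReal (L u) :=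
  ENNReal.ofReal_toReal (ne_top_of_le_ne_top ENNReal.ofReal_ne_top (iSup_lt_le_ofReal L N t))

lemma delayed_nonneg (t : ℝ≥0) : 0 ≤ delayed L N hN t := ENNReal.toReal_nonneg

lemma delayed_le (hL : ∀ t, 0 ≤ L t) (t : ℝ≥0) : delayed L N hN t ≤ L t := by
  rw [← ENNReal.ofReal_le_ofReal_iff (hL t), ofReal_delayed]
  exact iSup_lt_le_ofReal L N t

lemma delayed_zero : delayed L N hN 0 = 0 := by
  have : ∀ u, ¬ N u < N 0 := fun u => not_lt.2 (N.mono zero_le)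
  have h := ofReal_delayed (L := L) hN 0
  simp only [this, iSup_false, bot_eq_zero] at h
  exact le_antisymm (ENNReal.ofReal_eq_zero.1 (by simpa using h)) (delayed_nonneg hN 0)

lemma delayed_congr {s t : ℝ≥0} (h : N s = N t) : delayed L N hN s = delayed L N hN t := by
  change (⨆ u, ⨆ (_ : N u < N s), ENNReal.ofReal (L u)).toReal = _
  rw [h]
  rfl

/-- `N` is constant just to the right of `u`, so a dense time there still precedes the last jump and
carries at least as much dividend. Taking minima with `t` keeps all observations in the past, for
adaptedness. -/
lemma ofReal_delayed_eq (t : ℝ≥0) : ENNReal.ofReal (delayed L N hN t) =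
    ⨆ n, ⨆ (_ : N (min (TopologicalSpace.denseSeq ℝ≥0 n) t) < N t),
      ENNReal.ofReal (L (min (TopologicalSpace.denseSeq ℝ≥0 n) t)) := by
  rw [ofReal_delayed]
  refine le_antisymm (iSup₂_le fun u hu => ?_) (iSup₂_le fun n hn =>
    le_iSup₂ (f := fun u (_ : N u < N t) => ENNReal.ofReal (L u)) _ hn)
  obtain ⟨b, hub, hb⟩ := (mem_nhdsGE_iff_exists_Ico_subset).1 (eventually_eq_of_nat_valued hN u)
  have hut := N.mono.reflect_lt hu
  obtain ⟨n, hn⟩ := (TopologicalSpace.denseRange_denseSeq ℝ≥0).exists_mem_open isOpen_Ioo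
    (nonempty_Ioo.2 (lt_min (mem_Ioi.1 hub) hut))
  have hnt : min (TopologicalSpace.denseSeq ℝ≥0 n) t = TopologicalSpace.denseSeq ℝ≥0 n :=
    min_eq_left (hn.2.le.trans (min_le_right _ _))
  have hNn : N (TopologicalSpace.denseSeq ℝ≥0 n) = N u :=
    hb ⟨hn.1.le, hn.2.trans_le (min_le_left _ _)⟩
  refine le_trans ?_ (le_iSup₂ (f := fun n (_ : N (min (TopologicalSpace.denseSeq ℝ≥0 n) t) < N t) =>
    ENNReal.ofReal (L (min (TopologicalSpace.denseSeq ℝ≥0 n) t))) n (by rwa [hnt, hNn]))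
  rw [hnt]
  exact ENNReal.ofReal_le_ofReal (L.mono hn.1.le)

end paths

/-! ### Poisson superpositions and convergence of the periodic values. -/

section map

variable {E Ω : Type*} [TopologicalSpace E] [MeasurableSpace E] [MeasurableSpace Ω] {M : MAP E Ω}
  (C : PoissonClocks M)

namespace PoissonClocks

lemma superposition_nat (n : ℕ) (ω : Ω) (t : ℝ≥0) : ∃ k : ℕ, C.superposition n ω t = k :=
  ⟨∑ k ∈ Finset.range n, C.N k t ω, by simp [superposition]⟩

lemma superposition_nonneg (n : ℕ) (ω : Ω) (t : ℝ≥0) : 0 ≤ C.superposition n ω t :=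
  nonneg_of_nat_valued (C.superposition_nat n ω) t

lemma measurable_superposition (n : ℕ) (t : ℝ≥0) :
    Measurable[M.filt t] fun ω => C.superposition n ω t := by
  change Measurable[M.filt t] fun ω => ∑ k ∈ Finset.range n, (C.N k t ω : ℝ)
  refine Finset.measurable_sum _ fun k _ => ?_
  exact (measurable_from_top (f := fun j : ℕ => (j : ℝ))).comp (C.adapted k t)

/-- Each clock is non-decreasing, so equality of the sums forces equality clock by clock. -/
lemma superposition_eq_of_le {m n : ℕ} (hmn : m ≤ n) {ω : Ω} {s t : ℝ≥0}
    (h : C.superposition n ω s = C.superposition n ω t) :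
    C.superposition m ω s = C.superposition m ω t := by
  wlog hst : s ≤ t generalizing s t
  · exact (this h.symm (le_of_not_ge hst)).symm
  have hle : ∀ k ∈ Finset.range n, (C.N k s ω : ℝ) ≤ C.N k t ω := fun k _ =>
    Nat.cast_le.2 (C.mono k ω hst)
  have h1 := (Finset.sum_eq_sum_iff_of_le hle).1 h
  exact Finset.sum_congr rfl fun k hk => h1 k (Finset.range_mono hmn hk)

lemma superposition_zero_of_le {m n : ℕ} (hmn : m ≤ n) {ω : Ω}
    (h : C.superposition n ω 0 = 0) : C.superposition m ω 0 = 0 := by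
  have h1 := (Finset.sum_eq_zero_iff_of_nonneg (s := Finset.range n)
    (f := fun k => (C.N k 0 ω : ℝ)) (fun k _ => Nat.cast_nonneg _)).1 h
  exact Finset.sum_eq_zero fun k hk => h1 k (Finset.range_mono hmn hk)

lemma superposition_lt {n k : ℕ} (hk : k < n) {ω : Ω} {s t : ℝ≥0} (hst : s ≤ t)
    (h : C.N k s ω < C.N k t ω) : C.superposition n ω s < C.superposition n ω t :=
  Finset.sum_lt_sum (fun j _ => Nat.cast_le.2 (C.mono j ω hst))
    ⟨k, Finset.mem_range.2 hk, Nat.cast_lt.2 h⟩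

/-- By independence the first `n` clocks all stay still with probability `c ^ n`, where `c < 1` is
the probability for a single clock. -/
lemma prob_no_jump (z : ℝ × E) {r₁ r₂ : ℝ≥0} (h : r₁ < r₂) :
    ∀ᵐ ω ∂(M.P z), ∃ k, C.N k r₁ ω < C.N k r₂ ω := by
  have := M.isProb z
  set c : ℝ≥0∞ := ENNReal.ofReal (Real.exp (-(r₂ - r₁ : ℝ≥0))) with hc
  have hc1 : c < 1 := by
    rw [hc, ← ENNReal.ofReal_one]
    refine (ENNReal.ofReal_lt_ofReal_iff one_pos).2 ?_
    rw [Real.exp_lt_one_iff, neg_lt_zero]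
    exact_mod_cast tsub_pos_of_lt h
  set B : Set (ℝ≥0 → ℕ) := {p | p r₂ - p r₁ = 0} with hB
  have hBm : MeasurableSet B :=
    ((measurable_pi_apply r₂).sub (measurable_pi_apply r₁)) (measurableSet_singleton 0)
  have hNm : ∀ k t, Measurable (C.N k t) := fun k t => (C.adapted k t).mono (M.filt.le t) le_rfl
  have hone : ∀ k, M.P z ((fun (ω : Ω) (t : ℝ≥0) => C.N k t ω) ⁻¹' B) = c := by
    intro k
    have h1 := congrArg (fun μ : Measure ℕ => μ {0}) (C.law k z r₁ r₂ h.le)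
    simp only [poissonMeasure_singleton] at h1
    have hsub : Measurable fun ω => C.N k r₂ ω - C.N k r₁ ω := (hNm k r₂).sub (hNm k r₁)
    rw [Measure.map_apply hsub (measurableSet_singleton 0)] at h1
    refine Eq.trans (by rfl) (h1.trans ?_)
    simp [hc]
  have hpow : ∀ n : ℕ, M.P z {ω | ¬ ∃ k, C.N k r₁ ω < C.N k r₂ ω} ≤ c ^ n := by
    intro n
    have h2 := (C.indep z).measure_inter_preimage_eq_mul (Finset.range n) (sets := fun _ => B)
      (fun _ _ => hBm)
    simp only [hone, Finset.prod_const, Finset.card_range] at h2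
    rw [← h2]
    refine measure_mono fun ω hω => ?_
    simp only [mem_ofPred_eq, not_exists, not_lt] at hω
    simp only [mem_iInter]
    intro k _
    exact Nat.sub_eq_zero_of_le (hω k)
  rw [ae_iff]
  exact le_antisymm (ge_of_tendsto (ENNReal.tendsto_pow_atTop_nhds_zero_of_lt_one hc1)
    (.of_forall hpow)) zero_le

/-- Almost surely, every time interval contains a jump of some clock. -/
lemma ae_jumps_dense (z : ℝ × E) :
    ∀ᵐ ω ∂(M.P z), ∀ u s, u < s → ∀ᶠ n in atTop,
      C.superposition n ω u < C.superposition n ω s := by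
  let d := TopologicalSpace.denseSeq ℝ≥0
  have h : ∀ᵐ ω ∂(M.P z), ∀ i j, d i < d j → ∃ k, C.N k (d i) ω < C.N k (d j) ω := by
    simp only [ae_all_iff]
    exact fun i j hij => C.prob_no_jump z hij
  filter_upwards [h] with ω hω u s hus
  -- The null set was fixed using countably many times; two of them are now placed inside `(u, s)`.
  obtain ⟨v, huv, hvs⟩ := exists_between hus
  obtain ⟨i, hi⟩ := (TopologicalSpace.denseRange_denseSeq ℝ≥0).exists_mem_open isOpen_Ioo
    (nonempty_Ioo.2 huv)
  obtain ⟨j, hj⟩ := (TopologicalSpace.denseRange_denseSeq ℝ≥0).exists_mem_open isOpen_Ioo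
    (nonempty_Ioo.2 hvs)
  obtain ⟨k, hk⟩ := hω i j (hi.2.trans hj.1)
  filter_upwards [eventually_gt_atTop k] with n hn
  refine C.superposition_lt hn hus.le ?_
  exact (C.mono k ω hi.1.le).trans_lt (hk.trans_le (C.mono k ω hj.2.le))

end PoissonClocks

/-- Every jump of the smaller superposition is one of the larger, so multiplying the payment rate by
the ratio of jump sizes changes the integrator. The ratio vanishes where only the larger one jumps.
-/
lemma paysAtJumpsOf_mono {π : Strategy M} {m n : ℕ} (hmn : m ≤ n)
    (h : π.PaysAtJumpsOf (C.superposition m)) : π.PaysAtJumpsOf (C.superposition n) := by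
  obtain ⟨ℓ, hℓ, hL⟩ := h
  refine ⟨fun t ω => ℓ t ω * jumpRatio (C.superposition m ω) (C.superposition n ω) t,
    fun t => (hℓ t).mul (Measurable.ennreal_toNNReal (Measurable.div
      (measurable_pathMeasure_singleton (fun ω => C.superposition_nonneg m ω 0)
        (C.measurable_superposition m) t)
      (measurable_pathMeasure_singleton (fun ω => C.superposition_nonneg n ω 0)
        (C.measurable_superposition n) t))), fun z => (hL z).mono fun ω hω t => ?_⟩
  rw [hω t, setLIntegral_jumpRatio (C.superposition_nat n ω) (C.superposition_nonneg m ω 0)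
    (C.superposition_zero_of_le hmn) (fun _ _ => C.superposition_eq_of_le hmn) _ _]
  simp only [ENNReal.coe_mul]

lemma valuePoisson_mono (q : E → ℝ) (β : ℝ) {m n : ℕ} (hmn : m ≤ n) (z : ℝ × E) :
    valuePoisson M C q β m z ≤ valuePoisson M C q β n z :=
  iSup₂_le fun π hπ => le_iSup₂ (f := fun (π : Strategy M)
    (_ : π.Admissible q ∧ π.PaysAtJumpsOf (C.superposition n)) => π.value q β z) π
    ⟨hπ.1, paysAtJumpsOf_mono C hmn hπ.2⟩

/-- The strategy which postpones the dividends of `π` to the jump times of the `n`-th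
superposition. -/
def Strategy.postpone (π : Strategy M) (n : ℕ) : Strategy M where
  L ω := delayed (π.L ω) (C.superposition n ω) (C.superposition_nat n ω)
  R := π.R
  L_nonneg ω t := delayed_nonneg (C.superposition_nat n ω) t
  R_nonneg := π.R_nonneg
  L_adapted t := by
    have h1 : (fun ω => delayed (π.L ω) (C.superposition n ω) (C.superposition_nat n ω) t) =
        fun ω => (⨆ k, ⨆ (_ : C.superposition n ω (min (TopologicalSpace.denseSeq ℝ≥0 k) t) <
          C.superposition n ω t), ENNReal.ofReal
            (π.L ω (min (TopologicalSpace.denseSeq ℝ≥0 k) t))).toReal := by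
      ext ω
      rw [← ofReal_delayed_eq (C.superposition_nat n ω),
        ENNReal.toReal_ofReal (delayed_nonneg (C.superposition_nat n ω) t)]
    rw [h1]
    refine Measurable.ennreal_toReal (Measurable.iSup fun k => ?_)
    have hk : min (TopologicalSpace.denseSeq ℝ≥0 k) t ≤ t := min_le_right _ _
    have h2 : (fun ω => ⨆ (_ : C.superposition n ω (min (TopologicalSpace.denseSeq ℝ≥0 k) t) <
          C.superposition n ω t), ENNReal.ofReal
            (π.L ω (min (TopologicalSpace.denseSeq ℝ≥0 k) t))) =
        {ω | C.superposition n ω (min (TopologicalSpace.denseSeq ℝ≥0 k) t) <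
          C.superposition n ω t}.indicator fun ω => ENNReal.ofReal
            (π.L ω (min (TopologicalSpace.denseSeq ℝ≥0 k) t)) := by
      ext ω
      by_cases hω : C.superposition n ω (min (TopologicalSpace.denseSeq ℝ≥0 k) t) <
          C.superposition n ω t <;> simp [hω]
    rw [h2]
    exact (((π.L_adapted _).mono (M.filt.mono hk) le_rfl).ennreal_ofReal).indicator
      (measurableSet_lt ((C.measurable_superposition n _).mono (M.filt.mono hk) le_rfl)
        (C.measurable_superposition n t))
  R_adapted := π.R_adapted
  solvent z := (π.solvent z).mono fun ω hω t => by
    have := delayed_le (C.superposition_nat n ω) (π.L_nonneg ω) t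
    linarith [hω t]

lemma Strategy.paysAtJumpsOf_postpone (π : Strategy M) (n : ℕ) :
    (π.postpone C n).PaysAtJumpsOf (C.superposition n) := by
  refine ⟨fun t ω => jumpRatio ((π.postpone C n).L ω) (C.superposition n ω) t,
    fun t => Measurable.ennreal_toNNReal (Measurable.div
      (measurable_pathMeasure_singleton (fun ω => (π.postpone C n).L_nonneg ω 0)
        (π.postpone C n).L_adapted t)
      (measurable_pathMeasure_singleton (fun ω => C.superposition_nonneg n ω 0)
        (C.measurable_superposition n) t)), fun z => ae_of_all _ fun ω t => ?_⟩
  have h1 := setLIntegral_jumpRatio (C.superposition_nat n ω) ((π.postpone C n).L_nonneg ω 0)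
    (fun _ => delayed_zero (C.superposition_nat n ω))
    (fun _ _ => delayed_congr (C.superposition_nat n ω)) (fun _ => 1) (Icc 0 t)
  simp only [one_mul, lintegral_one, Measure.restrict_apply_univ] at h1
  have h2 : Icc 0 t = Iic t := by ext; simp
  rw [← h1, h2, pathMeasure_Iic _ ((π.postpone C n).L_nonneg ω 0)]

variable [BorelSpace E] [RadonSpace E] {q : E → ℝ} {q₀ : ℝ}

/-- The injections are unchanged, so only the dividend term moves; eventually a jump separates any
`u < s`, which is the hypothesis of `tendsto_discInt`. -/
lemma Standing.tendsto_value_postpone (H : Standing M q q₀) {π : Strategy M}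
    (hπ : π.Admissible q) (β : ℝ) (z : ℝ × E) :
    Tendsto (fun n => (π.postpone C n).value q β z) atTop (𝓝 (π.value q β z)) := by
  have hR : ∀ n z, (π.postpone C n).vR q z = π.vR q z := fun n z => rfl
  have hπn : ∀ n, (π.postpone C n).Admissible q := fun n => hπ
  have hL : Tendsto (fun n => (π.postpone C n).vL q z) atTop (𝓝 (π.vL q z)) := by
    simp only [H.vL_eq]
    refine tendsto_discInt H.measurable π.L z _
      (fun n => (π.postpone C n).measurable_L.ennreal_ofReal)
      (fun n s ω => ENNReal.ofReal_le_ofReal (delayed_le (C.superposition_nat n ω) (π.L_nonneg ω) s)) ?_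
    filter_upwards [C.ae_jumps_dense z] with ω hω u s hus
    filter_upwards [hω u s hus] with n hn
    refine (min_le_left _ _).trans (le_of_le_of_eq ?_ (ofReal_delayed (C.superposition_nat n ω) s).symm)
    exact le_iSup₂ (f := fun u (_ : C.superposition n ω u < C.superposition n ω s) =>
      ENNReal.ofReal (π.L ω u)) u hn
  simp only [fun n => H.value_eq (hπn n), H.value_eq hπ, hR]
  refine (continuous_coe_real_ereal.tendsto _).comp (Tendsto.sub_const ?_ _)
  exact (ENNReal.tendsto_toReal (H.vL_lt_top hπ z).ne).comp hL

theorem Standing.tendsto_valuePoisson (H : Standing M q q₀) (β : ℝ) (z : ℝ × E) :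
    Tendsto (fun n => valuePoisson M C q β n z) atTop (𝓝 (valueCC M q β z)) := by
  refine tendsto_of_le_liminf_of_limsup_le (iSup₂_le fun π hπ => ?_)
    (limsup_le_of_le (h := .of_forall fun n => valuePoisson_le_valueCC M C q β n z))
  rw [← (H.tendsto_value_postpone C hπ β z).liminf_eq]
  refine liminf_le_liminf (.of_forall fun n => ?_)
  exact le_iSup₂ (f := fun (π : Strategy M)
    (_ : π.Admissible q ∧ π.PaysAtJumpsOf (C.superposition n)) => π.value q β z) (π.postpone C n)
    ⟨hπ, π.paysAtJumpsOf_postpone C n⟩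

end map

/-! ### Conditional expectations of non-negative weights. -/

section projection

variable {Ω B : Type*} [MeasurableSpace Ω] [MeasurableSpace B] {μ : Measure Ω} [IsFiniteMeasure μ]
  {T : Ω → B} {f : Ω → ℝ≥0∞}

/-- A weight can be replaced by its conditional expectation given `T`. -/
lemma exists_conditional_weight (hT : Measurable T) (hf : Measurable f) :
    ∃ ρ : B → ℝ≥0∞, Measurable ρ ∧ ∀ F : B → ℝ≥0∞, Measurable F →
      ∫⁻ ω, f ω * F (T ω) ∂μ = ∫⁻ ω, ρ (T ω) * F (T ω) ∂μ := by
  have hac : (μ.withDensity f).map T ≪ μ.map T := (withDensity_absolutelyContinuous μ f).map hT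
  have hρ := Measure.measurable_rnDeriv ((μ.withDensity f).map T) (μ.map T)
  -- The weight is the Radon–Nikodym density of the `f`-weighted law of `T` with respect to its law.
  refine ⟨((μ.withDensity f).map T).rnDeriv (μ.map T), hρ, fun F hF => ?_⟩
  have h1 := lintegral_withDensity_eq_lintegral_mul μ hf (hF.comp hT)
  simp only [Pi.mul_apply, Function.comp_apply] at h1
  have h2 := lintegral_map (μ := μ) (hρ.mul hF) hT
  simp only [Pi.mul_apply] at h2
  rw [← h1, ← lintegral_map hF hT, ← h2]
  conv_lhs => rw [← Measure.withDensity_rnDeriv_eq _ _ hac]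
  rw [lintegral_withDensity_eq_lintegral_mul _ hρ hF]
  rfl

/-- Monotonicity of conditional expectation, tested on indicators of sets in the target of `T`. -/
lemma ae_le_of_conditional_weight (hT : Measurable T) {g : Ω → ℝ≥0∞} {φ ψ : B → ℝ≥0∞}
    (hφ : Measurable φ) (hψ : Measurable ψ)
    (hfφ : ∀ F : B → ℝ≥0∞, Measurable F → ∫⁻ ω, f ω * F (T ω) ∂μ = ∫⁻ ω, φ (T ω) * F (T ω) ∂μ)
    (hgψ : ∀ F : B → ℝ≥0∞, Measurable F → ∫⁻ ω, g ω * F (T ω) ∂μ = ∫⁻ ω, ψ (T ω) * F (T ω) ∂μ)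
    (hfg : ∀ᵐ ω ∂μ, f ω ≤ g ω) : ∀ᵐ ω ∂μ, φ (T ω) ≤ ψ (T ω) := by
  refine ae_of_ae_map hT.aemeasurable (p := fun b => φ b ≤ ψ b)
    (ae_le_of_forall_setLIntegral_le_of_sigmaFinite hφ fun A hA _ => ?_)
  have key : ∀ φ : B → ℝ≥0∞, Measurable φ → ∫⁻ b in A, φ b ∂(μ.map T) =
      ∫⁻ ω, φ (T ω) * A.indicator (fun _ => 1) (T ω) ∂μ := by
    intro φ hφ
    rw [← lintegral_indicator hA, lintegral_map (hφ.indicator hA) hT]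
    refine lintegral_congr fun ω => ?_
    by_cases h : T ω ∈ A <;> simp [h]
  have hA1 : Measurable (A.indicator fun _ => (1 : ℝ≥0∞)) := measurable_const.indicator hA
  rw [key φ hφ, key ψ hψ, ← hfφ _ hA1, ← hgψ _ hA1]
  refine lintegral_mono_ae (hfg.mono fun ω h => ?_)
  gcongr

/-- Truncating makes the bound hold everywhere rather than almost surely; it is later needed on
every path, including translated ones. -/
lemma exists_bounded_conditional_weight (hT : Measurable T) (hf : Measurable f) {c : ℝ≥0∞}
    (hfc : ∀ ω, f ω ≤ c) :
    ∃ ρ : B → ℝ≥0∞, Measurable ρ ∧ (∀ b, ρ b ≤ c) ∧ ∀ F : B → ℝ≥0∞, Measurable F →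
      ∫⁻ ω, f ω * F (T ω) ∂μ = ∫⁻ ω, ρ (T ω) * F (T ω) ∂μ := by
  obtain ⟨ρ, hρ, h⟩ := exists_conditional_weight (μ := μ) hT hf
  refine ⟨fun b => min (ρ b) c, hρ.min measurable_const, fun b => min_le_right _ _,
    fun F hF => (h F hF).trans (lintegral_congr_ae ?_)⟩
  filter_upwards [ae_le_of_conditional_weight hT hρ (ψ := fun _ => c) measurable_const h
    (fun F hF => rfl) (ae_of_all _ hfc)] with ω hω
  rw [min_eq_left hω]

end projection

/-! ### Non-anticipating projection on the path of the process. -/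

/-- the path stopped at time `s` -/
def stopPath {S : Type*} (s : ℝ≥0) (w : ℝ≥0 → S) (r : ℝ≥0) : S := w (min r s)

lemma measurable_stopPath {S : Type*} [MeasurableSpace S] (s : ℝ≥0) :
    Measurable (stopPath (S := S) s) :=
  measurable_pi_lambda _ fun _ => measurable_pi_apply _

/-- Concatenation of two paths at time `s`. -/
def gluePath {S : Type*} (s : ℝ≥0) (w : (ℝ≥0 → S) × (ℝ≥0 → S)) (r : ℝ≥0) : S :=
  if r < s then w.1 r else w.2 (r - s)

lemma measurable_gluePath {S : Type*} [MeasurableSpace S] (s : ℝ≥0) :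
    Measurable (gluePath (S := S) s) := by
  refine measurable_pi_lambda _ fun r => ?_
  unfold gluePath
  split_ifs
  · exact (measurable_pi_apply r).comp measurable_fst
  · exact (measurable_pi_apply (r - s)).comp measurable_snd

lemma gluePath_stopPath {S : Type*} (s : ℝ≥0) (w : ℝ≥0 → S) :
    gluePath s (stopPath s w, fun t => w (s + t)) = w := by
  ext r
  unfold gluePath stopPath
  split_ifs with h
  · simp [h.le]
  · simp [add_tsub_cancel_of_le (not_lt.1 h)]

section map

variable {E Ω : Type*} [TopologicalSpace E] [MeasurableSpace E] [MeasurableSpace Ω] {M : MAP E Ω}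

lemma measurable_path : Measurable fun ω t => M.Z t ω :=
  measurable_pi_lambda _ measurable_Z

/-- A bounded weight which is known at time `s` has a conditional expectation given the whole path
of `(X, Y)` which depends only on the path up to time `s`. -/
theorem exists_stopped_weight (z : ℝ × E) (s : ℝ≥0) {f : Ω → ℝ≥0∞} (hf : Measurable[M.filt s] f)
    {c : ℝ≥0∞} (hc : c ≠ ⊤) (hfc : ∀ ω, f ω ≤ c) :
    ∃ φ : (ℝ≥0 → ℝ × E) → ℝ≥0∞, Measurable φ ∧ (∀ w, φ w ≤ c) ∧
      ∀ F : (ℝ≥0 → ℝ × E) → ℝ≥0∞, Measurable F →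
        ∫⁻ ω, f ω * F (fun t => M.Z t ω) ∂(M.P z) =
          ∫⁻ ω, φ (stopPath s fun t => M.Z t ω) * F (fun t => M.Z t ω) ∂(M.P z) := by
  have := M.isProb z
  have hf' : Measurable f := hf.mono (M.filt.le s) le_rfl
  set T : Ω → ℝ≥0 → ℝ × E := fun ω => stopPath s fun t => M.Z t ω with hTdef
  set Θ : Ω → ℝ≥0 → ℝ × E := fun ω t => M.Z (s + t) ω with hΘdef
  have hT : Measurable[M.filt s] T := @measurable_pi_lambda _ _ _ (M.filt s) _ T fun r =>
    (M.adapted (min r s)).mono (M.filt.mono (min_le_right _ _)) le_rfl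
  have hT' : Measurable T := hT.mono (M.filt.le s) le_rfl
  have hΘ : Measurable Θ := measurable_pi_lambda _ fun t => measurable_Z _
  obtain ⟨φ, hφ, hφc, h⟩ := exists_bounded_conditional_weight (μ := M.P z) hT' hf' hfc
  refine ⟨φ, hφ, hφc, fun F hF => ?_⟩
  have hφT : Measurable[M.filt s] fun ω => φ (T ω) := hφ.comp hT
  have hφT' : Measurable fun ω => φ (T ω) := hφT.mono (M.filt.le s) le_rfl
  have hfin : ∀ g : Ω → ℝ≥0∞, (∀ ω, g ω ≤ c) → IsFiniteMeasure ((M.P z).withDensity g) :=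
    fun g hg => isFiniteMeasure_withDensity (ne_top_of_le_ne_top hc
      ((lintegral_mono hg).trans (by simp)))
  have := hfin f hfc
  have hpair : Measurable fun ω => (T ω, Θ ω) := hT'.prodMk hΘ
  have hrect : ∀ g : Ω → ℝ≥0∞, Measurable g → ∀ A B, MeasurableSet A → MeasurableSet B →
      ((M.P z).withDensity g).map (fun ω => (T ω, Θ ω)) (A ×ˢ B) =
        ∫⁻ ω, (g ω * A.indicator (fun _ => 1) (T ω)) * B.indicator (fun _ => 1) (Θ ω) ∂(M.P z) := by
    intro g hg A B hA hB
    rw [Measure.map_apply hpair (hA.prod hB), withDensity_apply _ (hpair (hA.prod hB)),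
      ← lintegral_indicator (hpair (hA.prod hB))]
    refine lintegral_congr fun ω => ?_
    by_cases h1 : T ω ∈ A <;> by_cases h2 : Θ ω ∈ B <;> simp [h1, h2]
  -- `φ` is so far only tested against the past `T`. The joint laws of past and future under the two
  -- weights are compared on rectangles, where the Markov property replaces the future by a function
  -- of the state at `s`.
  have hmeas : ((M.P z).withDensity f).map (fun ω => (T ω, Θ ω)) =
      ((M.P z).withDensity fun ω => φ (T ω)).map (fun ω => (T ω, Θ ω)) := by
    refine Measure.ext_prod fun {A B} hA hB => ?_
    have hB1 : Measurable (B.indicator fun _ => (1 : ℝ≥0∞)) := measurable_const.indicator hB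
    have hA1 : Measurable (A.indicator fun _ => (1 : ℝ≥0∞)) := measurable_const.indicator hA
    obtain ⟨hg, hmar⟩ := markov_pathMAP (M := M) hB1
    set g := fun z => ∫⁻ ω, B.indicator (fun _ => (1 : ℝ≥0∞)) (fun t => M.Z t ω) ∂(M.P z)
    have hga := hg ((M.P z).map (M.Z s)) inferInstance
    have hgs : AEMeasurable (fun ω => g (M.Z s ω)) (M.P z) := hga.comp_measurable (measurable_Z s)
    -- The state at `s` is read off the stopped path; a measurable version is needed because `g` is
    -- only universally measurable.
    have hgm : ∀ᵐ ω ∂(M.P z), g (M.Z s ω) = hga.mk g (T ω s) := by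
      filter_upwards [ae_of_ae_map (measurable_Z s).aemeasurable hga.ae_eq_mk] with ω hω
      simp [hω, hTdef, stopPath]
    have step : ∀ k : Ω → ℝ≥0∞, Measurable[M.filt s] k →
        ∫⁻ ω, k ω * A.indicator (fun _ => 1) (T ω) * B.indicator (fun _ => 1) (Θ ω) ∂(M.P z) =
          ∫⁻ ω, k ω * (A.indicator (fun _ => 1) (T ω) * hga.mk g (T ω s)) ∂(M.P z) := by
      intro k hk
      refine (lintegral_mul_eq_of_setLIntegral_eq (M.filt.le s) (hB1.comp hΘ).aemeasurable hgs
        (fun A' hA' => hmar M.Z z (oneStep_Z z) s A' hA') (hk.mul (hA1.comp hT))).trans ?_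
      refine lintegral_congr_ae (hgm.mono fun ω hω => ?_)
      simp [hω, mul_assoc]
    rw [hrect f hf' A B hA hB, hrect _ hφT' A B hA hB, step f hf, step _ hφT]
    exact h (fun w => A.indicator (fun _ => 1) w * hga.mk g (w s))
      (hA1.mul (hga.measurable_mk.comp (measurable_pi_apply s)))
  -- The whole path is recovered by gluing its past to its future, so equality of the joint laws
  -- suffices.
  have hfinal : ∀ g : Ω → ℝ≥0∞, Measurable g → ∫⁻ ω, g ω * F (fun t => M.Z t ω) ∂(M.P z) =
      ∫⁻ p, F (gluePath s p) ∂(((M.P z).withDensity g).map fun ω => (T ω, Θ ω)) := by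
    intro g hg
    have hFg := hF.comp (measurable_gluePath (S := ℝ × E) s)
    refine Eq.trans ?_ ((lintegral_map hFg hpair).trans
      (lintegral_withDensity_eq_lintegral_mul _ hg (hFg.comp hpair))).symm
    refine lintegral_congr fun ω => ?_
    simp [hTdef, hΘdef, gluePath_stopPath]
  rw [hfinal f hf', hfinal _ hφT', hmeas]

end map

/-! ### Dividends on a time grid. -/

section grid

/-- the index of the last point of the grid `{k / (m + 1)}` before `t` -/
def gridIndex (m : ℕ) (t : ℝ≥0) : ℕ := ⌊(m + 1 : ℝ≥0) * t⌋₊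

/-- the points of the grid -/
def gridPoint (m k : ℕ) : ℝ≥0 := k / (m + 1)

lemma gridIndex_mono (m : ℕ) : Monotone (gridIndex m) := fun _ _ h => Nat.floor_mono (by gcongr)

lemma gridPoint_le_iff {m k : ℕ} {t : ℝ≥0} : gridPoint m k ≤ t ↔ k ≤ gridIndex m t := by
  rw [gridPoint, gridIndex, div_le_iff₀ (by positivity), Nat.le_floor_iff zero_le, mul_comm]

lemma gridPoint_mono (m : ℕ) : Monotone (gridPoint m) := fun _ _ h => by
  unfold gridPoint
  gcongr

lemma lt_gridPoint_succ (m : ℕ) (t : ℝ≥0) : t < gridPoint m (gridIndex m t + 1) := by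
  rw [← not_le, gridPoint_le_iff]
  omega

lemma measurable_gridIndex (m : ℕ) : Measurable (gridIndex m) :=
  Nat.measurable_floor.comp (measurable_id.const_mul _)

lemma eventually_le_gridPoint {u s : ℝ≥0} (hus : u < s) :
    ∀ᶠ m : ℕ in atTop, u ≤ gridPoint m (gridIndex m s) := by
  obtain ⟨n, hn⟩ := exists_nat_one_div_lt (sub_pos.2 (NNReal.coe_lt_coe.2 hus))
  filter_upwards [eventually_ge_atTop n] with m hm
  have h1 := lt_gridPoint_succ m s
  have h2 : gridPoint m (gridIndex m s + 1) = gridPoint m (gridIndex m s) + 1 / (m + 1) := by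
    simp [gridPoint, add_div]
  rw [h2, ← NNReal.coe_lt_coe] at h1
  have h3 : 1 / ((m : ℝ) + 1) ≤ 1 / (n + 1) := by gcongr
  rw [← NNReal.coe_le_coe]
  push_cast at h1
  linarith

/-- The right-continuous path which takes the values `d k` at the points of the grid and is
constant in between. -/
def gridPath (m : ℕ) (d : ℕ → ℝ) (hd : Monotone d) : StieltjesFunction ℝ≥0 where
  toFun t := d (gridIndex m t)
  mono' _ _ h := hd (gridIndex_mono m h)
  right_continuous' t := by
    refine tendsto_const_nhds.congr' ?_
    filter_upwards [Ico_mem_nhdsGE (lt_gridPoint_succ m t)] with s hs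
    congr 1
    refine le_antisymm (gridIndex_mono m hs.1) (Nat.lt_succ_iff.1 ?_)
    rw [← not_le, ← gridPoint_le_iff, not_le]
    exact hs.2

/-- Dividends which are bounded by `m`, paid at the points of the grid, and determined by the past
of the path. -/
structure GridDividend (E : Type*) [MeasurableSpace E] (m : ℕ) where
  /-- cumulative dividends at the points of the grid -/
  D : ℕ → (ℝ≥0 → ℝ × E) → ℝ
  measurable : ∀ k, Measurable (D k)
  mono : ∀ w, Monotone fun k => D k w
  nonneg : ∀ k w, 0 ≤ D k w
  le : ∀ k w, D k w ≤ m
  D_stopPath : ∀ k w, D k (stopPath (gridPoint m k) w) = D k w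

/-- The minimal injections up to time `s` needed for paying the dividends `d`. -/
def GridDividend.inj {E : Type*} [MeasurableSpace E] {m : ℕ} (d : GridDividend E m) (s : ℝ≥0)
    (w : ℝ≥0 → ℝ × E) : ℝ≥0∞ :=
  ENNReal.ofReal (d.D (gridIndex m s) w - (w s).1) ⊔ ⨆ n, ENNReal.ofReal
    (d.D (gridIndex m (min (TopologicalSpace.denseSeq ℝ≥0 n) s)) w -
      (w (min (TopologicalSpace.denseSeq ℝ≥0 n) s)).1)

lemma GridDividend.measurable_inj {E : Type*} [MeasurableSpace E] {m : ℕ} (d : GridDividend E m)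
    (s : ℝ≥0) : Measurable (d.inj s) := by
  have h : ∀ u, Measurable fun w : ℝ≥0 → ℝ × E =>
      ENNReal.ofReal (d.D (gridIndex m u) w - (w u).1) := fun u =>
    ((d.measurable _).sub (measurable_pi_apply u).fst).ennreal_ofReal
  exact (h s).sup (Measurable.iSup fun n => h _)

/-- The dividends at the points of the grid which have the given values before taking running
maxima. -/
def GridDividend.ofSup {E : Type*} [MeasurableSpace E] (m : ℕ)
    (φ : ℕ → (ℝ≥0 → ℝ × E) → ℝ≥0∞) (hφ : ∀ k, Measurable (φ k)) (hφm : ∀ k w, φ k w ≤ m) :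
    GridDividend E m where
  D k w := (⨆ j, ⨆ (_ : j ≤ k), φ j (stopPath (gridPoint m j) w)).toReal
  measurable k := Measurable.ennreal_toReal (Measurable.iSup fun j => Measurable.iSup fun _ =>
    (hφ j).comp (measurable_stopPath _))
  mono w k l hkl := ENNReal.toReal_mono
    (ne_top_of_le_ne_top (ENNReal.natCast_ne_top m) (iSup₂_le fun j _ => hφm j _))
    (biSup_mono fun j hj => le_trans hj hkl)
  nonneg _ _ := ENNReal.toReal_nonneg
  le k w := by
    refine ENNReal.toReal_le_of_le_ofReal (Nat.cast_nonneg m) ?_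
    rw [ENNReal.ofReal_natCast]
    exact iSup₂_le fun j _ => hφm j _
  D_stopPath k w := by
    congr 1
    refine iSup_congr fun j => iSup_congr fun hj => ?_
    congr 1
    ext r : 1
    simp only [stopPath, min_assoc, min_eq_left (gridPoint_mono m hj)]

lemma GridDividend.ofReal_ofSup {E : Type*} [MeasurableSpace E] (m : ℕ)
    {φ : ℕ → (ℝ≥0 → ℝ × E) → ℝ≥0∞} (hφ : ∀ k, Measurable (φ k)) (hφm : ∀ k w, φ k w ≤ m) (k : ℕ)
    (w : ℝ≥0 → ℝ × E) : ENNReal.ofReal ((GridDividend.ofSup m φ hφ hφm).D k w) =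
      ⨆ j, ⨆ (_ : j ≤ k), φ j (stopPath (gridPoint m j) w) :=
  ENNReal.ofReal_toReal
    (ne_top_of_le_ne_top (ENNReal.natCast_ne_top m) (iSup₂_le fun j _ => hφm j _))

end grid

/-- Splitting `x` into positive and negative parts writes `d - x ≤ ρ` without subtraction, a form to
which conditional expectation in `[0, ∞]` applies. The next lemma is the way in, this one the way
out. -/
lemma ofReal_sub_le_of_add_le {d x : ℝ} (hd : 0 ≤ d) {ρ : ℝ≥0∞}
    (h : ENNReal.ofReal d + ENNReal.ofReal (-x) ≤ ρ + ENNReal.ofReal x) :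
    ENNReal.ofReal (d - x) ≤ ρ := by
  rcases le_total 0 x with hx | hx
  · rw [ENNReal.ofReal_sub _ hx, tsub_le_iff_right]
    exact le_self_add.trans h
  · rw [← ENNReal.ofReal_add hd (neg_nonneg.2 hx), ENNReal.ofReal_of_nonpos hx, add_zero] at h
    exact h

lemma ofReal_add_le_of_sub_le {d x r : ℝ} (hd : 0 ≤ d) (hr : 0 ≤ r) (h : d - x ≤ r) :
    ENNReal.ofReal d + ENNReal.ofReal (-x) ≤ ENNReal.ofReal r + ENNReal.ofReal x := by
  rcases le_total 0 x with hx | hx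
  · rw [ENNReal.ofReal_of_nonpos (neg_nonpos.2 hx), add_zero, ← ENNReal.ofReal_add hr hx]
    exact ENNReal.ofReal_le_ofReal (by linarith)
  · rw [ENNReal.ofReal_of_nonpos hx, add_zero, ← ENNReal.ofReal_add hd (neg_nonneg.2 hx)]
    exact ENNReal.ofReal_le_ofReal (by linarith)

/-! ### Projecting a strategy on the path. -/

section map

variable {E Ω : Type*} [TopologicalSpace E] [MeasurableSpace E] [MeasurableSpace Ω] {M : MAP E Ω}

/-- The dividends of a strategy, delayed to the grid and truncated, can be projected on the path of
`(X, Y)` without increasing the injections. -/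
theorem Strategy.exists_gridDividend (π : Strategy M) (z : ℝ × E) (m : ℕ) :
    ∃ d : GridDividend E m, ∀ (s : ℝ≥0) (F : (ℝ≥0 → ℝ × E) → ℝ≥0∞), Measurable F →
      ∫⁻ ω, ENNReal.ofReal (min (π.L ω (gridPoint m (gridIndex m s))) m) *
          F (fun t => M.Z t ω) ∂(M.P z) ≤
        ∫⁻ ω, ENNReal.ofReal (d.D (gridIndex m s) fun t => M.Z t ω) *
          F (fun t => M.Z t ω) ∂(M.P z) ∧
      ∫⁻ ω, d.inj s (fun t => M.Z t ω) * F (fun t => M.Z t ω) ∂(M.P z) ≤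
        ∫⁻ ω, ENNReal.ofReal (π.R ω s) * F (fun t => M.Z t ω) ∂(M.P z) := by
  have := M.isProb z
  set f : ℕ → Ω → ℝ≥0∞ := fun k ω => ENNReal.ofReal (min (π.L ω (gridPoint m k)) m) with hfdef
  have hf : ∀ k, Measurable[M.filt (gridPoint m k)] (f k) := fun k =>
    Measurable.ennreal_ofReal ((π.L_adapted (gridPoint m k)).inf_const (m : ℝ))
  have hf' : ∀ k, Measurable (f k) := fun k => (hf k).mono (M.filt.le _) le_rfl
  have hfm : ∀ k ω, f k ω ≤ m := fun k ω =>
    (ENNReal.ofReal_le_ofReal (min_le_right _ _)).trans_eq (ENNReal.ofReal_natCast m)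
  choose φ hφ hφm hφF using fun k =>
    exists_stopped_weight z (gridPoint m k) (hf k) (ENNReal.natCast_ne_top m) (hfm k)
  -- Conditional expectations need not be monotone in time on every path, so running maxima are
  -- taken. This can only raise dividends, and solvency at `u` controls the dividends at all earlier
  -- grid points, so the injection bound survives.
  refine ⟨GridDividend.ofSup m φ hφ hφm, fun s F hF => ⟨?_, ?_⟩⟩
  · rw [hφF _ F hF]
    refine lintegral_mono fun ω => ?_
    simp only []
    gcongr
    rw [GridDividend.ofReal_ofSup]
    exact le_iSup₂ (f := fun j (_ : j ≤ gridIndex m s) =>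
      φ j (stopPath (gridPoint m j) fun t => M.Z t ω)) _ le_rfl
  · have hRm : Measurable fun ω => ENNReal.ofReal (π.R ω s) :=
      ((π.R_adapted s).mono (M.filt.le s) le_rfl).ennreal_ofReal
    -- Here conditioning is on the whole path: `ρ` serves only as an upper bound and need not be
    -- non-anticipating.
    obtain ⟨ρ, hρ, hρF⟩ := exists_conditional_weight (μ := M.P z) (measurable_path (M := M)) hRm
    have hXm : ∀ u, Measurable fun w : ℝ≥0 → ℝ × E => ENNReal.ofReal (w u).1 := fun u =>
      (measurable_pi_apply u).fst.ennreal_ofReal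
    have hXm' : ∀ u, Measurable fun w : ℝ≥0 → ℝ × E => ENNReal.ofReal (-(w u).1) := fun u =>
      (measurable_pi_apply u).fst.neg.ennreal_ofReal
    have hφs : ∀ j, Measurable fun w : ℝ≥0 → ℝ × E => φ j (stopPath (gridPoint m j) w) :=
      fun j => (hφ j).comp (measurable_stopPath _)
    have hadd : ∀ g h k : Ω → ℝ≥0∞, Measurable g → Measurable k →
        ∫⁻ ω, (g ω + h ω) * k ω ∂(M.P z) =
          ∫⁻ ω, g ω * k ω ∂(M.P z) + ∫⁻ ω, h ω * k ω ∂(M.P z) := fun g h k hg hk => by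
      simp only [add_mul]
      exact lintegral_add_left (hg.mul hk) _
    have key : ∀ u ≤ s, ∀ᵐ ω ∂(M.P z), ∀ j ≤ gridIndex m u,
        φ j (stopPath (gridPoint m j) fun t => M.Z t ω) + ENNReal.ofReal (-(M.Z u ω).1) ≤
          ρ (fun t => M.Z t ω) + ENNReal.ofReal (M.Z u ω).1 := by
      intro u hu
      simp only [ae_all_iff]
      intro j hj
      refine ae_le_of_conditional_weight (μ := M.P z) (measurable_path (M := M))
        (f := fun ω => f j ω + ENNReal.ofReal (-(M.Z u ω).1))
        (g := fun ω => ENNReal.ofReal (π.R ω s) + ENNReal.ofReal (M.Z u ω).1)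
        (φ := fun w => φ j (stopPath (gridPoint m j) w) + ENNReal.ofReal (-(w u).1))
        (ψ := fun w => ρ w + ENNReal.ofReal (w u).1)
        ((hφs j).add (hXm' u)) (hρ.add (hXm u)) (fun F hF => ?_) (fun F hF => ?_) ?_
      · exact (hadd (f j) _ _ (hf' j) (hF.comp measurable_path)).trans ((congrArg (· + _)
          (hφF j F hF)).trans (hadd (fun ω => φ j (stopPath (gridPoint m j) fun t => M.Z t ω)) _ _
            ((hφs j).comp measurable_path) (hF.comp measurable_path)).symm)
      · exact (hadd (fun ω => ENNReal.ofReal (π.R ω s)) _ _ hRm (hF.comp measurable_path)).trans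
          ((congrArg (· + _) (hρF F hF)).trans (hadd (fun ω => ρ fun t => M.Z t ω) _ _
            (hρ.comp measurable_path) (hF.comp measurable_path)).symm)
      · filter_upwards [π.solvent z] with ω hω
        refine ofReal_add_le_of_sub_le (le_min (π.L_nonneg ω _) (Nat.cast_nonneg m))
          (π.R_nonneg ω s) ?_
        -- Dividends at a grid point before `u` are at most those at `u`, hence at most `X_u + R_u ≤
        -- X_u + R_s`.
        have h1 := (π.L ω).mono (gridPoint_le_iff.2 hj)
        have h2 := (π.R ω).mono hu
        have h3 := hω u
        simp only [MAP.X] at h3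
        linarith [min_le_left (π.L ω (gridPoint m j)) (m : ℝ)]
    have key' : ∀ u ≤ s, ∀ᵐ ω ∂(M.P z), ENNReal.ofReal ((GridDividend.ofSup m φ hφ hφm).D
        (gridIndex m u) (fun t => M.Z t ω) - (M.Z u ω).1) ≤ ρ (fun t => M.Z t ω) := by
      intro u hu
      filter_upwards [key u hu] with ω hω
      refine ofReal_sub_le_of_add_le (GridDividend.nonneg _ _ _) ?_
      rw [GridDividend.ofReal_ofSup]
      rw [ENNReal.biSup_add' (p := fun j => j ≤ gridIndex m u) ⟨0, Nat.zero_le _⟩]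
      exact iSup₂_le hω
    rw [hρF F hF]
    refine lintegral_mono_ae ?_
    filter_upwards [key' s le_rfl, ae_all_iff.2 fun n : ℕ =>
      key' (min (TopologicalSpace.denseSeq ℝ≥0 n) s) (min_le_right _ _)] with ω h1 h2
    gcongr
    exact sup_le h1 (iSup_le h2)

end map

/-! ### Mixing strategies from two starting points; concavity. -/

section map

variable {E Ω : Type*} [TopologicalSpace E] [MeasurableSpace E] [MeasurableSpace Ω] {M : MAP E Ω}

/-- Weights of a convex combination of two starting points, and the displacements of these points
from the combination. -/
structure Mixture (a b a₁ a₂ : ℝ) : Prop where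
  nonneg_left : 0 ≤ a
  nonneg_right : 0 ≤ b
  add_eq : a + b = 1
  balance : a * a₁ + b * a₂ = 0

section mix

variable {m : ℕ} {a b a₁ a₂ : ℝ} (h : Mixture a b a₁ a₂) (d₁ d₂ : GridDividend E m)

variable (M) in
/-- The convex combination of the dividends `d₁` for the path of `(X + a₁, Y)` and of the dividends
`d₂` for the path of `(X + a₂, Y)`. -/
def mixDividend (ω : Ω) : StieltjesFunction ℝ≥0 :=
  gridPath m (fun k => a * d₁.D k (shiftPath M a₁ ω) + b * d₂.D k (shiftPath M a₂ ω))
    fun _ _ hkl => add_le_add (mul_le_mul_of_nonneg_left (d₁.mono _ hkl) h.nonneg_left)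
      (mul_le_mul_of_nonneg_left (d₂.mono _ hkl) h.nonneg_right)

lemma mixDividend_apply (ω : Ω) (t : ℝ≥0) :
    mixDividend M h d₁ d₂ ω t = a * d₁.D (gridIndex m t) (shiftPath M a₁ ω) +
      b * d₂.D (gridIndex m t) (shiftPath M a₂ ω) := rfl

lemma mixDividend_nonneg (ω : Ω) (t : ℝ≥0) : 0 ≤ mixDividend M h d₁ d₂ ω t :=
  add_nonneg (mul_nonneg h.nonneg_left (d₁.nonneg _ _)) (mul_nonneg h.nonneg_right (d₂.nonneg _ _))

lemma mixDividend_le (ω : Ω) (t : ℝ≥0) : mixDividend M h d₁ d₂ ω t ≤ m := by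
  rw [mixDividend_apply]
  calc _ ≤ a * m + b * m := add_le_add
        (mul_le_mul_of_nonneg_left (d₁.le _ _) h.nonneg_left)
        (mul_le_mul_of_nonneg_left (d₂.le _ _) h.nonneg_right)
    _ = m := by rw [← add_mul, h.add_eq, one_mul]

/-- The dividend sees only the path stopped at the last grid point, which is at most `t`. -/
lemma GridDividend.measurable_shiftPath (d : GridDividend E m) (c : ℝ) (t : ℝ≥0) :
    Measurable[M.filt t] fun ω => d.D (gridIndex m t) (shiftPath M c ω) := by
  have h1 : (fun ω => d.D (gridIndex m t) (shiftPath M c ω)) = fun ω => d.D (gridIndex m t)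
      (stopPath (gridPoint m (gridIndex m t)) (shiftPath M c ω)) := by
    ext ω
    rw [d.D_stopPath]
  rw [h1]
  refine (d.measurable _).comp (@measurable_pi_lambda _ _ _ (M.filt t) _ _ fun r => ?_)
  exact (((measurable_X _).add_const c).prodMk (measurable_Y _)).mono
    (M.filt.mono ((min_le_right _ _).trans (gridPoint_le_iff.2 le_rfl))) le_rfl

lemma measurable_mixDividend (t : ℝ≥0) :
    Measurable[M.filt t] fun ω => mixDividend M h d₁ d₂ ω t :=
  ((d₁.measurable_shiftPath a₁ t).const_mul a).add ((d₂.measurable_shiftPath a₂ t).const_mul b)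

variable (M) in
/-- The strategy which pays a convex combination of two dividend streams. -/
def mixStrategy : Strategy M :=
  minStrategy M (mixDividend M h d₁ d₂) m (mixDividend_nonneg h d₁ d₂) (mixDividend_le h d₁ d₂)
    (measurable_mixDividend h d₁ d₂)

lemma ofReal_mixStrategy_L (ω : Ω) (t : ℝ≥0) :
    ENNReal.ofReal ((mixStrategy M h d₁ d₂).L ω t) =
      ENNReal.ofReal a * ENNReal.ofReal (d₁.D (gridIndex m t) (shiftPath M a₁ ω)) +
      ENNReal.ofReal b * ENNReal.ofReal (d₂.D (gridIndex m t) (shiftPath M a₂ ω)) := by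
  rw [show (mixStrategy M h d₁ d₂).L ω t = mixDividend M h d₁ d₂ ω t from rfl, mixDividend_apply,
    ENNReal.ofReal_add (mul_nonneg h.nonneg_left (d₁.nonneg _ _))
      (mul_nonneg h.nonneg_right (d₂.nonneg _ _)), ENNReal.ofReal_mul h.nonneg_left,
    ENNReal.ofReal_mul h.nonneg_right]

/-- As the weights sum to one and the weighted displacements cancel, the shortfall of the mixture is
the mixture of the shortfalls. Positive parts are subadditive, and each is bounded by its own
running supremum. -/
lemma ofReal_mixStrategy_R_le (ω : Ω) (t : ℝ≥0) :
    ENNReal.ofReal ((mixStrategy M h d₁ d₂).R ω t) ≤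
      ENNReal.ofReal a * d₁.inj t (shiftPath M a₁ ω) +
      ENNReal.ofReal b * d₂.inj t (shiftPath M a₂ ω) := by
  have key : ∀ u, ENNReal.ofReal (mixDividend M h d₁ d₂ ω u - M.X u ω) ≤
      ENNReal.ofReal a * ENNReal.ofReal
        (d₁.D (gridIndex m u) (shiftPath M a₁ ω) - (shiftPath M a₁ ω u).1) +
      ENNReal.ofReal b * ENNReal.ofReal
        (d₂.D (gridIndex m u) (shiftPath M a₂ ω) - (shiftPath M a₂ ω u).1) := by
    intro u
    rw [← ENNReal.ofReal_mul h.nonneg_left, ← ENNReal.ofReal_mul h.nonneg_right]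
    refine le_trans (ENNReal.ofReal_le_ofReal (le_of_eq ?_)) ENNReal.ofReal_add_le
    rw [mixDividend_apply]
    simp only [shiftPath]
    linear_combination (M.X u ω) * h.add_eq + h.balance
  unfold mixStrategy
  rw [ofReal_minStrategy_R, iSup_Iic_eq_of_rightCont
    (f := fun u => ENNReal.ofReal (mixDividend M h d₁ d₂ ω u - M.X u ω))
    (fun t => ENNReal.continuous_ofReal.continuousAt.comp_continuousWithinAt
      (rightCont_sub_X _ ω t))]
  refine sup_le ((key t).trans ?_) (iSup_le fun n => (key _).trans ?_)
  · gcongr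
    · exact le_sup_left
    · exact le_sup_left
  · gcongr
    · exact le_sup_of_le_right (le_iSup (fun n => ENNReal.ofReal
        (d₁.D (gridIndex m (min (TopologicalSpace.denseSeq ℝ≥0 n) t)) (shiftPath M a₁ ω) -
          (shiftPath M a₁ ω (min (TopologicalSpace.denseSeq ℝ≥0 n) t)).1)) n)
    · exact le_sup_of_le_right (le_iSup (fun n => ENNReal.ofReal
        (d₂.D (gridIndex m (min (TopologicalSpace.denseSeq ℝ≥0 n) t)) (shiftPath M a₂ ω) -
          (shiftPath M a₂ ω (min (TopologicalSpace.denseSeq ℝ≥0 n) t)).1)) n)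

end mix

/-- the dividends of a strategy, delayed to the grid and truncated -/
def Strategy.gridL (π : Strategy M) (m : ℕ) (s : ℝ≥0) (ω : Ω) : ℝ≥0∞ :=
  ENNReal.ofReal (min (π.L ω (gridPoint m (gridIndex m s))) m)

lemma Strategy.measurable_gridL (π : Strategy M) (m : ℕ) :
    Measurable fun p : ℝ≥0 × Ω => π.gridL m p.1 p.2 := by
  have h1 : Measurable fun p : ℝ≥0 × Ω => gridPoint m (gridIndex m p.1) :=
    (measurable_of_countable (gridPoint m)).comp ((measurable_gridIndex m).comp measurable_fst)
  exact ((π.measurable_L.comp (h1.prodMk measurable_snd)).min measurable_const).ennreal_ofReal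

variable [BorelSpace E] [RadonSpace E] {q : E → ℝ} {q₀ : ℝ}

/-- Discounting depends on `Y` only, so translating `X` leaves it unchanged. -/
lemma exists_dens_eq_path (hq : Measurable q) (s : ℝ≥0) :
    ∃ F : (ℝ≥0 → ℝ × E) → ℝ≥0∞, Measurable F ∧ (∀ ω, F (fun t => M.Z t ω) = dens M q s ω) ∧
      ∀ c ω, F (shiftPath M c ω) = dens M q s ω := by
  obtain ⟨Ψ, hΨ, h⟩ := exists_dens_eq_comp (M := M) hq s
  exact ⟨fun w => Ψ fun t => (w t).2,
    hΨ.comp (measurable_pi_lambda _ fun t => (measurable_pi_apply t).snd),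
    fun ω => (h ω).symm, fun c ω => (h ω).symm⟩

lemma lintegral_shiftPath_mul_dens (hq : Measurable q) (s : ℝ≥0) {G : (ℝ≥0 → ℝ × E) → ℝ≥0∞}
    (hG : Measurable G) (c x : ℝ) (y : E) :
    ∫⁻ ω, G (shiftPath M c ω) * dens M q s ω ∂(M.P (x, y)) =
      ∫⁻ ω, G (fun t => M.Z t ω) * dens M q s ω ∂(M.P (x + c, y)) := by
  obtain ⟨F, hF, h1, h2⟩ := exists_dens_eq_path (M := M) hq s
  have h3 := lintegral_shiftPath (M := M) (hG.mul hF) c x y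
  simpa only [h1, h2, Pi.mul_apply] using h3

/-- Integrating in time a combination of expectations under two initial states. -/
lemma add_discInt_eq (hq : Measurable q) {g₁ g₂ : ℝ≥0 → Ω → ℝ≥0∞}
    (hg₁ : Measurable fun p : ℝ≥0 × Ω => g₁ p.1 p.2)
    (hg₂ : Measurable fun p : ℝ≥0 × Ω => g₂ p.1 p.2) (α β : ℝ≥0∞) (z₁ z₂ : ℝ × E) :
    α * discInt M q g₁ z₁ + β * discInt M q g₂ z₂ =
      ∫⁻ s, (α * ∫⁻ ω, g₁ s ω * dens M q s ω ∂(M.P z₁) +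
        β * ∫⁻ ω, g₂ s ω * dens M q s ω ∂(M.P z₂)) ∂nnVol := by
  have := M.isProb z₁
  have := M.isProb z₂
  have h1 : Measurable fun s => ∫⁻ ω, g₁ s ω * dens M q s ω ∂(M.P z₁) :=
    (hg₁.mul (measurable_dens hq)).lintegral_prod_right'
  have h2 : Measurable fun s => ∫⁻ ω, g₂ s ω * dens M q s ω ∂(M.P z₂) :=
    (hg₂.mul (measurable_dens hq)).lintegral_prod_right'
  rw [discInt_eq_swap hq hg₁, discInt_eq_swap hq hg₂, lintegral_add_left (h1.const_mul _),
    lintegral_const_mul _ h1, lintegral_const_mul _ h2]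

namespace Standing

variable (H : Standing M q q₀)
include H

/-- A strategy from a convex combination of two starting points which does at least as well as the
combination of two given strategies, up to the discretization of their dividends. -/
lemma exists_mixStrategy {a b a₁ a₂ : ℝ} (h : Mixture a b a₁ a₂) (π₁ π₂ : Strategy M) (m : ℕ)
    (x : ℝ) (y : E) :
    ∃ π : Strategy M, π.Admissible q ∧
      ENNReal.ofReal a * discInt M q (π₁.gridL m) (x + a₁, y) +
        ENNReal.ofReal b * discInt M q (π₂.gridL m) (x + a₂, y) ≤ π.vL q (x, y) ∧
      π.vR q (x, y) ≤ ENNReal.ofReal a * π₁.vR q (x + a₁, y) +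
        ENNReal.ofReal b * π₂.vR q (x + a₂, y) := by
  have hq := H.measurable
  obtain ⟨d₁, hd₁⟩ := π₁.exists_gridDividend (x + a₁, y) m
  obtain ⟨d₂, hd₂⟩ := π₂.exists_gridDividend (x + a₂, y) m
  refine ⟨mixStrategy M h d₁ d₂, H.admissible_minStrategy _ _ _, ?_, ?_⟩
  · rw [H.vL_eq, add_discInt_eq hq (π₁.measurable_gridL m) (π₂.measurable_gridL m),
      discInt_eq_swap hq (Strategy.measurable_L _).ennreal_ofReal]
    refine lintegral_mono fun s => ?_
    -- At fixed time `s` the discounting density is a functional of the path, hence an allowed test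
    -- function for the projection.
    obtain ⟨F, hF, hFZ, -⟩ := exists_dens_eq_path (M := M) hq s
    have h1 := (hd₁ s F hF).1
    have h2 := (hd₂ s F hF).1
    have hm : ∀ (d : GridDividend E m) c, Measurable fun ω =>
        ENNReal.ofReal (d.D (gridIndex m s) (shiftPath M c ω)) * dens M q s ω := fun d c =>
      ((d.measurable _).comp (measurable_shiftPath c)).ennreal_ofReal.mul
        ((measurable_dens hq).comp (measurable_const.prodMk measurable_id))
    simp only [hFZ] at h1 h2
    simp only [ofReal_mixStrategy_L, add_mul, mul_assoc]
    rw [lintegral_add_left ((hm d₁ a₁).const_mul _), lintegral_const_mul _ (hm d₁ a₁),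
      lintegral_const_mul _ (hm d₂ a₂),
      lintegral_shiftPath_mul_dens hq s (d₁.measurable _).ennreal_ofReal,
      lintegral_shiftPath_mul_dens hq s (d₂.measurable _).ennreal_ofReal]
    exact add_le_add (mul_le_mul_right h1 _) (mul_le_mul_right h2 _)
  · rw [H.vR_eq, H.vR_eq, H.vR_eq, add_discInt_eq hq (π₁.measurable_R).ennreal_ofReal
      (π₂.measurable_R).ennreal_ofReal, discInt_eq_swap hq (Strategy.measurable_R _).ennreal_ofReal]
    refine lintegral_mono fun s => ?_
    obtain ⟨F, hF, hFZ, -⟩ := exists_dens_eq_path (M := M) hq s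
    have h1 := (hd₁ s F hF).2
    have h2 := (hd₂ s F hF).2
    have hm : ∀ (d : GridDividend E m) c, Measurable fun ω =>
        d.inj s (shiftPath M c ω) * dens M q s ω := fun d c =>
      ((d.measurable_inj s).comp (measurable_shiftPath c)).mul
        ((measurable_dens hq).comp (measurable_const.prodMk measurable_id))
    simp only [hFZ] at h1 h2
    calc _ ≤ ∫⁻ ω, (ENNReal.ofReal a * (d₁.inj s (shiftPath M a₁ ω) * dens M q s ω) +
          ENNReal.ofReal b * (d₂.inj s (shiftPath M a₂ ω) * dens M q s ω)) ∂(M.P (x, y)) := by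
          refine lintegral_mono fun ω => ?_
          simp only [← mul_assoc, ← add_mul]
          gcongr
          exact ofReal_mixStrategy_R_le h d₁ d₂ ω s
      _ ≤ _ := by
          rw [lintegral_add_left ((hm d₁ a₁).const_mul _), lintegral_const_mul _ (hm d₁ a₁),
            lintegral_const_mul _ (hm d₂ a₂),
            lintegral_shiftPath_mul_dens hq s (d₁.measurable_inj s),
            lintegral_shiftPath_mul_dens hq s (d₂.measurable_inj s)]
          gcongr

lemma discInt_gridL_le (π : Strategy M) (m : ℕ) (z : ℝ × E) :
    discInt M q (π.gridL m) z ≤ π.vL q z := by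
  rw [H.vL_eq]
  exact discInt_mono (ae_of_all _ fun ω s => ENNReal.ofReal_le_ofReal
    ((min_le_left _ _).trans ((π.L ω).mono (gridPoint_le_iff.2 le_rfl))))

lemma tendsto_discInt_gridL (π : Strategy M) (z : ℝ × E) :
    Tendsto (fun m => discInt M q (π.gridL m) z) atTop (𝓝 (π.vL q z)) := by
  rw [H.vL_eq]
  refine tendsto_discInt H.measurable π.L z _ π.measurable_gridL (fun m s ω =>
    ENNReal.ofReal_le_ofReal ((min_le_left _ _).trans ((π.L ω).mono (gridPoint_le_iff.2 le_rfl))))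
    (ae_of_all _ fun ω u s hus => ?_)
  filter_upwards [eventually_le_gridPoint hus] with m hm
  rw [Strategy.gridL, ← ENNReal.ofReal_natCast, ← ENNReal.ofReal_min]
  exact ENNReal.ofReal_le_ofReal (min_le_min_right _ ((π.L ω).mono hm))

lemma value_le_toReal_valueCC {β : ℝ} (hβ : 1 < β) {π : Strategy M} (hπ : π.Admissible q)
    (z : ℝ × E) : (π.vL q z).toReal - β * (π.vR q z).toReal ≤ (valueCC M q β z).toReal := by
  have h1 := le_iSup₂ (f := fun (π : Strategy M) (_ : π.Admissible q) => π.value q β z) π hπ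
  rw [H.value_eq hπ] at h1
  exact EReal.toReal_le_toReal h1 (EReal.coe_ne_bot _) (H.valueCC_ne_top hβ z)

/-- The mixed strategy varies with the grid, but its value never exceeds the value function and its
injection bound is independent of `m`; only the discretized dividends pass to the limit. -/
lemma add_value_le {β : ℝ} (hβ : 1 < β) {a b a₁ a₂ : ℝ} (h : Mixture a b a₁ a₂)
    {π₁ π₂ : Strategy M} (hπ₁ : π₁.Admissible q) (hπ₂ : π₂.Admissible q) (x : ℝ) (y : E) :
    a * ((π₁.vL q (x + a₁, y)).toReal - β * (π₁.vR q (x + a₁, y)).toReal) +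
      b * ((π₂.vL q (x + a₂, y)).toReal - β * (π₂.vR q (x + a₂, y)).toReal) ≤
      (valueCC M q β (x, y)).toReal := by
  have hlim : ∀ {π : Strategy M}, π.Admissible q → ∀ z,
      Tendsto (fun m => (discInt M q (π.gridL m) z).toReal) atTop (𝓝 (π.vL q z).toReal) :=
    fun hπ z => (ENNReal.tendsto_toReal (H.vL_lt_top hπ z).ne).comp (H.tendsto_discInt_gridL _ z)
  refine le_of_tendsto (((hlim hπ₁ (x + a₁, y)).sub_const _ |>.const_mul a).add
    ((hlim hπ₂ (x + a₂, y)).sub_const _ |>.const_mul b)) (.of_forall fun m => ?_)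
  obtain ⟨π, hπ, hL, hR⟩ := H.exists_mixStrategy h π₁ π₂ m x y
  have hg₁ := ((H.discInt_gridL_le π₁ m (x + a₁, y)).trans_lt (H.vL_lt_top hπ₁ _)).ne
  have hg₂ := ((H.discInt_gridL_le π₂ m (x + a₂, y)).trans_lt (H.vL_lt_top hπ₂ _)).ne
  have hadd : ∀ {p r : ℝ≥0∞}, p ≠ ⊤ → r ≠ ⊤ →
      (ENNReal.ofReal a * p + ENNReal.ofReal b * r).toReal = a * p.toReal + b * r.toReal := by
    intro p r hp hr
    rw [ENNReal.toReal_add (ENNReal.mul_ne_top ENNReal.ofReal_ne_top hp)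
      (ENNReal.mul_ne_top ENNReal.ofReal_ne_top hr), ENNReal.toReal_mul, ENNReal.toReal_mul,
      ENNReal.toReal_ofReal h.nonneg_left, ENNReal.toReal_ofReal h.nonneg_right]
  have hL' := ENNReal.toReal_mono (H.vL_lt_top hπ (x, y)).ne hL
  have hR' := ENNReal.toReal_mono (ENNReal.add_ne_top.2
    ⟨ENNReal.mul_ne_top ENNReal.ofReal_ne_top (hπ₁ (x + a₁, y)).ne,
      ENNReal.mul_ne_top ENNReal.ofReal_ne_top (hπ₂ (x + a₂, y)).ne⟩) hR
  rw [hadd hg₁ hg₂] at hL'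
  rw [hadd (hπ₁ _).ne (hπ₂ _).ne] at hR'
  have h3 := H.value_le_toReal_valueCC hβ hπ (x, y)
  have h4 := mul_le_mul_of_nonneg_left hR' (zero_lt_one.trans hβ).le
  linarith

lemma exists_lt_value {β : ℝ} (hβ : 1 < β) (C : PoissonClocks M) (z : ℝ × E) {ε : ℝ}
    (hε : 0 < ε) : ∃ π : Strategy M, π.Admissible q ∧
      (valueCC M q β z).toReal - ε < (π.vL q z).toReal - β * (π.vR q z).toReal := by
  have h1 : (((valueCC M q β z).toReal - ε : ℝ) : EReal) < valueCC M q β z := by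
    conv_rhs => rw [← EReal.coe_toReal (H.valueCC_ne_top hβ z) (H.valueCC_ne_bot β C z)]
    exact EReal.coe_lt_coe_iff.2 (sub_lt_self _ hε)
  obtain ⟨π, hπ⟩ := lt_iSup_iff.1 h1
  obtain ⟨hπa, hπ⟩ := lt_iSup_iff.1 hπ
  rw [H.value_eq hπa, EReal.coe_lt_coe_iff] at hπ
  exact ⟨π, hπa, hπ⟩

theorem concaveOn_valueCC {β : ℝ} (hβ : 1 < β) (C : PoissonClocks M) (y : E) :
    ConcaveOn ℝ univ fun x : ℝ => (valueCC M q β (x, y)).toReal := by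
  refine ⟨convex_univ, fun x₁ _ x₂ _ a b ha hb hab => ?_⟩
  simp only [smul_eq_mul]
  refine le_of_forall_pos_le_add fun ε hε => ?_
  obtain ⟨π₁, hπ₁, h1⟩ := H.exists_lt_value hβ C (x₁, y) hε
  obtain ⟨π₂, hπ₂, h2⟩ := H.exists_lt_value hβ C (x₂, y) hε
  set x := a * x₁ + b * x₂ with hx
  -- Displacements are measured from the combined starting point, so their weighted sum vanishes.
  have hmix : Mixture a b (x₁ - x) (x₂ - x) := ⟨ha, hb, hab, by
    linear_combination -hx - x * hab⟩
  have h3 := H.add_value_le hβ hmix hπ₁ hπ₂ x y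
  simp only [add_sub_cancel] at h3
  have h4 := mul_le_mul_of_nonneg_left h1.le ha
  have h5 := mul_le_mul_of_nonneg_left h2.le hb
  have h6 : a * ε + b * ε = ε := by rw [← add_mul, hab, one_mul]
  linarith

end Standing

end map

end Dividend

end

theorem mainTheorem9 {E Ω : Type*} [TopologicalSpace E] [MeasurableSpace E] [BorelSpace E]
    [Dividend.RadonSpace E] [MeasurableSpace Ω]
    (M : Dividend.MAP E Ω) (C : Dividend.PoissonClocks M)
    (hM : (⨆ y : E, ∫⁻ ω, (⨆ s ∈ Icc (0 : ℝ≥0) 1, ‖M.X s ω‖ₑ) ∂(M.P (0, y))) < ⊤)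
    (q : E → ℝ) (hq : Measurable q) (q₀ : ℝ) (hq₀ : 0 < q₀) (hqq₀ : ∀ y, q₀ < q y)
    (hfin : ∀ z, ∀ᵐ ω ∂(M.P z), ∀ t : ℝ≥0, Dividend.cumDiscount M q t ω < ⊤)
    (β : ℝ) (hβ : 1 < β) :
    (∀ (x : ℝ) (y : E),
      (∀ m n : ℕ, 1 ≤ m → m ≤ n →
        Dividend.valuePoisson M C q β m (x, y) ≤ Dividend.valuePoisson M C q β n (x, y)) ∧
      Tendsto (fun n : ℕ => Dividend.valuePoisson M C q β n (x, y)) atTop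
        (𝓝 (Dividend.valueCC M q β (x, y)))) ∧
    (∀ (x : ℝ) (y : E),
      (∀ n : ℕ, 1 ≤ n → Dividend.valuePoisson M C q β n (x, y) ≠ ⊥ ∧
        Dividend.valuePoisson M C q β n (x, y) ≠ ⊤) ∧
      Dividend.valueCC M q β (x, y) ≠ ⊥ ∧ Dividend.valueCC M q β (x, y) ≠ ⊤) ∧
    (∀ y : E, ConcaveOn ℝ univ (fun x : ℝ => (Dividend.valueCC M q β (x, y)).toReal)) := by
  have H : Dividend.Standing M q q₀ := ⟨hM, hq, hq₀, hqq₀, hfin⟩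
  refine ⟨fun x y => ⟨fun m n _ hmn => Dividend.valuePoisson_mono C q β hmn (x, y),
    H.tendsto_valuePoisson C β (x, y)⟩, fun x y => ⟨fun n _ => ⟨H.valuePoisson_ne_bot C β n (x, y),
    ne_top_of_le_ne_top (H.valueCC_ne_top hβ (x, y))
      (Dividend.valuePoisson_le_valueCC M C q β n (x, y))⟩,
    H.valueCC_ne_bot β C (x, y), H.valueCC_ne_top hβ (x, y)⟩, fun y => H.concaveOn_valueCC hβ C y⟩
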